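/- Let $\Lambda=(-1,1)$, $k\in\mathbb N$, $s\in(k-1,k)$, $\omega^{(a,b)}(x)=(1-x)^a(1+x)^b$, let $\|\cdot\|_{\omega^{(a,b)}}$ be the norm of $L^2_{\omega^{(a,b)}}(\Lambda)$ and $(\cdot,\cdot)$ the $L^2(\Lambda)$ pairing. For $r\ge 0$ and $n=\lfloor r\rfloor+1$ let $$D_+^r v=(-1)^nD^n I_+^{n-r}v,\qquad I_+^\rho v(x)=\frac1{\Gamma(\rho)}\int_x^1 (y-x)^{\rho-1}v(y)\,dy ,$$ with $D^n$ the weak derivative on $\Lambda$. Consider $D_+^{s+k}u=f$ in $\Lambda$, $u^{(l)}(\pm1)=0$ for $0\le l\le k-1$, in weak form. Let $$\|u\|_U=\big(\|u\|^2_{\omega^{(-s,-k)}}+\|D_+^su\|^2_{\omega^{(0,s-k)}}\big)^{1/2},$$ let $U$ be the set of $u\in L^2_{\omega^{(-s,-k)}}(\Lambda)$ with $D_+^su\in L^2_{\omega^{(0,s-k)}}(\Lambda)$ that satisfy the boundary conditions in the sense that $u$ lies in the closure of $C_c^\infty(\Lambda)$ in $\|\cdot\|_U$, and let $V$ be the set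 of $v\in L^2_{\omega^{(-k,-s)}}(\Lambda)$ with $D^kv\in L^2_{\omega^{(0,k-s)}}(\Lambda)$ and $v^{(l)}(\pm1)=0$ for $0\le l\le k-1$ (such $v$ are of class $C^{k-1}$ on $[-1,1]$). Let $f$ be a function for which $fv$ is integrable on $\Lambda$ for all $v\in V$, let $u\in U$ satisfy $$(D_+^su,D^kv)=(f,v)\qquad\forall v\in V,$$ and let $u_N\in{}^+\mathcal F_N=\{(1-x)^s\psi:\ \psi\in\mathcal P_N,\ \psi^{(l)}(-1)=0,\ 0\le l\le k-1\}$ satisfy $$(D_+^su_N,D^kv_N)=(f,v_N)\qquad\forall v_N\in{}^-\mathcal F_N=\{(1+x)^s\psi:\ \psi\in\mathcal P_N,\ \psi^{(l)}(1)=0,\ 0\le l\le k-1\},$$ where $\mathcal P_N$ is the space of real polynomials of degree at most $N$. Let $0\le m\le N$. (i) If $D_+^{s+l}u\in L^2_{\omega^{(l,s-k+l)}}(\Lambda)$ for $0\le l\le m$, then $$\|u-u_N\|_U\le c\,N^{-m}\,\|D_+^{s+m}u\|_{\omega^{(m,s-k+m)}} .$$ (ii) If $m\ge k$ and $f^{(m-k)}\in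 L^2_{\omega^{(m,s-k+m)}}(\Lambda)$, then $$\|u-u_N\|_U\le c\,N^{-m}\,\|f^{(m-k)}\|_{\omega^{(m,s-k+m)}} .$$ Here $c>0$ depends only on $s,k,m$ (not on $u,f,N$), and $0^0=1$. Moreover, both estimates hold with $c\,N^{-m}$ replaced by $C\,N^{-m/2}\sqrt{(N-m+1)!/(N+1)!}$, where $C>0$ depends only on $s,k$. -/

import Mathlib

open MeasureTheory Set

noncomputable section

namespace GJF

/-- The interval `Λ = (-1, 1)`. -/
def Lam : Set ℝ := Ioo (-1) 1

/-- The Jacobi weight `ω^{(a,b)}(x) = (1 - x)^a (1 + x)^b`, for `x ∈ Λ`. -/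
def weight (a b x : ℝ) : ℝ := (1 - x) ^ a * (1 + x) ^ b

/-- `u ∈ L²_{ω^{(a,b)}}(Λ)`. -/
def MemL2w (a b : ℝ) (u : ℝ → ℝ) : Prop :=
  AEStronglyMeasurable u (volume.restrict Lam) ∧
    IntegrableOn (fun x => u x ^ 2 * weight a b x) Lam

/-- The norm of `L²_{ω^{(a,b)}}(Λ)`. -/
def normL2w (a b : ℝ) (u : ℝ → ℝ) : ℝ :=
  √(∫ x in Lam, u x ^ 2 * weight a b x)

/-- The test functions `C_c^∞(Λ)`. -/
def IsTestFun (φ : ℝ → ℝ) : Prop :=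
  ContDiff ℝ ((⊤ : ℕ∞) : WithTop ℕ∞) φ ∧ HasCompactSupport φ ∧ tsupport φ ⊆ Lam

/-- `g` is the weak derivative of order `n` of `w` on `Λ`. -/
def IsWeakDeriv (n : ℕ) (w g : ℝ → ℝ) : Prop :=
  LocallyIntegrableOn w Lam ∧ LocallyIntegrableOn g Lam ∧
    ∀ φ : ℝ → ℝ, IsTestFun φ →
      ∫ x in Lam, w x * iteratedDeriv n φ x = (-1) ^ n * ∫ x in Lam, g x * φ x

/-- `w` has a weak derivative of order `n` on `Λ`. -/
def HasWeakDeriv (n : ℕ) (w : ℝ → ℝ) : Prop := ∃ g, IsWeakDeriv n w g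

open Classical in
/-- The weak derivative `D^n w` on `Λ` (a representative; it is unique up to null sets). -/
def weakDeriv (n : ℕ) (w : ℝ → ℝ) : ℝ → ℝ :=
  if h : HasWeakDeriv n w then h.choose else 0

/-- The right fractional integral `I_+^ρ v(x) = Γ(ρ)⁻¹ ∫_x^1 v(y) (y - x)^{ρ-1} dy`, `ρ > 0`. -/
def fracInt (ρ : ℝ) (v : ℝ → ℝ) (x : ℝ) : ℝ :=
  (Real.Gamma ρ)⁻¹ * ∫ y in x..1, v y * (y - x) ^ (ρ - 1)

/-- The right Riemann-Liouville derivative `D_+^r u = (-1)^n D^n I_+^{n-r} u`, where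
`r ∈ [n-1, n)` (that is, `n = ⌊r⌋ + 1`), exists, with `D^n` taken in the weak sense. -/
def HasRL (r : ℝ) (u : ℝ → ℝ) : Prop :=
  IntegrableOn u Lam ∧
    HasWeakDeriv (⌊r⌋₊ + 1) (fracInt (((⌊r⌋₊ + 1 : ℕ) : ℝ) - r) u)

/-- The right Riemann-Liouville derivative `D_+^r u`, for `r ≥ 0`. -/
def rlDeriv (r : ℝ) (u : ℝ → ℝ) (x : ℝ) : ℝ :=
  (-1) ^ (⌊r⌋₊ + 1) *
    weakDeriv (⌊r⌋₊ + 1) (fracInt (((⌊r⌋₊ + 1 : ℕ) : ℝ) - r) u) x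

/-- `‖u‖_U = (‖u‖²_{ω^{(-s,-k)}} + ‖D_+^s u‖²_{ω^{(0,s-k)}})^{1/2}`. -/
def normU (s : ℝ) (k : ℕ) (u : ℝ → ℝ) : ℝ :=
  √(normL2w (-s) (-k) u ^ 2 + normL2w 0 (s - k) (rlDeriv s u) ^ 2)

/-- The solution space `U`: `u ∈ L²_{ω^{(-s,-k)}}(Λ)` with `D_+^s u ∈ L²_{ω^{(0,s-k)}}(Λ)`, and
the homogeneous boundary conditions `u^{(l)}(±1) = 0`, `0 ≤ l ≤ k - 1`. The conditions are
understood, as in the spaces `H_0^k`, as membership in the closure of `C_c^∞(Λ)` in the norm of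
`U`, because `u^{(k-1)}` need not have boundary values if `s - k + 1 ≤ 1/2`. -/
def MemU (s : ℝ) (k : ℕ) (u : ℝ → ℝ) : Prop :=
  MemL2w (-s) (-k) u ∧ HasRL s u ∧ MemL2w 0 (s - k) (rlDeriv s u) ∧
    ∀ ε > 0, ∃ φ : ℝ → ℝ, IsTestFun φ ∧ normU s k (fun x => u x - φ x) < ε

/-- The test space `V`: `v ∈ L²_{ω^{(-k,-s)}}(Λ)` with `D^k v ∈ L²_{ω^{(0,k-s)}}(Λ)`, and the
homogeneous boundary conditions `v^{(l)}(±1) = 0`, `0 ≤ l ≤ k - 1`. Here `D^k v` is integrable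
on `Λ` for `k - 1 < s < k`, so `v` is (has a representative) of class `C^{k-1}` on `[-1, 1]`. -/
def MemV (s : ℝ) (k : ℕ) (v : ℝ → ℝ) : Prop :=
  MemL2w (-k) (-s) v ∧ HasWeakDeriv k v ∧ MemL2w 0 (k - s) (weakDeriv k v) ∧
    ContDiffOn ℝ ((k - 1 : ℕ) : WithTop ℕ∞) v (Icc (-1) 1) ∧
    ∀ l < k, iteratedDerivWithin l v (Icc (-1) 1) (-1) = 0 ∧
      iteratedDerivWithin l v (Icc (-1) 1) 1 = 0

/-- `a(u, v) = (D_+^s u, D^k v)`. -/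
def bilin (s : ℝ) (k : ℕ) (u v : ℝ → ℝ) : ℝ :=
  ∫ x in Lam, rlDeriv s u x * weakDeriv k v x

/-- The trial space `⁺F_N^{(-s,-k)}(Λ)`: functions `(1 - x)^s ψ` with `ψ ∈ P_N` and
`ψ^{(l)}(-1) = 0` for `0 ≤ l ≤ k - 1`. -/
def MemFplus (s : ℝ) (k N : ℕ) (φ : ℝ → ℝ) : Prop :=
  ∃ ψ : Polynomial ℝ, ψ.natDegree ≤ N ∧
    (∀ l < k, (Polynomial.derivative^[l] ψ).eval (-1) = 0) ∧
    EqOn φ (fun x => (1 - x) ^ s * ψ.eval x) Lam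

/-- The test space `⁻F_N^{(-k,-s)}(Λ)`: functions `(1 + x)^s ψ` with `ψ ∈ P_N` and
`ψ^{(l)}(1) = 0` for `0 ≤ l ≤ k - 1`. -/
def MemFminus (s : ℝ) (k N : ℕ) (φ : ℝ → ℝ) : Prop :=
  ∃ ψ : Polynomial ℝ, ψ.natDegree ≤ N ∧
    (∀ l < k, (Polynomial.derivative^[l] ψ).eval 1 = 0) ∧
    EqOn φ (fun x => (1 + x) ^ s * ψ.eval x) Lam

/-- `u ∈ U` solves `a(u, v) = (f, v)` for all `v ∈ V`; the pairings `(f, v)` are finite. -/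
def IsWeakSolution (s : ℝ) (k : ℕ) (f u : ℝ → ℝ) : Prop :=
  MemU s k u ∧ ∀ v : ℝ → ℝ, MemV s k v →
    IntegrableOn (fun x => f x * v x) Lam ∧ bilin s k u v = ∫ x in Lam, f x * v x

/-- `u_N` solves the Petrov-Galerkin scheme. -/
def IsDiscreteSolution (s : ℝ) (k N : ℕ) (f uN : ℝ → ℝ) : Prop :=
  MemFplus s k N uN ∧ ∀ vN : ℝ → ℝ, MemFminus s k N vN →
    bilin s k uN vN = ∫ x in Lam, f x * vN x

/-- `u ∈ ⁺B^m_{s,-k}(Λ)`: `u ∈ L²_{ω^{(-s,-k)}}(Λ)` and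
`D_+^{s+l} u ∈ L²_{ω^{(l,s-k+l)}}(Λ)` for `0 ≤ l ≤ m`. -/
def MemB (s : ℝ) (k m : ℕ) (u : ℝ → ℝ) : Prop :=
  MemL2w (-s) (-k) u ∧ ∀ l ≤ m, HasRL (s + l) u ∧ MemL2w l (s - k + l) (rlDeriv (s + l) u)

end GJF

end

noncomputable section

namespace GJF
open Polynomial

/-! ### Positive definite forms on polynomials and triangular symmetric operators -/

/-! Put `g = D_+^s u` and `b = s - k`. The proof shows that `D_+^s u_N` is the orthogonal projection
of `g` onto `P_N` in `L²_{ω^{(0,b)}}`, and that the `U` norm of the error is controlled by its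
fractional derivative alone. What remains is the classical error bound for a Jacobi projection.

Polynomial structure: a trial function is `r ω^{(s,k)}` with `r` a polynomial. Its `k`-th derivative
is a polynomial times `(1-x)^{s-k}`, and by the beta integral `I_+^{k-s}` turns this into a
polynomial `P` of degree at most `N` (`rlDeriv_weight_ae_eq`). Likewise `D^k` of a test function `r
ω^{(k,s)}` is a polynomial times the weight `ω^{(0,b)}`.

Orthogonality (`galerkin_orthogonality`): the scheme makes `g - P` orthogonal to one polynomial of
each exact degree `k, ..., N`. For degrees below `k` the boundary conditions take over: the adjoint
identity `(D_+^s e, q ω^{(0,b)}) = (e, D_-^s(q ω^{(0,b)}))` holds for `e = u - u_N`, and `D_-^s(q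
ω^{(0,b)})` is the `k`-th derivative of a polynomial of the same degree as `q`, hence zero. For `u`
the identity comes from test functions by density (`MemU.integral_rlDeriv_mul`).

Two bounds by duality: both rest on `IsPosDefForm.exists_preimage`. A symmetric operator on
polynomials that does not raise degrees has the orthogonal polynomials as eigenvectors and its
diagonal entries as eigenvalues, so it is inverted with a bound, and no Jacobi polynomial is needed
explicitly. The operator `(-1)^m ω^{(0,-b)} D^m ω^{(m,b+m)} D^m` has eigenvalues at least `N^m
(N+1)!/(N+1-m)!` in degrees above `N`, which gives the projection error
(`normL2w_projection_error_le`). The operator `D_-^s ω^{(0,b)} D_+^s ω^{(s,k)}` has increasing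
positive eigenvalues, which gives the stability bound `normL2w_le_of_adjoint`.

Finally, the `m`-th weak derivative of `g` is, up to sign, `D_+^{s+m} u` in (i), and `f^{(m-k)}` in
(ii), where the equation is tested with `φ^{(m-k)}`. -/

/-- Symmetry and positive definiteness of a bilinear form on polynomials. -/
structure IsPosDefForm (B : LinearMap.BilinForm ℝ ℝ[X]) : Prop where
  symm : ∀ p q, B p q = B q p
  pos : ∀ p, p ≠ 0 → 0 < B p p

lemma IsPosDefForm.nonneg {B : LinearMap.BilinForm ℝ ℝ[X]} (hB : IsPosDefForm B) (p : ℝ[X]) :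
    0 ≤ B p p := by
  by_cases h : p = 0
  · simp [h]
  · exact (hB.pos p h).le

lemma mem_degreeLT_iff_coeff {n : ℕ} {p : ℝ[X]} :
    p ∈ degreeLT ℝ n ↔ ∀ i, n ≤ i → p.coeff i = 0 := by
  rw [mem_degreeLT, degree_lt_iff_coeff_zero]

/-- Gram-Schmidt, by induction on `n`. The step subtracts from `p₁` its component along `a₁`, the
monic polynomial of degree `n` orthogonal to all lower degrees. -/
lemma IsPosDefForm.exists_decomp {B : LinearMap.BilinForm ℝ ℝ[X]} (hB : IsPosDefForm B) (n : ℕ)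
    (p : ℝ[X]) : ∃ p₀ p₁, p = p₀ + p₁ ∧ p₀ ∈ degreeLT ℝ n ∧ ∀ x ∈ degreeLT ℝ n, B p₁ x = 0 := by
  induction n generalizing p with
  | zero =>
    refine ⟨0, p, by simp, Submodule.zero_mem _, fun x hx => ?_⟩
    have : x = 0 := by ext i; simpa using mem_degreeLT_iff_coeff.1 hx i (Nat.zero_le _)
    simp [this]
  | succ n ih =>
    obtain ⟨p₀, p₁, hp, h₀, h₁⟩ := ih p
    obtain ⟨a₀, a₁, ha, k₀, k₁⟩ := ih (X ^ n)
    have hmono : degreeLT ℝ n ≤ degreeLT ℝ (n + 1) := degreeLT_mono (by omega)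
    have ha₁ : a₁ = X ^ n - a₀ := by rw [ha]; ring
    have hc := mem_degreeLT_iff_coeff.1 k₀
    have hcoef : a₁.coeff n = 1 := by
      rw [ha₁, coeff_sub, hc n le_rfl, coeff_X_pow, if_pos rfl, sub_zero]
    have hne : a₁ ≠ 0 := fun h => by simp [h] at hcoef
    have hpos := hB.pos a₁ hne
    have hmem : a₁ ∈ degreeLT ℝ (n + 1) := by
      rw [mem_degreeLT_iff_coeff]
      intro i hi
      rw [ha₁, coeff_sub, hc i (by omega), coeff_X_pow, if_neg (by omega), sub_zero]
    refine ⟨p₀ + (B p₁ a₁ / B a₁ a₁) • a₁, p₁ - (B p₁ a₁ / B a₁ a₁) • a₁, by rw [hp]; abel,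
      Submodule.add_mem _ (hmono h₀) (Submodule.smul_mem _ _ hmem), fun x hx => ?_⟩
    have hx' : x - x.coeff n • a₁ ∈ degreeLT ℝ n := by
      have h1 := mem_degreeLT_iff_coeff.1 hx
      have h2 := mem_degreeLT_iff_coeff.1 hmem
      rw [mem_degreeLT_iff_coeff]
      intro i hi
      rcases hi.eq_or_lt with rfl | hi
      · simp [hcoef]
      · simp [h1 i hi, h2 i hi]
    have e1 := h₁ _ hx'
    have e2 := k₁ _ hx'
    simp only [map_sub, map_smul, smul_eq_mul] at e1 e2
    simp only [map_sub, map_smul, smul_eq_mul, LinearMap.sub_apply, LinearMap.smul_apply]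
    rw [sub_eq_zero.1 e1, sub_eq_zero.1 e2]
    field_simp
    ring

lemma IsPosDefForm.exists_monic_orthogonal {B : LinearMap.BilinForm ℝ ℝ[X]}
    (hB : IsPosDefForm B) (n : ℕ) :
    ∃ q, q ∈ degreeLT ℝ (n + 1) ∧ q.coeff n = 1 ∧ ∀ x ∈ degreeLT ℝ n, B q x = 0 := by
  obtain ⟨p₀, p₁, h, h₀, h₁⟩ := hB.exists_decomp n (X ^ n)
  rw [mem_degreeLT_iff_coeff] at h₀
  have hp₁ : p₁ = X ^ n - p₀ := by rw [h]; ring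
  refine ⟨p₁, ?_, ?_, h₁⟩
  · rw [mem_degreeLT_iff_coeff]
    intro i hi
    rw [hp₁, coeff_sub, h₀ i (by omega), coeff_X_pow, if_neg (by omega), sub_zero]
  · rw [hp₁, coeff_sub, h₀ n le_rfl, coeff_X_pow, if_pos rfl, sub_zero]

/-- The difference `S q - c q` has degree below `n`. By symmetry of `S` it is also orthogonal to
every polynomial of degree below `n`, hence to itself. -/
lemma IsPosDefForm.eigen_of_triangular {B : LinearMap.BilinForm ℝ ℝ[X]} (hB : IsPosDefForm B)
    {S : ℝ[X] →ₗ[ℝ] ℝ[X]} (hS : ∀ p q, B (S p) q = B p (S q))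
    (hdeg : ∀ n, ∀ p ∈ degreeLT ℝ n, S p ∈ degreeLT ℝ n) {n : ℕ} {c : ℝ} {q : ℝ[X]}
    (hc : (S q).coeff n = c * q.coeff n)
    (hq : q ∈ degreeLT ℝ (n + 1)) (hort : ∀ x ∈ degreeLT ℝ n, B q x = 0) :
    S q = c • q := by
  have hd : S q - c • q ∈ degreeLT ℝ n := by
    have h1 := mem_degreeLT_iff_coeff.1 (hdeg _ _ hq)
    have h2 := mem_degreeLT_iff_coeff.1 hq
    rw [mem_degreeLT_iff_coeff]
    intro i hi
    rcases hi.eq_or_lt with rfl | hi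
    · simp [hc]
    · simp [h1 i hi, h2 i hi]
  have h0 : B (S q - c • q) (S q - c • q) = 0 := by
    have : B (S q - c • q) (S q - c • q)
        = B q (S (S q - c • q)) - c * B q (S q - c • q) := by
      rw [← hS, map_sub B, LinearMap.sub_apply, map_smul B, LinearMap.smul_apply, smul_eq_mul]
    rw [this, hort _ (hdeg _ _ hd), hort _ hd]; ring
  by_contra hne
  exact (hB.pos _ (sub_ne_zero.2 hne)).ne' h0

/-- A symmetric triangular operator whose diagonal entries are at least `c > 0` from index `M` on
is invertible on polynomials orthogonal to those of degree less than `M`, with a bound. -/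
lemma IsPosDefForm.exists_preimage {B : LinearMap.BilinForm ℝ ℝ[X]} (hB : IsPosDefForm B)
    {S : ℝ[X] →ₗ[ℝ] ℝ[X]} (hS : ∀ p q, B (S p) q = B p (S q))
    (hdeg : ∀ n, ∀ p ∈ degreeLT ℝ n, S p ∈ degreeLT ℝ n) {M : ℕ} {ev : ℕ → ℝ} {c : ℝ}
    (hcoeff : ∀ n, M ≤ n → ∀ p ∈ degreeLT ℝ (n + 1), (S p).coeff n = ev n * p.coeff n)
    (hc : 0 < c) (hev : ∀ n, M ≤ n → c ≤ ev n) {p : ℝ[X]}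
    (hp : ∀ x ∈ degreeLT ℝ M, B p x = 0) :
    ∃ r, S r = p ∧ c * B (S r) r ≤ B p p := by
  suffices h : ∀ n, ∀ p ∈ degreeLT ℝ n, (∀ x ∈ degreeLT ℝ M, B p x = 0) →
      ∃ r ∈ degreeLT ℝ n, S r = p ∧ c * B (S r) r ≤ B p p by
    obtain ⟨r, -, hr⟩ := h (p.natDegree + 1) p
      (mem_degreeLT_iff_coeff.2 fun i hi => coeff_eq_zero_of_natDegree_lt (by omega)) hp
    exact ⟨r, hr⟩
  intro n
  induction n with
  | zero =>
    intro p hp _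
    have : p = 0 := by
      ext i; simpa using mem_degreeLT_iff_coeff.1 hp i (Nat.zero_le _)
    exact ⟨0, Submodule.zero_mem _, by simp [this], by simp [this]⟩
  | succ n ih =>
    intro p hp hort
    -- Below index `M` the polynomial `p` is orthogonal to itself, so it vanishes.
    by_cases hn : n < M
    · have h0 : p = 0 := by
        by_contra hne
        exact (hB.pos p hne).ne' (hort p (degreeLT_mono (by omega) hp))
      exact ⟨0, Submodule.zero_mem _, by simp [h0], by simp [h0]⟩
    · push Not at hn
      obtain ⟨q, hq, hq1, hqo⟩ := hB.exists_monic_orthogonal n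
      have hSq := hB.eigen_of_triangular hS hdeg (hcoeff n hn q hq) hq hqo
      have hevn : 0 < ev n := hc.trans_le (hev n hn)
      set a := p.coeff n with ha
      have hp' : p - a • q ∈ degreeLT ℝ n := by
        have h1 := mem_degreeLT_iff_coeff.1 hp
        have h2 := mem_degreeLT_iff_coeff.1 hq
        rw [mem_degreeLT_iff_coeff]
        intro i hi
        rcases hi.eq_or_lt with rfl | hi
        · simp [hq1, ha]
        · simp [h1 i hi, h2 i hi]
      obtain ⟨r, hr, hSr, hle⟩ := ih (p - a • q) hp' (fun x hx => by
        simp [hort x hx, hqo x (degreeLT_mono hn hx)])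
      have hmono : degreeLT ℝ n ≤ degreeLT ℝ (n + 1) := degreeLT_mono (by omega)
      refine ⟨r + (a / ev n) • q, Submodule.add_mem _ (hmono hr) (Submodule.smul_mem _ _ hq),
        ?_, ?_⟩
      · rw [map_add, map_smul, hSr, hSq, smul_smul, div_mul_cancel₀ _ hevn.ne']; simp
      · rw [map_add S, map_smul S, hSr, hSq, smul_smul, div_mul_cancel₀ _ hevn.ne']
        rw [hSr] at hle
        have e1 : B (p - a • q) q = 0 := by rw [hB.symm]; exact hqo _ hp'
        have e2 : B q r = 0 := hqo _ hr
        -- Both forms split orthogonally along `q`, so the bound reduces to the induction hypothesis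
        -- and `c * a² / ev n ≤ a²`.
        have e3 : B p p = B (p - a • q) (p - a • q) + a ^ 2 * B q q := by
          have : B p p = B ((p - a • q) + a • q) ((p - a • q) + a • q) := by simp
          rw [this, LinearMap.BilinForm.add_left, LinearMap.BilinForm.add_right,
            LinearMap.BilinForm.add_right, map_smul, map_smul, LinearMap.smul_apply,
            LinearMap.smul_apply, map_smul, e1, hB.symm q, e1]
          simp only [smul_eq_mul]; ring
        have e4 : B (p - a • q + a • q) (r + (a / ev n) • q)
            = B (p - a • q) r + a ^ 2 / ev n * B q q := by
          rw [LinearMap.BilinForm.add_left, LinearMap.BilinForm.add_right,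
            LinearMap.BilinForm.add_right, map_smul, map_smul, LinearMap.smul_apply,
            LinearMap.smul_apply, map_smul, e1, e2]
          simp only [smul_eq_mul]; ring
        rw [e4, e3, mul_add]
        refine add_le_add hle ?_
        rw [← mul_assoc]
        refine mul_le_mul_of_nonneg_right ?_ (hB.nonneg q)
        rw [mul_div_assoc', div_le_iff₀ hevn, mul_comm]
        exact mul_le_mul_of_nonneg_left (hev n hn) (sq_nonneg a)

/-! ### Differentiation against Jacobi weights -/

/-- The polynomial factor of `D (p ω^{(a,b)}) = (jacobiStep a b p) ω^{(a-1,b-1)}`. -/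
def jacobiStep (a b : ℝ) : ℝ[X] →ₗ[ℝ] ℝ[X] :=
  LinearMap.mulLeft ℝ (1 - X ^ 2) ∘ₗ derivative + LinearMap.mulLeft ℝ (C (b - a) - C (a + b) * X)

/-- The polynomial factor of `D^n (p ω^{(a,b)}) = (jacobiIter a b n p) ω^{(a-n,b-n)}`. -/
def jacobiIter (a b : ℝ) : ℕ → ℝ[X] →ₗ[ℝ] ℝ[X]
  | 0 => LinearMap.id
  | n + 1 => jacobiStep (a - n) (b - n) ∘ₗ jacobiIter a b n

lemma jacobiStep_apply (a b : ℝ) (p : ℝ[X]) :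
    jacobiStep a b p = (1 - X ^ 2) * derivative p + (C (b - a) - C (a + b) * X) * p := rfl

lemma jacobiIter_succ_apply (a b : ℝ) (n : ℕ) (p : ℝ[X]) :
    jacobiIter a b (n + 1) p = jacobiStep (a - n) (b - n) (jacobiIter a b n p) := rfl

lemma coeff_jacobiStep (a b : ℝ) (p : ℝ[X]) (i : ℕ) :
    (jacobiStep a b p).coeff (i + 1) = p.coeff (i + 2) * (i + 2) + (b - a) * p.coeff (i + 1)
      - (i + a + b) * p.coeff i := by
  have h : jacobiStep a b p = derivative p - X * (X * derivative p) + C (b - a) * p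
      - C (a + b) * (X * p) := by
    rw [jacobiStep_apply]; ring
  have h2 : (X * derivative p).coeff i = i * p.coeff i := by
    cases i with
    | zero => simp
    | succ i => rw [coeff_X_mul, coeff_derivative]; push_cast; ring
  rw [h, coeff_sub, coeff_add, coeff_sub, coeff_C_mul, coeff_C_mul, coeff_X_mul, coeff_X_mul, h2,
    coeff_derivative]
  push_cast; ring

lemma jacobiStep_mem_degreeLT (a b : ℝ) {n : ℕ} {p : ℝ[X]} (hp : p ∈ degreeLT ℝ n) :
    jacobiStep a b p ∈ degreeLT ℝ (n + 1) := by
  rw [mem_degreeLT_iff_coeff] at hp ⊢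
  intro i hi
  obtain ⟨j, rfl⟩ : ∃ j, i = j + 1 := ⟨i - 1, by omega⟩
  rw [coeff_jacobiStep, hp j (by omega), hp (j + 1) (by omega), hp (j + 2) (by omega)]; ring

lemma jacobiIter_mem_degreeLT (a b : ℝ) {n : ℕ} {p : ℝ[X]} (hp : p ∈ degreeLT ℝ n) (i : ℕ) :
    jacobiIter a b i p ∈ degreeLT ℝ (n + i) := by
  induction i with
  | zero => exact hp
  | succ i ih =>
    rw [jacobiIter_succ_apply]
    exact jacobiStep_mem_degreeLT (a - i) (b - i) ih

/-- Step `j` acts in degree `n + j` with exponents `a - j` and `b - j`, so it multiplies the leading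
coefficient by `-(n + a + b - j)`. -/
lemma coeff_jacobiIter (a b : ℝ) {n : ℕ} {p : ℝ[X]} (hp : p ∈ degreeLT ℝ (n + 1)) (i : ℕ) :
    (jacobiIter a b i p).coeff (n + i)
      = (-1) ^ i * (∏ j ∈ Finset.range i, (n + a + b - j)) * p.coeff n := by
  induction i with
  | zero => simp [jacobiIter]
  | succ i ih =>
    have h := mem_degreeLT_iff_coeff.1 (jacobiIter_mem_degreeLT a b hp i)
    rw [← add_assoc, jacobiIter_succ_apply, coeff_jacobiStep, h (n + i + 2) (by omega), h (n + i + 1) (by omega), ih,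
      Finset.prod_range_succ]
    push_cast; ring

/-! ### Diagonal operators in powers of `1 + X` and reflection -/

/-- Multiplication of the `j`-th coefficient by `c j`. -/
def diagCoeff (c : ℕ → ℝ) : ℝ[X] →ₗ[ℝ] ℝ[X] :=
  Polynomial.lsum fun j => (monomial j).comp (LinearMap.mulLeft ℝ (c j))

lemma diagCoeff_monomial (c : ℕ → ℝ) (j : ℕ) (a : ℝ) :
    diagCoeff c (monomial j a) = monomial j (c j * a) := by
  simp [diagCoeff, lsum_apply]

lemma coeff_diagCoeff (c : ℕ → ℝ) (p : ℝ[X]) (i : ℕ) :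
    (diagCoeff c p).coeff i = c i * p.coeff i := by
  induction p using Polynomial.induction_on' with
  | add p q hp hq => simp only [map_add, coeff_add, hp, hq]; ring
  | monomial j a =>
    rw [diagCoeff_monomial, coeff_monomial, coeff_monomial]
    split_ifs with h
    · rw [h]
    · simp

/-- The operator `(1 + X)^j ↦ c j (1 + X)^j`. -/
def diagLeft (c : ℕ → ℝ) : ℝ[X] →ₗ[ℝ] ℝ[X] := taylor 1 ∘ₗ diagCoeff c ∘ₗ taylor (-1)

/-- The reflection `p(x) ↦ p(-x)`. -/
def reflect : ℝ[X] →ₗ[ℝ] ℝ[X] := diagCoeff fun j => (-1) ^ j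

lemma eval_reflect (p : ℝ[X]) (x : ℝ) : (reflect p).eval x = p.eval (-x) := by
  induction p using Polynomial.induction_on' with
  | add p q hp hq => simp only [map_add, eval_add, hp, hq]
  | monomial j a =>
    rw [reflect, diagCoeff_monomial, eval_monomial, eval_monomial, neg_pow x]; ring

lemma coeff_reflect (p : ℝ[X]) (i : ℕ) : (reflect p).coeff i = (-1) ^ i * p.coeff i :=
  coeff_diagCoeff _ p i

lemma taylor_mem_degreeLT (a : ℝ) {n : ℕ} {p : ℝ[X]} (hp : p ∈ degreeLT ℝ n) :
    taylor a p ∈ degreeLT ℝ n := by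
  rw [mem_degreeLT] at hp ⊢
  rwa [degree_taylor]

lemma coeff_taylor_of_mem_degreeLT (a : ℝ) {n : ℕ} {p : ℝ[X]} (hp : p ∈ degreeLT ℝ (n + 1)) :
    (taylor a p).coeff n = p.coeff n := by
  by_cases h : p.natDegree = n
  · rw [← h, coeff_taylor_natDegree, leadingCoeff]
  · have hlt : p.natDegree < n := by
      refine lt_of_le_of_ne ?_ h
      rw [natDegree_le_iff_coeff_eq_zero]
      exact fun i hi => mem_degreeLT_iff_coeff.1 hp i hi
    rw [coeff_eq_zero_of_natDegree_lt hlt,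
      coeff_eq_zero_of_natDegree_lt (by rwa [natDegree_taylor])]

lemma diagCoeff_mem_degreeLT (c : ℕ → ℝ) {n : ℕ} {p : ℝ[X]} (hp : p ∈ degreeLT ℝ n) :
    diagCoeff c p ∈ degreeLT ℝ n := by
  rw [mem_degreeLT_iff_coeff] at hp ⊢
  intro i hi
  rw [coeff_diagCoeff, hp i hi, mul_zero]

lemma diagLeft_mem_degreeLT (c : ℕ → ℝ) {n : ℕ} {p : ℝ[X]} (hp : p ∈ degreeLT ℝ n) :
    diagLeft c p ∈ degreeLT ℝ n :=
  taylor_mem_degreeLT _ (diagCoeff_mem_degreeLT _ (taylor_mem_degreeLT _ hp))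

lemma coeff_diagLeft (c : ℕ → ℝ) {n : ℕ} {p : ℝ[X]} (hp : p ∈ degreeLT ℝ (n + 1)) :
    (diagLeft c p).coeff n = c n * p.coeff n := by
  change (taylor 1 (diagCoeff c (taylor (-1) p))).coeff n = _
  rw [coeff_taylor_of_mem_degreeLT _ (diagCoeff_mem_degreeLT _ (taylor_mem_degreeLT _ hp)),
    coeff_diagCoeff, coeff_taylor_of_mem_degreeLT _ hp]

lemma reflect_mem_degreeLT {n : ℕ} {p : ℝ[X]} (hp : p ∈ degreeLT ℝ n) :
    reflect p ∈ degreeLT ℝ n := by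
  rw [mem_degreeLT_iff_coeff] at hp ⊢
  intro i hi
  rw [coeff_reflect, hp i hi, mul_zero]

/-- Every polynomial is a sum of powers of `1 + X`. -/
lemma induction_one_add_X {P : ℝ[X] → Prop} (hadd : ∀ p q, P p → P q → P (p + q))
    (hmon : ∀ (j : ℕ) (a : ℝ), P (C a * (X + C 1) ^ j)) (p : ℝ[X]) : P p := by
  have h : ∀ q : ℝ[X], P (taylor 1 q) := by
    intro q
    induction q using Polynomial.induction_on' with
    | add p q hp hq => rw [map_add]; exact hadd _ _ hp hq
    | monomial j a => rw [taylor_monomial]; exact hmon j a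
  have := h (taylor (-1) p)
  rwa [taylor_taylor, add_neg_cancel, taylor_zero] at this

lemma diagLeft_pow (c : ℕ → ℝ) (j : ℕ) (a : ℝ) :
    diagLeft c (C a * (X + C 1) ^ j) = C (c j * a) * (X + C 1) ^ j := by
  change taylor 1 (diagCoeff c (taylor (-1) (C a * (X + C 1) ^ j))) = _
  rw [← taylor_monomial, taylor_taylor, neg_add_cancel, taylor_zero, diagCoeff_monomial,
    taylor_monomial]

/-! ### Jacobi weights -/

lemma measurableSet_Lam : MeasurableSet Lam := measurableSet_Ioo

lemma weight_pos {a b x : ℝ} (hx : x ∈ Lam) : 0 < weight a b x :=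
  mul_pos (Real.rpow_pos_of_pos (by linarith [hx.2]) _)
    (Real.rpow_pos_of_pos (by linarith [hx.1]) _)

lemma measurable_weight (a b : ℝ) : Measurable (weight a b) := by
  unfold weight; fun_prop

lemma weight_mul {a b c d x : ℝ} (hx : x ∈ Lam) :
    weight a b x * weight c d x = weight (a + c) (b + d) x := by
  have h1 : 0 < 1 - x := by linarith [hx.2]
  have h2 : 0 < 1 + x := by linarith [hx.1]
  unfold weight
  rw [Real.rpow_add h1, Real.rpow_add h2]; ring

lemma weight_zero {x : ℝ} : weight 0 0 x = 1 := by simp [weight]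

lemma intervalIntegral_zero_beta {c d a : ℝ} (hc : 0 < c) (hd : 0 < d) (ha : 0 < a) :
    ∫ t in (0 : ℝ)..a, t ^ (c - 1) * (a - t) ^ (d - 1)
      = a ^ (c + d - 1) * (Real.Gamma c * Real.Gamma d / Real.Gamma (c + d)) := by
  have h := Complex.betaIntegral_scaled (c : ℂ) (d : ℂ) ha
  rw [Complex.betaIntegral_eq_Gamma_mul_div _ _ (by simpa using hc) (by simpa using hd)] at h
  have h2 : ∫ x in (0 : ℝ)..a, (x : ℂ) ^ ((c : ℂ) - 1) * ((a : ℂ) - x) ^ ((d : ℂ) - 1)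
      = ((∫ t in (0 : ℝ)..a, t ^ (c - 1) * (a - t) ^ (d - 1) : ℝ) : ℂ) := by
    rw [← intervalIntegral.integral_ofReal]
    refine intervalIntegral.integral_congr fun t ht => ?_
    rw [uIcc_of_le ha.le] at ht
    push_cast
    rw [Complex.ofReal_cpow ht.1, Complex.ofReal_cpow (sub_nonneg.2 ht.2)]
    push_cast
    rfl
  rw [h2] at h
  have h3 : (((a : ℂ)) ^ ((c : ℂ) + d - 1)) = ((a ^ (c + d - 1) : ℝ) : ℂ) := by
    rw [Complex.ofReal_cpow ha.le]; push_cast; rfl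
  rw [h3, Complex.Gamma_ofReal, Complex.Gamma_ofReal, ← Complex.ofReal_add,
    Complex.Gamma_ofReal] at h
  exact_mod_cast h

lemma intervalIntegral_beta {c d y : ℝ} (hc : 0 < c) (hd : 0 < d) (hy : -1 < y) :
    ∫ x in (-1 : ℝ)..y, (1 + x) ^ (c - 1) * (y - x) ^ (d - 1)
      = (1 + y) ^ (c + d - 1) * (Real.Gamma c * Real.Gamma d / Real.Gamma (c + d)) := by
  rw [← intervalIntegral_zero_beta hc hd (by linarith : 0 < 1 + y)]
  have := intervalIntegral.integral_comp_add_left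
    (fun t : ℝ => t ^ (c - 1) * (1 + y - t) ^ (d - 1)) (1 : ℝ) (a := -1) (b := y)
  rw [show (1 : ℝ) + -1 = 0 by norm_num] at this
  rw [← this]
  congr 1; ext x; congr 2; ring

/-- The integral of a non-integrable function is `0` by convention, whereas the beta integral has a
positive value. The same argument gives integrability of the fractional kernels below. -/
lemma intervalIntegrable_beta {c d y : ℝ} (hc : 0 < c) (hd : 0 < d) (hy : -1 < y) :
    IntervalIntegrable (fun x => (1 + x) ^ (c - 1) * (y - x) ^ (d - 1)) volume (-1) y := by
  by_contra h
  have h1 := intervalIntegral_beta hc hd hy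
  rw [intervalIntegral.integral_undef h] at h1
  have h2 : 0 < (1 + y) ^ (c + d - 1) * (Real.Gamma c * Real.Gamma d / Real.Gamma (c + d)) :=
    mul_pos (Real.rpow_pos_of_pos (by linarith) _)
      (div_pos (mul_pos (Real.Gamma_pos_of_pos hc) (Real.Gamma_pos_of_pos hd))
        (Real.Gamma_pos_of_pos (by linarith)))
  linarith

lemma integrableOn_weight {a b : ℝ} (ha : -1 < a) (hb : -1 < b) :
    IntegrableOn (weight a b) Lam := by
  have h := intervalIntegrable_beta (c := b + 1) (d := a + 1) (y := 1) (by linarith) (by linarith)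
    (by norm_num)
  rw [intervalIntegrable_iff_integrableOn_Ioo_of_le (by norm_num)] at h
  refine h.congr_fun (fun x _ => ?_) measurableSet_Lam
  simp only [weight, add_sub_cancel_right]; ring

lemma integrableOn_continuous_mul_weight {a b : ℝ} (ha : -1 < a) (hb : -1 < b) {F : ℝ → ℝ}
    (hF : Continuous F) : IntegrableOn (fun x => F x * weight a b x) Lam := by
  have h : IntegrableOn (weight a b) (Icc (-1) 1) :=
    (integrableOn_Icc_iff_integrableOn_Ioo (by simp) (by simp)).2 (integrableOn_weight ha hb)
  exact (h.continuousOn_mul hF.continuousOn isCompact_Icc).mono_set Ioo_subset_Icc_self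

/-- The `L²_{ω^{(a,b)}}` inner product on polynomials. -/
def jacobiForm (a b : ℝ) (ha : -1 < a) (hb : -1 < b) : LinearMap.BilinForm ℝ ℝ[X] :=
  LinearMap.mk₂ ℝ (fun p q => ∫ x in Lam, p.eval x * q.eval x * weight a b x)
    (fun p p' q => by
      rw [← integral_add (integrableOn_continuous_mul_weight ha hb (by fun_prop))
        (integrableOn_continuous_mul_weight ha hb (by fun_prop))]
      congr 1; ext x; simp only [eval_add]; ring)
    (fun c p q => by
      rw [smul_eq_mul, ← integral_const_mul]
      congr 1; ext x; simp only [eval_smul, smul_eq_mul]; ring)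
    (fun p q q' => by
      rw [← integral_add (integrableOn_continuous_mul_weight ha hb (by fun_prop))
        (integrableOn_continuous_mul_weight ha hb (by fun_prop))]
      congr 1; ext x; simp only [eval_add]; ring)
    (fun c p q => by
      rw [smul_eq_mul, ← integral_const_mul]
      congr 1; ext x; simp only [eval_smul, smul_eq_mul]; ring)

lemma jacobiForm_apply {a b : ℝ} (ha : -1 < a) (hb : -1 < b) (p q : ℝ[X]) :
    jacobiForm a b ha hb p q = ∫ x in Lam, p.eval x * q.eval x * weight a b x := rfl

lemma isPosDefForm_jacobiForm {a b : ℝ} (ha : -1 < a) (hb : -1 < b) :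
    IsPosDefForm (jacobiForm a b ha hb) where
  symm p q := by
    simp only [jacobiForm_apply]
    congr 1; ext x; ring
  pos p hp := by
    rw [jacobiForm_apply]
    have hnn : 0 ≤ᵐ[volume.restrict Lam] fun x => p.eval x * p.eval x * weight a b x := by
      filter_upwards [ae_restrict_mem measurableSet_Lam] with x hx
      exact mul_nonneg (mul_self_nonneg _) (weight_pos hx).le
    rw [setIntegral_pos_iff_support_of_nonneg_ae hnn
      (integrableOn_continuous_mul_weight ha hb (by fun_prop))]
    -- The integrand is positive off the finitely many roots of `p`, a null set.
    have hsub : Lam \ (p.roots.toFinset : Set ℝ) ⊆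
        (Function.support fun x => p.eval x * p.eval x * weight a b x) ∩ Lam := by
      intro x hx
      refine ⟨?_, hx.1⟩
      have : p.eval x ≠ 0 := fun h => hx.2 (by simp [hp, h])
      exact mul_ne_zero (mul_ne_zero this this) (weight_pos hx.1).ne'
    refine lt_of_lt_of_le ?_ (measure_mono hsub)
    rw [measure_sdiff_null (p.roots.toFinset.finite_toSet.measure_zero _)]
    simp [Lam]

/-! ### Weighted `L²` spaces -/

lemma integrable_mul_of_sq {α : Type*} [MeasurableSpace α] {μ : Measure α} {f g : α → ℝ}
    (hf : AEStronglyMeasurable f μ) (hg : AEStronglyMeasurable g μ)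
    (hf2 : Integrable (fun x => f x ^ 2) μ) (hg2 : Integrable (fun x => g x ^ 2) μ) :
    Integrable (fun x => f x * g x) μ := by
  refine (hf2.add hg2).mono' (hf.mul hg) (Filter.Eventually.of_forall fun x => ?_)
  simp only [Pi.add_apply, Real.norm_eq_abs, abs_mul]
  nlinarith [sq_nonneg (|f x| - |g x|), sq_abs (f x), sq_abs (g x), sq_nonneg (f x),
    sq_nonneg (g x)]

lemma abs_integral_mul_le {α : Type*} [MeasurableSpace α] {μ : Measure α} {f g : α → ℝ}
    (hf : AEStronglyMeasurable f μ) (hg : AEStronglyMeasurable g μ)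
    (hf2 : Integrable (fun x => f x ^ 2) μ) (hg2 : Integrable (fun x => g x ^ 2) μ) :
    |∫ x, f x * g x ∂μ| ≤ √(∫ x, f x ^ 2 ∂μ) * √(∫ x, g x ^ 2 ∂μ) := by
  have hfg := integrable_mul_of_sq hf hg hf2 hg2
  set A := ∫ x, f x ^ 2 ∂μ with hA
  set B := ∫ x, f x * g x ∂μ with hB
  set D := ∫ x, g x ^ 2 ∂μ with hD
  have key : ∀ t : ℝ, 0 ≤ D * (t * t) + (2 * B) * t + A := by
    intro t
    have h : ∫ x, (f x + t * g x) ^ 2 ∂μ = D * (t * t) + (2 * B) * t + A := by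
      have e : (fun x => (f x + t * g x) ^ 2)
          = fun x => (t * t) * g x ^ 2 + (2 * t) * (f x * g x) + f x ^ 2 := by
        ext x; ring
      have i1 : Integrable (fun x => (t * t) * g x ^ 2 + (2 * t) * (f x * g x)) μ :=
        (hg2.const_mul _).add (hfg.const_mul _)
      rw [e, integral_add i1 hf2, integral_add (hg2.const_mul _) (hfg.const_mul _), integral_const_mul, integral_const_mul,
        ← hA, ← hB, ← hD]
      ring
    rw [← h]
    exact integral_nonneg fun x => sq_nonneg _
  have hdisc := discrim_le_zero key
  rw [discrim] at hdisc
  have hA0 : 0 ≤ A := integral_nonneg fun x => sq_nonneg _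
  rw [← Real.sqrt_mul hA0]
  apply Real.abs_le_sqrt
  nlinarith

lemma MemL2w.sqrt_weight {a b : ℝ} {f : ℝ → ℝ} (hf : MemL2w a b f) :
    AEStronglyMeasurable (fun x => f x * √(weight a b x)) (volume.restrict Lam) ∧
      IntegrableOn (fun x => (f x * √(weight a b x)) ^ 2) Lam := by
  refine ⟨hf.1.mul (measurable_weight a b).sqrt.aestronglyMeasurable, ?_⟩
  refine hf.2.congr_fun (fun x hx => ?_) measurableSet_Lam
  simp only [mul_pow, Real.sq_sqrt (weight_pos hx).le]

lemma setIntegral_sqrt_weight (a b : ℝ) (f : ℝ → ℝ) :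
    ∫ x in Lam, (f x * √(weight a b x)) ^ 2 = ∫ x in Lam, f x ^ 2 * weight a b x := by
  refine setIntegral_congr_fun measurableSet_Lam fun x hx => ?_
  simp only [mul_pow, Real.sq_sqrt (weight_pos hx).le]

lemma MemL2w.integrableOn_mul {a b : ℝ} {f g : ℝ → ℝ} (hf : MemL2w a b f) (hg : MemL2w a b g) :
    IntegrableOn (fun x => f x * g x * weight a b x) Lam := by
  refine IntegrableOn.congr_fun (integrable_mul_of_sq hf.sqrt_weight.1 hg.sqrt_weight.1
    hf.sqrt_weight.2 hg.sqrt_weight.2) (fun x hx => ?_) measurableSet_Lam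
  have := Real.mul_self_sqrt (weight_pos (a := a) (b := b) hx).le
  linear_combination (f x * g x) * this

lemma MemL2w.abs_integral_mul_le {a b : ℝ} {f g : ℝ → ℝ} (hf : MemL2w a b f)
    (hg : MemL2w a b g) :
    |∫ x in Lam, f x * g x * weight a b x| ≤ normL2w a b f * normL2w a b g := by
  have h := GJF.abs_integral_mul_le hf.sqrt_weight.1 hg.sqrt_weight.1
    hf.sqrt_weight.2 hg.sqrt_weight.2
  rw [setIntegral_sqrt_weight, setIntegral_sqrt_weight] at h
  refine le_of_eq_of_le (congrArg _ ?_) h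
  refine setIntegral_congr_fun measurableSet_Lam fun x hx => ?_
  have := Real.mul_self_sqrt (weight_pos (a := a) (b := b) hx).le
  linear_combination -(f x * g x) * this

lemma normL2w_nonneg (a b : ℝ) (f : ℝ → ℝ) : 0 ≤ normL2w a b f := Real.sqrt_nonneg _

lemma integral_sq_weight_nonneg (a b : ℝ) (f : ℝ → ℝ) :
    0 ≤ ∫ x in Lam, f x ^ 2 * weight a b x :=
  setIntegral_nonneg measurableSet_Lam fun _ hx => mul_nonneg (sq_nonneg _) (weight_pos hx).le

lemma normL2w_sq (a b : ℝ) (f : ℝ → ℝ) :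
    normL2w a b f ^ 2 = ∫ x in Lam, f x ^ 2 * weight a b x :=
  Real.sq_sqrt (integral_sq_weight_nonneg a b f)

lemma memL2w_continuous {a b : ℝ} (ha : -1 < a) (hb : -1 < b) {F : ℝ → ℝ} (hF : Continuous F) :
    MemL2w a b F :=
  ⟨hF.aestronglyMeasurable, integrableOn_continuous_mul_weight ha hb (hF.pow 2)⟩

lemma memL2w_eval {a b : ℝ} (ha : -1 < a) (hb : -1 < b) (p : ℝ[X]) :
    MemL2w a b (fun x => p.eval x) := memL2w_continuous ha hb p.continuous

lemma MemL2w.congr {a b : ℝ} {f g : ℝ → ℝ} (hf : MemL2w a b f)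
    (h : f =ᵐ[volume.restrict Lam] g) : MemL2w a b g := by
  refine ⟨hf.1.congr h, Integrable.congr hf.2 ?_⟩
  filter_upwards [h] with x hx
  rw [hx]

lemma normL2w_congr {a b : ℝ} {f g : ℝ → ℝ} (h : f =ᵐ[volume.restrict Lam] g) :
    normL2w a b f = normL2w a b g := by
  unfold normL2w
  congr 1
  refine integral_congr_ae ?_
  filter_upwards [h] with x hx
  rw [hx]

lemma MemL2w.sub {a b : ℝ} {f g : ℝ → ℝ} (hf : MemL2w a b f) (hg : MemL2w a b g) :
    MemL2w a b (fun x => f x - g x) := by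
  refine ⟨hf.1.sub hg.1, ?_⟩
  have h := (hf.2.add hg.2).sub ((hf.integrableOn_mul hg).const_mul 2)
  refine h.congr_fun (fun x _ => ?_) measurableSet_Lam
  simp only [Pi.add_apply, Pi.sub_apply]; ring

lemma normL2w_eval_sq {a b : ℝ} (ha : -1 < a) (hb : -1 < b) (p : ℝ[X]) :
    normL2w a b (fun x => p.eval x) ^ 2 = jacobiForm a b ha hb p p := by
  rw [normL2w_sq, jacobiForm_apply]
  congr 1; ext x; ring

/-- Polynomials are dense in `L²_{ω^{(a,b)}}(Λ)`. -/
lemma exists_polynomial_normL2w_sub_le {a b : ℝ} (ha : -1 < a) (hb : -1 < b) {h : ℝ → ℝ}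
    (hh : MemL2w a b h) {ε : ℝ} (hε : 0 < ε) :
    ∃ p : ℝ[X], normL2w a b (fun x => h x - p.eval x) ^ 2 ≤ ε := by
  -- With respect to the finite measure `ω^{(a,b)} dx`, bounded continuous functions are dense in
  -- `L²`; Weierstrass approximation then passes to polynomials.
  set W : ℝ → NNReal := fun x => Real.toNNReal (weight a b x) with hW
  have hWm : Measurable W := (measurable_weight a b).real_toNNReal
  set μ := (volume.restrict Lam).withDensity (fun x => (W x : ENNReal)) with hμ
  have hint : ∀ F : ℝ → ℝ, ∫ x, F x ∂μ = ∫ x in Lam, F x * weight a b x := by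
    intro F
    rw [hμ, integral_withDensity_eq_integral_smul hWm]
    refine setIntegral_congr_fun measurableSet_Lam fun x hx => ?_
    simp only [hW, NNReal.smul_def, Real.coe_toNNReal _ (weight_pos hx).le, smul_eq_mul, mul_comm]
  have hinteg : ∀ F : ℝ → ℝ, Integrable F μ ↔ IntegrableOn (fun x => F x * weight a b x) Lam := by
    intro F
    rw [hμ, integrable_withDensity_iff_integrable_smul hWm]
    refine integrable_congr ?_
    filter_upwards [ae_restrict_mem measurableSet_Lam] with x hx
    simp only [hW, NNReal.smul_def, Real.coe_toNNReal _ (weight_pos hx).le, smul_eq_mul, mul_comm]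
  have hfin : IsFiniteMeasure μ := by
    have h1 : Integrable (fun _ => (1 : ℝ)) μ := by
      rw [hinteg]; simpa using integrableOn_weight ha hb
    exact (integrable_const_iff_isFiniteMeasure one_ne_zero).1 h1
  have hmeas : AEStronglyMeasurable h μ := hh.1.mono_ac (withDensity_absolutelyContinuous _ _)
  have hLp : MemLp h 2 μ := (memLp_two_iff_integrable_sq hmeas).2 ((hinteg _).2 hh.2)
  -- Each of the two squared errors is at most `ε / 4`, to be combined through `(x + y)² ≤ 2x² +
  -- 2y²`.
  set δ := √(ε / 4) with hδ
  have hδ0 : 0 < δ := Real.sqrt_pos.2 (by linarith)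
  obtain ⟨g, hg, hgL⟩ := hLp.exists_boundedContinuous_eLpNorm_sub_le (by simp)
    (ε := ENNReal.ofReal δ) (by simpa using hδ0)
  have hg2 : normL2w a b (fun x => h x - g x) ^ 2 ≤ ε / 4 := by
    rw [normL2w_sq, ← hint]
    have hd : MemLp (fun x => h x - g x) 2 μ := hLp.sub hgL
    have e := hd.eLpNorm_eq_integral_rpow_norm (by norm_num) (by norm_num)
    have hg' : eLpNorm (fun x => h x - g x) 2 μ ≤ ENNReal.ofReal δ := hg
    rw [e, ENNReal.ofReal_le_ofReal_iff hδ0.le] at hg'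
    simp only [ENNReal.toReal_ofNat, Real.rpow_two, Real.norm_eq_abs, sq_abs] at hg'
    rw [show (2 : ℝ)⁻¹ = 1 / 2 by norm_num, ← Real.sqrt_eq_rpow, hδ] at hg'
    exact (Real.sqrt_le_sqrt_iff (by linarith)).1 hg'
  set T := ∫ x in Lam, weight a b x with hT
  have hT0 : 0 ≤ T := setIntegral_nonneg measurableSet_Lam fun x hx => (weight_pos hx).le
  set η := √(ε / (4 * (T + 1))) with hη
  have hη0 : 0 < η := Real.sqrt_pos.2 (by positivity)
  obtain ⟨p, hp⟩ := exists_polynomial_near_of_continuousOn (-1) 1 g g.continuous.continuousOn η hη0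
  refine ⟨p, ?_⟩
  have hgc : MemL2w a b g := memL2w_continuous ha hb g.continuous
  have hpc := memL2w_eval ha hb p
  have h1 := (hh.sub hgc).2
  have h2 := (hgc.sub hpc).2
  have h3 := (hh.sub hpc).2
  have hgp : ∫ x in Lam, (g x - p.eval x) ^ 2 * weight a b x ≤ ε / 4 := by
    have : ∫ x in Lam, (g x - p.eval x) ^ 2 * weight a b x ≤ ∫ x in Lam, η ^ 2 * weight a b x := by
      refine setIntegral_mono_on h2 ((integrableOn_weight ha hb).const_mul _) measurableSet_Lam
        fun x hx => mul_le_mul_of_nonneg_right ?_ (weight_pos hx).le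
      have := (hp x (Ioo_subset_Icc_self hx)).le
      rw [abs_sub_comm] at this
      exact sq_le_sq' (by linarith [abs_le.1 this]) (abs_le.1 this).2
    rw [integral_const_mul, hη, Real.sq_sqrt (by positivity), ← hT] at this
    refine this.trans ?_
    rw [div_mul_eq_mul_div, div_le_div_iff₀ (by positivity) (by positivity)]
    nlinarith
  rw [normL2w_sq] at hg2 ⊢
  have : ∫ x in Lam, (h x - p.eval x) ^ 2 * weight a b x
      ≤ ∫ x in Lam, (2 * ((h x - g x) ^ 2 * weight a b x)
        + 2 * ((g x - p.eval x) ^ 2 * weight a b x)) := by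
    refine setIntegral_mono_on h3 ((h1.const_mul 2).add (h2.const_mul 2)) measurableSet_Lam
      fun x hx => ?_
    nlinarith [mul_nonneg (sq_nonneg ((h x - g x) - (g x - p.eval x)))
      (weight_pos (a := a) (b := b) hx).le]
  rw [integral_add (h1.const_mul 2) (h2.const_mul 2), integral_const_mul,
    integral_const_mul] at this
  linarith

/-- Duality against a dense subspace. If the norm `n` were `K + 2ε` with `ε > 0`, a polynomial `p`
within `ε` of `h` would satisfy `‖p‖ ≤ K + ε`, hence `n² ≤ n ε + K (K + ε)`, which is less than `(K
+ 2ε)²`. -/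
lemma normL2w_le_of_forall_polynomial {a b : ℝ} (ha : -1 < a) (hb : -1 < b) {h : ℝ → ℝ}
    (hh : MemL2w a b h) {K : ℝ} (hK : 0 ≤ K)
    (H : ∀ p : ℝ[X], |∫ x in Lam, h x * p.eval x * weight a b x|
      ≤ K * normL2w a b (fun x => p.eval x)) : normL2w a b h ≤ K := by
  by_contra hlt
  push Not at hlt
  set n := normL2w a b h with hn
  have hn0 : 0 < n := hK.trans_lt hlt
  set ε := (n - K) / 2 with hε
  have hε0 : 0 < ε := by rw [hε]; linarith
  obtain ⟨p, hp⟩ := exists_polynomial_normL2w_sub_le ha hb hh (ε := ε ^ 2) (by positivity)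
  have hpc := memL2w_eval ha hb p
  have hd : normL2w a b (fun x => h x - p.eval x) ≤ ε :=
    (sq_le_sq₀ (normL2w_nonneg _ _ _) hε0.le).1 hp
  have e1 := (abs_le.1 (hh.abs_integral_mul_le (hh.sub hpc))).2
  have e2 := (abs_le.1 ((hh.sub hpc).abs_integral_mul_le hpc)).2
  have e3 := (abs_le.1 (H p)).2
  have i1 := hh.integrableOn_mul (hh.sub hpc)
  have i2 := (hh.sub hpc).integrableOn_mul hpc
  have i3 := hh.integrableOn_mul hpc
  have s1 : n ^ 2 = (∫ x in Lam, h x * (h x - p.eval x) * weight a b x)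
      + ∫ x in Lam, h x * p.eval x * weight a b x := by
    rw [hn, normL2w_sq, ← integral_add i1 i3]
    congr 1; ext x; ring
  have s2 : normL2w a b (fun x => p.eval x) ^ 2 + ∫ x in Lam, (h x - p.eval x) * p.eval x *
      weight a b x = ∫ x in Lam, h x * p.eval x * weight a b x := by
    rw [normL2w_sq, ← integral_add hpc.2 i2]
    congr 1; ext x; ring
  set P := normL2w a b (fun x => p.eval x) with hP
  have hP0 : 0 ≤ P := normL2w_nonneg _ _ _
  rw [← hn] at e1
  have e2' := (abs_le.1 ((hh.sub hpc).abs_integral_mul_le hpc)).1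
  rw [← hP] at e2'
  have hPle : P ≤ K + ε := by
    by_contra hc
    push Not at hc
    nlinarith
  nlinarith

/-! ### Integration by parts -/

lemma setIntegral_Lam (F : ℝ → ℝ) : ∫ x in Lam, F x = ∫ x in (-1 : ℝ)..1, F x := by
  rw [intervalIntegral.integral_of_le (by norm_num), integral_Ioc_eq_integral_Ioo, Lam]

/-- The boundary terms are killed by `w`, so `Ψ` is free at the endpoints. Only integrability is
asked of `w'`, which admits weights whose derivative blows up at `±1`. -/
lemma integral_mul_deriv_eq_neg {w w' Ψ : ℝ → ℝ} (hw : ContinuousOn w (Icc (-1) 1))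
    (hl : w (-1) = 0) (hr : w 1 = 0) (hd : ∀ x ∈ Lam, HasDerivAt w (w' x) x)
    (hw' : IntegrableOn w' Lam) (hΨ : ContDiff ℝ 1 Ψ) :
    ∫ x in Lam, w x * deriv Ψ x = -∫ x in Lam, w' x * Ψ x := by
  rw [setIntegral_Lam, setIntegral_Lam,
    intervalIntegral.integral_mul_deriv_eq_deriv_mul_of_hasDerivAt (u' := w') (v := Ψ)]
  · simp [hl, hr]
  · rwa [uIcc_of_le (by norm_num)]
  · exact hΨ.continuous.continuousOn
  · intro x hx
    rw [min_eq_left (by norm_num), max_eq_right (by norm_num)] at hx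
    exact hd x hx
  · intro x _
    exact (hΨ.differentiable (by norm_num) x).hasDerivAt
  · rw [intervalIntegrable_iff_integrableOn_Ioo_of_le (by norm_num)]
    exact hw'
  · exact (hΨ.continuous_deriv (by norm_num)).intervalIntegrable _ _

lemma hasDerivAt_eval_mul_weight (a b : ℝ) (p : ℝ[X]) {x : ℝ} (hx : x ∈ Lam) :
    HasDerivAt (fun y => p.eval y * weight a b y)
      ((jacobiStep a b p).eval x * weight (a - 1) (b - 1) x) x := by
  have h1 : 0 < 1 - x := by linarith [hx.2]
  have h2 : 0 < 1 + x := by linarith [hx.1]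
  have d1 : HasDerivAt (fun y : ℝ => (1 - y) ^ a) (-1 * a * (1 - x) ^ (a - 1)) x :=
    ((hasDerivAt_id x).const_sub 1).rpow_const (Or.inl h1.ne')
  have d2 : HasDerivAt (fun y : ℝ => (1 + y) ^ b) (1 * b * (1 + x) ^ (b - 1)) x :=
    ((hasDerivAt_id x).const_add 1).rpow_const (Or.inl h2.ne')
  refine ((p.hasDerivAt x).mul (d1.mul d2)).congr_deriv ?_
  rw [jacobiStep_apply, weight]
  simp only [eval_add, eval_mul, eval_sub, eval_one, eval_pow, eval_X, eval_C, Pi.mul_apply]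
  have e1 : (1 - x) ^ a = (1 - x) ^ (a - 1) * (1 - x) := by
    rw [← Real.rpow_add_one h1.ne']; congr 1; ring
  have e2 : (1 + x) ^ b = (1 + x) ^ (b - 1) * (1 + x) := by
    rw [← Real.rpow_add_one h2.ne']; congr 1; ring
  rw [e1, e2]; ring

lemma continuous_weight {a b : ℝ} (ha : 0 ≤ a) (hb : 0 ≤ b) : Continuous (weight a b) :=
  ((continuous_const.sub continuous_id).rpow_const fun _ => Or.inr ha).mul
    ((continuous_const.add continuous_id).rpow_const fun _ => Or.inr hb)

lemma weight_neg_one {a b : ℝ} (hb : 0 < b) : weight a b (-1) = 0 := by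
  simp [weight, Real.zero_rpow hb.ne']

lemma weight_one {a b : ℝ} (ha : 0 < a) : weight a b 1 = 0 := by
  simp [weight, Real.zero_rpow ha.ne']

/-- Repeated integration by parts of `p ω^{(a,b)}` against a smooth function. -/
lemma integral_eval_mul_weight_mul_iteratedDeriv {a b : ℝ} (n : ℕ) (ha : n - 1 < a)
    (hb : n - 1 < b) (p : ℝ[X]) {Ψ : ℝ → ℝ} (hΨ : ContDiff ℝ ((⊤ : ℕ∞) : WithTop ℕ∞) Ψ) :
    ∫ x in Lam, p.eval x * weight a b x * iteratedDeriv n Ψ x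
      = (-1) ^ n * ∫ x in Lam, (jacobiIter a b n p).eval x * weight (a - n) (b - n) x * Ψ x := by
  induction n generalizing Ψ with
  | zero => simp [jacobiIter]
  | succ n ih =>
    push_cast at ha hb
    rw [iteratedDeriv_succ', ih (by linarith) (by linarith)
      ((contDiff_infty_iff_deriv.1 hΨ).2), jacobiIter_succ_apply]
    rw [integral_mul_deriv_eq_neg
      (w' := fun x => (jacobiStep (a - n) (b - n) (jacobiIter a b n p)).eval x
        * weight (a - n - 1) (b - n - 1) x) (Ψ := Ψ)]
    · have e1 : a - ((n + 1 : ℕ) : ℝ) = a - n - 1 := by push_cast; ring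
      have e2 : b - ((n + 1 : ℕ) : ℝ) = b - n - 1 := by push_cast; ring
      rw [e1, e2]; ring
    · exact (Continuous.mul (by fun_prop)
        (continuous_weight (by linarith) (by linarith))).continuousOn
    · simp [weight_neg_one (a := a - n) (b := b - n) (by linarith)]
    · simp [weight_one (a := a - n) (b := b - n) (by linarith)]
    · exact fun x hx => hasDerivAt_eval_mul_weight _ _ _ hx
    · exact integrableOn_continuous_mul_weight (by linarith) (by linarith) (by fun_prop)
    · exact hΨ.of_le (by exact_mod_cast le_top)

lemma iteratedDeriv_eval_mul_weight (a b : ℝ) (p : ℝ[X]) (n : ℕ) {x : ℝ} (hx : x ∈ Lam) :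
    iteratedDeriv n (fun y => p.eval y * weight a b y) x
      = (jacobiIter a b n p).eval x * weight (a - n) (b - n) x := by
  induction n generalizing x with
  | zero => simp [jacobiIter]
  | succ n ih =>
    have hev : iteratedDeriv n (fun y => p.eval y * weight a b y) =ᶠ[nhds x]
        fun y => (jacobiIter a b n p).eval y * weight (a - n) (b - n) y := by
      filter_upwards [isOpen_Ioo.mem_nhds hx] with y hy
      exact ih hy
    have e1 : a - ((n + 1 : ℕ) : ℝ) = a - n - 1 := by push_cast; ring
    have e2 : b - ((n + 1 : ℕ) : ℝ) = b - n - 1 := by push_cast; ring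
    rw [iteratedDeriv_succ, hev.deriv_eq, (hasDerivAt_eval_mul_weight _ _ _ hx).deriv,
      jacobiIter_succ_apply, e1, e2]

/-! ### Test functions and weak derivatives -/

lemma IsTestFun.deriv {φ : ℝ → ℝ} (h : IsTestFun φ) : IsTestFun (deriv φ) :=
  ⟨(contDiff_infty_iff_deriv.1 h.1).2, h.2.1.deriv, (tsupport_deriv_subset).trans h.2.2⟩

lemma IsTestFun.iteratedDeriv {φ : ℝ → ℝ} (h : IsTestFun φ) (n : ℕ) :
    IsTestFun (iteratedDeriv n φ) := by
  induction n with
  | zero => simpa using h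
  | succ n ih => rw [iteratedDeriv_succ]; exact ih.deriv

lemma IsTestFun.eq_zero {φ : ℝ → ℝ} (h : IsTestFun φ) {x : ℝ} (hx : x ∉ Lam) : φ x = 0 :=
  image_eq_zero_of_notMem_tsupport fun h' => hx (h.2.2 h')

lemma IsTestFun.integrableOn {φ : ℝ → ℝ} (h : IsTestFun φ) : IntegrableOn φ Lam :=
  (h.1.continuous.integrable_of_hasCompactSupport h.2.1).integrableOn

/-- Repeated integration by parts of a test function against a smooth function. -/
lemma IsTestFun.integral_mul_iteratedDeriv {φ Ψ : ℝ → ℝ} (h : IsTestFun φ) (n : ℕ)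
    (hΨ : ContDiff ℝ ((⊤ : ℕ∞) : WithTop ℕ∞) Ψ) :
    ∫ x in Lam, φ x * _root_.iteratedDeriv n Ψ x
      = (-1) ^ n * ∫ x in Lam, _root_.iteratedDeriv n φ x * Ψ x := by
  induction n generalizing Ψ with
  | zero => simp
  | succ n ih =>
    have hn := h.iteratedDeriv n
    rw [iteratedDeriv_succ', ih ((contDiff_infty_iff_deriv.1 hΨ).2),
      integral_mul_deriv_eq_neg (w' := _root_.iteratedDeriv (n + 1) φ)
        hn.1.continuous.continuousOn (hn.eq_zero (by simp [Lam])) (hn.eq_zero (by simp [Lam]))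
        (fun x _ => ?_) (h.iteratedDeriv (n + 1)).integrableOn
        (hΨ.of_le (by exact_mod_cast le_top))]
    · ring
    · rw [iteratedDeriv_succ]
      exact (hn.1.differentiable (by simp) x).hasDerivAt

lemma IsTestFun.isWeakDeriv {φ : ℝ → ℝ} (h : IsTestFun φ) (n : ℕ) :
    IsWeakDeriv n φ (_root_.iteratedDeriv n φ) :=
  ⟨h.integrableOn.locallyIntegrableOn, (h.iteratedDeriv n).integrableOn.locallyIntegrableOn,
    fun _ hψ => h.integral_mul_iteratedDeriv n hψ.1⟩

lemma LocallyIntegrableOn.integrableOn_mul_test {g φ : ℝ → ℝ} (hg : LocallyIntegrableOn g Lam)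
    (h : IsTestFun φ) : IntegrableOn (fun x => g x * φ x) Lam := by
  have h1 : IntegrableOn g (tsupport φ) :=
    hg.integrableOn_compact_subset h.2.2 h.2.1
  have h2 : IntegrableOn (fun x => g x * φ x) (tsupport φ) :=
    h1.mul_continuousOn h.1.continuous.continuousOn h.2.1
  refine (integrableOn_iff_integrable_of_support_subset ?_).1 h2 |>.integrableOn
  intro x hx
  exact subset_tsupport φ fun h0 => hx (by simp [h0])

lemma ae_eq_of_forall_test {g g' : ℝ → ℝ} (hg : LocallyIntegrableOn g Lam)
    (hg' : LocallyIntegrableOn g' Lam)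
    (H : ∀ φ, IsTestFun φ → ∫ x in Lam, g x * φ x = ∫ x in Lam, g' x * φ x) :
    g =ᵐ[volume.restrict Lam] g' := by
  have h0 := IsOpen.ae_eq_zero_of_integral_contDiff_smul_eq_zero (μ := volume) (U := Lam)
    isOpen_Ioo (f := fun x => g x - g' x) (hg.sub hg') (fun φ h1 h2 h3 => ?_)
  · rw [Filter.EventuallyEq, ae_restrict_iff' measurableSet_Lam]
    filter_upwards [h0] with x hx hxL
    exact sub_eq_zero.1 (hx hxL)
  · have hφ : IsTestFun φ := ⟨h1, h2, h3⟩
    have e : ∫ x, φ x • (g x - g' x) = ∫ x in Lam, φ x • (g x - g' x) := by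
      rw [setIntegral_eq_integral_of_forall_compl_eq_zero]
      intro x hx
      simp [hφ.eq_zero hx]
    rw [e]
    have e2 : ∫ x in Lam, φ x • (g x - g' x) = ∫ x in Lam, (g x * φ x - g' x * φ x) := by
      congr 1; ext x; simp only [smul_eq_mul]; ring
    rw [e2, integral_sub (LocallyIntegrableOn.integrableOn_mul_test hg hφ)
      (LocallyIntegrableOn.integrableOn_mul_test hg' hφ), H φ hφ, sub_self]

lemma IsWeakDeriv.ae_eq {n : ℕ} {w g g' : ℝ → ℝ} (h : IsWeakDeriv n w g)
    (h' : IsWeakDeriv n w g') : g =ᵐ[volume.restrict Lam] g' :=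
  ae_eq_of_forall_test h.2.1 h'.2.1 fun φ hφ => by
    have := (h.2.2 φ hφ).symm.trans (h'.2.2 φ hφ)
    exact mul_left_cancel₀ (pow_ne_zero n (by norm_num)) this

lemma HasWeakDeriv.isWeakDeriv {n : ℕ} {w : ℝ → ℝ} (h : HasWeakDeriv n w) :
    IsWeakDeriv n w (weakDeriv n w) := by
  unfold weakDeriv
  rw [dif_pos h]
  exact h.choose_spec

lemma IsWeakDeriv.weakDeriv_ae_eq {n : ℕ} {w g : ℝ → ℝ} (h : IsWeakDeriv n w g) :
    weakDeriv n w =ᵐ[volume.restrict Lam] g :=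
  (HasWeakDeriv.isWeakDeriv ⟨g, h⟩).ae_eq h

lemma LocallyIntegrableOn.congr_ae_Lam {w w' : ℝ → ℝ} (h : LocallyIntegrableOn w Lam)
    (e : w =ᵐ[volume.restrict Lam] w') : LocallyIntegrableOn w' Lam := by
  rw [locallyIntegrableOn_iff (s := Lam) isOpen_Ioo.isLocallyClosed] at h ⊢
  intro K hK hKc
  exact (h K hK hKc).congr (ae_restrict_of_ae_restrict_of_subset hK e)

lemma IsWeakDeriv.congr {n : ℕ} {w w' g : ℝ → ℝ} (h : IsWeakDeriv n w g)
    (e : w =ᵐ[volume.restrict Lam] w') : IsWeakDeriv n w' g := by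
  refine ⟨LocallyIntegrableOn.congr_ae_Lam h.1 e, h.2.1, fun φ hφ => ?_⟩
  rw [← h.2.2 φ hφ]
  refine integral_congr_ae ?_
  filter_upwards [e] with x hx
  rw [hx]

lemma IsWeakDeriv.sub {n : ℕ} {w w' g g' : ℝ → ℝ} (h : IsWeakDeriv n w g)
    (h' : IsWeakDeriv n w' g') :
    IsWeakDeriv n (fun x => w x - w' x) (fun x => g x - g' x) := by
  refine ⟨h.1.sub h'.1, h.2.1.sub h'.2.1, fun φ hφ => ?_⟩
  simp only [sub_mul]
  rw [integral_sub (LocallyIntegrableOn.integrableOn_mul_test h.1 (hφ.iteratedDeriv n))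
    (LocallyIntegrableOn.integrableOn_mul_test h'.1 (hφ.iteratedDeriv n)),
    integral_sub (LocallyIntegrableOn.integrableOn_mul_test h.2.1 hφ)
    (LocallyIntegrableOn.integrableOn_mul_test h'.2.1 hφ), h.2.2 φ hφ, h'.2.2 φ hφ]
  ring

/-! ### Fractional integrals -/

/-- The kernel `t_+^{ρ-1}`. -/
def fracKernel (ρ t : ℝ) : ℝ := if 0 < t then t ^ (ρ - 1) else 0

/-- The left fractional integral `I_-^ρ z(y) = Γ(ρ)⁻¹ ∫_{-1}^y z(x) (y - x)^{ρ-1} dx`. -/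
def fracIntLeft (ρ : ℝ) (z : ℝ → ℝ) (y : ℝ) : ℝ :=
  (Real.Gamma ρ)⁻¹ * ∫ x in (-1 : ℝ)..y, z x * (y - x) ^ (ρ - 1)

lemma measurable_fracKernel (ρ : ℝ) : Measurable (fracKernel ρ) := by
  unfold fracKernel
  exact Measurable.ite measurableSet_Ioi (by fun_prop) measurable_const

lemma fracKernel_nonneg (ρ t : ℝ) : 0 ≤ fracKernel ρ t := by
  unfold fracKernel
  split_ifs with h
  · exact Real.rpow_nonneg h.le _
  · exact le_rfl

lemma intervalIntegral_left_eq (ρ : ℝ) (z : ℝ → ℝ) {y : ℝ} (hy : y ∈ Lam) :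
    ∫ x in (-1 : ℝ)..y, z x * (y - x) ^ (ρ - 1) = ∫ x in Lam, z x * fracKernel ρ (y - x) := by
  rw [intervalIntegral.integral_of_le hy.1.le, integral_Ioc_eq_integral_Ioo]
  have hsub : Ioo (-1) y ⊆ Lam := Ioo_subset_Ioo_right hy.2.le
  rw [setIntegral_eq_of_subset_of_forall_sdiff_eq_zero
    (f := fun x => z x * fracKernel ρ (y - x)) measurableSet_Lam hsub]
  · refine setIntegral_congr_fun measurableSet_Ioo fun x hx => ?_
    simp [fracKernel, hx.2]
  · intro x hx
    have : ¬ x < y := fun h => hx.2 ⟨hx.1.1, h⟩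
    simp [fracKernel, this]

lemma fracIntLeft_eq (ρ : ℝ) (z : ℝ → ℝ) {y : ℝ} (hy : y ∈ Lam) :
    fracIntLeft ρ z y = (Real.Gamma ρ)⁻¹ * ∫ x in Lam, z x * fracKernel ρ (y - x) := by
  rw [fracIntLeft, intervalIntegral_left_eq ρ z hy]

lemma fracInt_eq (ρ : ℝ) (v : ℝ → ℝ) {x : ℝ} (hx : x ∈ Lam) :
    fracInt ρ v x = (Real.Gamma ρ)⁻¹ * ∫ y in Lam, v y * fracKernel ρ (y - x) := by
  rw [fracInt, intervalIntegral.integral_of_le hx.2.le, integral_Ioc_eq_integral_Ioo]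
  have hsub : Ioo x 1 ⊆ Lam := Ioo_subset_Ioo_left hx.1.le
  rw [setIntegral_eq_of_subset_of_forall_sdiff_eq_zero
    (f := fun y => v y * fracKernel ρ (y - x)) measurableSet_Lam hsub]
  · congr 1
    refine setIntegral_congr_fun measurableSet_Ioo fun y hy => ?_
    simp [fracKernel, hy.1]
  · intro y hy
    have : ¬ x < y := fun h => hy.2 ⟨h, hy.1.2⟩
    simp [fracKernel, this]

/-- The left fractional integral of order `ρ` of `(1+x)^{-ρ}` is constant. This makes `(1+x)^{-ρ}`
the natural majorant for exchanging fractional integrals. -/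
lemma integral_fracKernel_weight {ρ : ℝ} (h0 : 0 < ρ) (h1 : ρ < 1) {y : ℝ} (hy : y ∈ Lam) :
    IntegrableOn (fun x => (1 + x) ^ (-ρ) * fracKernel ρ (y - x)) Lam ∧
      ∫ x in Lam, (1 + x) ^ (-ρ) * fracKernel ρ (y - x) = Real.Gamma (1 - ρ) * Real.Gamma ρ := by
  have hval : ∫ x in Lam, (1 + x) ^ (-ρ) * fracKernel ρ (y - x)
      = Real.Gamma (1 - ρ) * Real.Gamma ρ := by
    rw [← intervalIntegral_left_eq ρ _ hy]
    have := intervalIntegral_beta (c := 1 - ρ) (d := ρ) (by linarith) h0 hy.1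
    simpa using this
  refine ⟨?_, hval⟩
  by_contra h
  rw [integral_undef h] at hval
  have := mul_pos (Real.Gamma_pos_of_pos (by linarith : 0 < 1 - ρ)) (Real.Gamma_pos_of_pos h0)
  linarith

/-- Tonelli: after `z` is replaced by its majorant, the inner integral in `x` no longer depends on
`y`, so integrability of `W` suffices. -/
lemma integrable_fracKernel_prod {ρ : ℝ} (h0 : 0 < ρ) (h1 : ρ < 1) {W z : ℝ → ℝ} {K : ℝ}
    (hW : IntegrableOn W Lam) (hz : AEStronglyMeasurable z (volume.restrict Lam))
    (hzb : ∀ x ∈ Lam, |z x| ≤ K * (1 + x) ^ (-ρ)) :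
    Integrable (fun p : ℝ × ℝ => W p.2 * fracKernel ρ (p.2 - p.1) * z p.1)
      ((volume.restrict Lam).prod (volume.restrict Lam)) := by
  have hker : Measurable fun p : ℝ × ℝ => fracKernel ρ (p.2 - p.1) :=
    (measurable_fracKernel ρ).comp (measurable_snd.sub measurable_fst)
  have hbase : Integrable
      (fun p : ℝ × ℝ => W p.2 * ((1 + p.1) ^ (-ρ) * fracKernel ρ (p.2 - p.1)))
      ((volume.restrict Lam).prod (volume.restrict Lam)) := by
    rw [integrable_prod_iff']
    · constructor
      · filter_upwards [ae_restrict_mem measurableSet_Lam] with y hy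
        exact (integral_fracKernel_weight h0 h1 hy).1.const_mul (W y)
      · refine (hW.norm.mul_const (Real.Gamma (1 - ρ) * Real.Gamma ρ)).congr ?_
        filter_upwards [ae_restrict_mem measurableSet_Lam] with y hy
        rw [← (integral_fracKernel_weight h0 h1 hy).2, ← integral_const_mul]
        refine setIntegral_congr_fun measurableSet_Lam fun x hx => ?_
        simp only [norm_mul]
        rw [Real.norm_of_nonneg (Real.rpow_nonneg (by linarith [hx.1]) _),
          Real.norm_of_nonneg (fracKernel_nonneg _ _)]
    · refine hW.aestronglyMeasurable.comp_snd.mul (Measurable.aestronglyMeasurable ?_)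
      exact Measurable.mul (by fun_prop) hker
  refine (hbase.const_mul K).mono ?_ ?_
  · exact (hW.aestronglyMeasurable.comp_snd.mul hker.aestronglyMeasurable).mul hz.comp_fst
  · have : ∀ᵐ p ∂((volume.restrict Lam).prod (volume.restrict Lam)), p.1 ∈ Lam :=
      Measure.quasiMeasurePreserving_fst.ae (ae_restrict_mem measurableSet_Lam)
    filter_upwards [this] with p hp
    have hb := hzb p.1 hp
    have hr : 0 ≤ (1 + p.1) ^ (-ρ) := Real.rpow_nonneg (by linarith [hp.1]) _
    have hk := fracKernel_nonneg ρ (p.2 - p.1)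
    simp only [norm_mul, Real.norm_eq_abs]
    rw [abs_of_nonneg hr, abs_of_nonneg hk]
    have hK : K * (1 + p.1) ^ (-ρ) ≤ |K| * (1 + p.1) ^ (-ρ) :=
      mul_le_mul_of_nonneg_right (le_abs_self K) hr
    calc |W p.2| * fracKernel ρ (p.2 - p.1) * |z p.1|
        ≤ |W p.2| * fracKernel ρ (p.2 - p.1) * (|K| * (1 + p.1) ^ (-ρ)) :=
          mul_le_mul_of_nonneg_left (hb.trans hK) (mul_nonneg (abs_nonneg _) hk)
      _ = _ := by ring

lemma integral_fracInt_mul {ρ : ℝ} (h0 : 0 < ρ) (h1 : ρ < 1) {W z : ℝ → ℝ} {K : ℝ}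
    (hW : IntegrableOn W Lam) (hz : AEStronglyMeasurable z (volume.restrict Lam))
    (hzb : ∀ x ∈ Lam, |z x| ≤ K * (1 + x) ^ (-ρ)) :
    ∫ x in Lam, fracInt ρ W x * z x = ∫ y in Lam, W y * fracIntLeft ρ z y := by
  have hint := integrable_fracKernel_prod h0 h1 hW hz hzb
  have hsw := integral_integral_swap
    (f := fun x y => W y * fracKernel ρ (y - x) * z x) hint
  have eL : ∫ x in Lam, fracInt ρ W x * z x
      = (Real.Gamma ρ)⁻¹ * ∫ x in Lam, ∫ y in Lam, W y * fracKernel ρ (y - x) * z x := by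
    rw [← integral_const_mul]
    refine setIntegral_congr_fun measurableSet_Lam fun x hx => ?_
    simp only [fracInt_eq ρ W hx, integral_mul_const]
    ring
  have eR : ∫ y in Lam, W y * fracIntLeft ρ z y
      = (Real.Gamma ρ)⁻¹ * ∫ y in Lam, ∫ x in Lam, W y * fracKernel ρ (y - x) * z x := by
    rw [← integral_const_mul]
    refine setIntegral_congr_fun measurableSet_Lam fun y hy => ?_
    simp only [fracIntLeft_eq ρ z hy, mul_assoc, integral_const_mul]
    rw [mul_left_comm]
    congr 3; ext x; ring
  rw [eL, eR, hsw]

/-- Bounded functions thereby fall under the majorant `(1+x)^{-ρ}`. -/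
lemma one_le_two_rpow_mul {ρ : ℝ} (h0 : 0 < ρ) {x : ℝ} (hx : x ∈ Lam) :
    1 ≤ 2 ^ ρ * (1 + x) ^ (-ρ) := by
  have h2 : 0 < 1 + x := by linarith [hx.1]
  rw [Real.rpow_neg h2.le, ← div_eq_mul_inv, le_div_iff₀ (Real.rpow_pos_of_pos h2 _), one_mul]
  exact Real.rpow_le_rpow h2.le (by linarith [hx.2]) h0.le

lemma integrable_fracKernel_prod_one {ρ : ℝ} (h0 : 0 < ρ) (h1 : ρ < 1) {W : ℝ → ℝ}
    (hW : IntegrableOn W Lam) :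
    Integrable (fun p : ℝ × ℝ => W p.2 * fracKernel ρ (p.2 - p.1))
      ((volume.restrict Lam).prod (volume.restrict Lam)) := by
  simpa using integrable_fracKernel_prod h0 h1 hW (z := fun _ => 1) (K := 2 ^ ρ)
    aestronglyMeasurable_const (fun x hx => by simpa using one_le_two_rpow_mul h0 hx)

lemma integrableOn_fracInt {ρ : ℝ} (h0 : 0 < ρ) (h1 : ρ < 1) {W : ℝ → ℝ}
    (hW : IntegrableOn W Lam) : IntegrableOn (fracInt ρ W) Lam := by
  have := (integrable_fracKernel_prod_one h0 h1 hW).integral_prod_left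
  refine IntegrableOn.congr_fun (this.const_mul (Real.Gamma ρ)⁻¹) (fun x hx => ?_)
    measurableSet_Lam
  exact (fracInt_eq ρ W hx).symm

lemma fracInt_sub_ae {ρ : ℝ} (h0 : 0 < ρ) (h1 : ρ < 1) {u v : ℝ → ℝ}
    (hu : IntegrableOn u Lam) (hv : IntegrableOn v Lam) :
    (fun x => fracInt ρ u x - fracInt ρ v x) =ᵐ[volume.restrict Lam]
      fracInt ρ (fun x => u x - v x) := by
  filter_upwards [(integrable_fracKernel_prod_one h0 h1 hu).prod_right_ae,
    (integrable_fracKernel_prod_one h0 h1 hv).prod_right_ae,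
    ae_restrict_mem measurableSet_Lam] with x h2 h3 hx
  rw [fracInt_eq ρ _ hx, fracInt_eq ρ _ hx, fracInt_eq ρ _ hx, ← mul_sub, ← integral_sub h2 h3]
  simp only [sub_mul]

/-! ### Fractional integrals of weighted polynomials -/

/-- The multipliers of `I_-^ρ` on `(1+x)^{j-ρ}`. -/
def fracCoeff (ρ : ℝ) (j : ℕ) : ℝ := Real.Gamma (j + 1 - ρ) / Real.Gamma (j + 1)

lemma fracCoeff_pos {ρ : ℝ} (h1 : ρ < 1) (j : ℕ) : 0 < fracCoeff ρ j := by
  have : (0 : ℝ) ≤ j := Nat.cast_nonneg j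
  exact div_pos (Real.Gamma_pos_of_pos (by linarith)) (Real.Gamma_pos_of_pos (by linarith))

/-- By the beta integral, `(1+x)^{j-ρ}` is sent to a multiple of `(1+x)^j`. So, once the factor
`(1+x)^{-ρ}` is removed, the operator is diagonal in powers of `1 + x` and keeps degrees. -/
lemma fracIntLeft_eval_mul {ρ : ℝ} (h0 : 0 < ρ) (h1 : ρ < 1) (q : ℝ[X]) {y : ℝ} (hy : y ∈ Lam) :
    fracIntLeft ρ (fun x => q.eval x * (1 + x) ^ (-ρ)) y
      = (diagLeft (fracCoeff ρ) q).eval y := by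
  -- Integrability is carried through the induction because additivity of the integral requires it.
  have key : IntegrableOn (fun x => q.eval x * (1 + x) ^ (-ρ) * fracKernel ρ (y - x)) Lam ∧
      fracIntLeft ρ (fun x => q.eval x * (1 + x) ^ (-ρ)) y
        = (diagLeft (fracCoeff ρ) q).eval y := by
    induction q using induction_one_add_X with
    | hadd p q hp hq =>
      refine ⟨?_, ?_⟩
      · have := hp.1.add hq.1
        refine this.congr_fun (fun x _ => ?_) measurableSet_Lam
        simp only [Pi.add_apply, eval_add]; ring
      · rw [map_add, eval_add, ← hp.2, ← hq.2, fracIntLeft_eq _ _ hy, fracIntLeft_eq _ _ hy,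
          fracIntLeft_eq _ _ hy, ← mul_add, ← integral_add hp.1 hq.1]
        congr 2; ext x; simp only [eval_add]; ring
    | hmon j a =>
      have hj : (0 : ℝ) ≤ j := Nat.cast_nonneg j
      have e : ∀ x ∈ Lam, (C a * (X + C 1) ^ j).eval x * (1 + x) ^ (-ρ)
          = a * (1 + x) ^ (j + 1 - ρ - 1) := by
        intro x hx
        have h2 : 0 < 1 + x := by linarith [hx.1]
        simp only [eval_mul, eval_C, eval_pow, eval_add, eval_X]
        rw [show (j : ℝ) + 1 - ρ - 1 = j + -ρ by ring, Real.rpow_add h2, Real.rpow_natCast,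
          add_comm x 1]
        ring
      have hb := intervalIntegral_beta (c := j + 1 - ρ) (d := ρ) (by linarith) h0 hy.1
      have hval : ∫ x in Lam, (1 + x) ^ ((j : ℝ) + 1 - ρ - 1) * fracKernel ρ (y - x)
          = (1 + y) ^ j * (Real.Gamma (j + 1 - ρ) * Real.Gamma ρ / Real.Gamma (j + 1)) := by
        rw [← intervalIntegral_left_eq ρ _ hy, hb, ← Real.rpow_natCast]
        rw [show (j : ℝ) + 1 - ρ + ρ - 1 = j by ring, show (j : ℝ) + 1 - ρ + ρ = j + 1 by ring]
      refine ⟨?_, ?_⟩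
      · have hi : IntegrableOn (fun x => (1 + x) ^ ((j : ℝ) + 1 - ρ - 1) *
            fracKernel ρ (y - x)) Lam := by
          by_contra h
          rw [integral_undef h] at hval
          have : 0 < (1 + y) ^ j * (Real.Gamma (j + 1 - ρ) * Real.Gamma ρ / Real.Gamma (j + 1)) :=
            mul_pos (pow_pos (by linarith [hy.1]) _) (div_pos (mul_pos
              (Real.Gamma_pos_of_pos (by linarith)) (Real.Gamma_pos_of_pos h0))
              (Real.Gamma_pos_of_pos (by linarith)))
          linarith
        refine IntegrableOn.congr_fun (hi.const_mul a) (fun x hx => ?_) measurableSet_Lam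
        simp only [e x hx]; ring
      · rw [fracIntLeft_eq _ _ hy, diagLeft_pow]
        have : ∫ x in Lam, (C a * (X + C 1) ^ j).eval x * (1 + x) ^ (-ρ) * fracKernel ρ (y - x)
            = a * ∫ x in Lam, (1 + x) ^ ((j : ℝ) + 1 - ρ - 1) * fracKernel ρ (y - x) := by
          rw [← integral_const_mul]
          refine setIntegral_congr_fun measurableSet_Lam fun x hx => ?_
          simp only [e x hx]; ring
        rw [this, hval]
        simp only [eval_mul, eval_C, eval_pow, eval_add, eval_X, fracCoeff]
        have hG := (Real.Gamma_pos_of_pos h0).ne'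
        rw [add_comm 1 y]
        field_simp
  exact key.2

lemma fracInt_eq_fracIntLeft (ρ : ℝ) (v : ℝ → ℝ) (x : ℝ) :
    fracInt ρ v x = fracIntLeft ρ (fun t => v (-t)) (-x) := by
  rw [fracInt, fracIntLeft]
  congr 1
  have := intervalIntegral.integral_comp_neg (fun y => v y * (y - x) ^ (ρ - 1))
    (a := -1) (b := -x)
  rw [neg_neg, neg_neg] at this
  rw [← this]
  congr 1; ext t; congr 2; ring

lemma fracInt_eval_mul {ρ : ℝ} (h0 : 0 < ρ) (h1 : ρ < 1) (p : ℝ[X]) {x : ℝ} (hx : x ∈ Lam) :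
    fracInt ρ (fun y => p.eval y * (1 - y) ^ (-ρ)) x
      = (reflect (diagLeft (fracCoeff ρ) (reflect p))).eval x := by
  have hx' : -x ∈ Lam := ⟨by linarith [hx.2], by linarith [hx.1]⟩
  rw [eval_reflect, ← fracIntLeft_eval_mul h0 h1 _ hx', fracInt_eq_fracIntLeft]
  simp only [eval_reflect, sub_neg_eq_add]

/-! ### Fractional derivatives -/

lemma locallyIntegrable_fracKernel {ρ : ℝ} (h0 : 0 < ρ) :
    LocallyIntegrable (fracKernel ρ) := by
  rw [locallyIntegrable_iff]
  intro K hK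
  obtain ⟨R, hR⟩ := hK.isBounded.subset_ball 0
  have h : IntegrableOn (fun t : ℝ => t ^ (ρ - 1)) (Ioo 0 (max R 1)) := by
    rw [← intervalIntegrable_iff_integrableOn_Ioo_of_le (by positivity)]
    exact intervalIntegral.intervalIntegrable_rpow' (by linarith)
  have h2 : IntegrableOn (fracKernel ρ) (Ioo (-(max R 1)) (max R 1)) := by
    have h3 : IntegrableOn (fracKernel ρ) (Ioo 0 (max R 1)) :=
      h.congr_fun (fun t ht => by simp [fracKernel, ht.1]) measurableSet_Ioo
    refine IntegrableOn.of_forall_sdiff_eq_zero h3 measurableSet_Ioo (fun t ht => ?_)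
    have : ¬ 0 < t := fun h => ht.2 ⟨h, ht.1.2⟩
    simp [fracKernel, this]
  refine h2.mono_set (hR.trans ?_)
  rw [Real.ball_eq_Ioo]
  exact Ioo_subset_Ioo (by simp) (by simp)

/-- The left fractional integral of a test function, as a smooth function on the line. -/
def fracConv (ρ : ℝ) (ψ : ℝ → ℝ) (y : ℝ) : ℝ :=
  (Real.Gamma ρ)⁻¹ * ∫ x, ψ x * fracKernel ρ (y - x)

lemma fracConv_eq_convolution (ρ : ℝ) (ψ : ℝ → ℝ) :
    fracConv ρ ψ = fun y => (Real.Gamma ρ)⁻¹ *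
      (convolution ψ (fracKernel ρ) (ContinuousLinearMap.mul ℝ ℝ) volume) y := by
  ext y
  simp [fracConv, convolution]

lemma fracIntLeft_test (ρ : ℝ) {ψ : ℝ → ℝ} (hψ : IsTestFun ψ) {y : ℝ} (hy : y ∈ Lam) :
    fracIntLeft ρ ψ y = fracConv ρ ψ y := by
  rw [fracIntLeft_eq _ _ hy, fracConv, setIntegral_eq_integral_of_forall_compl_eq_zero]
  intro x hx
  simp [hψ.eq_zero hx]

lemma contDiff_fracConv {ρ : ℝ} (h0 : 0 < ρ) {ψ : ℝ → ℝ} (hψ : IsTestFun ψ) :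
    ContDiff ℝ ((⊤ : ℕ∞) : WithTop ℕ∞) (fracConv ρ ψ) := by
  rw [fracConv_eq_convolution]
  exact contDiff_const.mul (hψ.2.1.contDiff_convolution_left _ hψ.1
    (locallyIntegrable_fracKernel h0))

/-- The derivatives of the convolution fall on its compactly supported factor. -/
lemma iteratedDeriv_fracConv {ρ : ℝ} (h0 : 0 < ρ) {ψ : ℝ → ℝ} (hψ : IsTestFun ψ) (n : ℕ) :
    iteratedDeriv n (fracConv ρ ψ) = fracConv ρ (iteratedDeriv n ψ) := by
  induction n with
  | zero => simp
  | succ n ih =>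
    rw [iteratedDeriv_succ, ih, iteratedDeriv_succ]
    have hn := hψ.iteratedDeriv n
    ext y
    rw [fracConv_eq_convolution, fracConv_eq_convolution]
    exact ((hn.2.1.hasDerivAt_convolution_left _ (hn.1.of_le (by exact_mod_cast le_top))
      (locallyIntegrable_fracKernel h0) y).const_mul _).deriv

lemma IsTestFun.exists_bound {ρ : ℝ} (h0 : 0 < ρ) {ψ : ℝ → ℝ} (hψ : IsTestFun ψ) :
    ∃ K, ∀ x ∈ Lam, |ψ x| ≤ K * (1 + x) ^ (-ρ) := by
  obtain ⟨K, hK⟩ := hψ.1.continuous.bounded_above_of_compact_support hψ.2.1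
  have hK0 : 0 ≤ K := (norm_nonneg _).trans (hK 0)
  refine ⟨K * 2 ^ ρ, fun x hx => (hK x).trans ?_⟩
  rw [mul_assoc]
  exact le_mul_of_one_le_right hK0 (one_le_two_rpow_mul h0 hx)

/-- `W` is the derivative of order `k` of `w`, and `w` vanishes to order `k` at both ends. -/
def IsZeroTraceDeriv (k : ℕ) (w W : ℝ → ℝ) : Prop :=
  IntegrableOn w Lam ∧ IntegrableOn W Lam ∧
    ∀ Ψ : ℝ → ℝ, ContDiff ℝ ((⊤ : ℕ∞) : WithTop ℕ∞) Ψ →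
      ∫ x in Lam, w x * iteratedDeriv k Ψ x = (-1) ^ k * ∫ x in Lam, W x * Ψ x

lemma IsZeroTraceDeriv.isWeakDeriv {k : ℕ} {w W : ℝ → ℝ} (h : IsZeroTraceDeriv k w W) :
    IsWeakDeriv k w W :=
  ⟨h.1.locallyIntegrableOn, h.2.1.locallyIntegrableOn, fun φ hφ => h.2.2 φ hφ.1⟩

/-- Riemann-Liouville and Caputo derivatives agree for functions with zero trace. -/
lemma IsZeroTraceDeriv.isWeakDeriv_fracInt {ρ : ℝ} (h0 : 0 < ρ) (h1 : ρ < 1) {k : ℕ}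
    {w W : ℝ → ℝ} (h : IsZeroTraceDeriv k w W) :
    IsWeakDeriv k (fracInt ρ w) (fracInt ρ W) := by
  refine ⟨(integrableOn_fracInt h0 h1 h.1).locallyIntegrableOn,
    (integrableOn_fracInt h0 h1 h.2.1).locallyIntegrableOn, fun ψ hψ => ?_⟩
  have hk := hψ.iteratedDeriv k
  obtain ⟨K, hK⟩ := hψ.exists_bound h0
  obtain ⟨K', hK'⟩ := hk.exists_bound h0
  rw [integral_fracInt_mul h0 h1 h.1 hk.1.continuous.aestronglyMeasurable hK',
    integral_fracInt_mul h0 h1 h.2.1 hψ.1.continuous.aestronglyMeasurable hK]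
  have e1 : ∫ y in Lam, w y * fracIntLeft ρ (iteratedDeriv k ψ) y
      = ∫ y in Lam, w y * iteratedDeriv k (fracConv ρ ψ) y :=
    setIntegral_congr_fun measurableSet_Lam fun y hy => by
      simp only [fracIntLeft_test ρ hk hy, iteratedDeriv_fracConv h0 hψ]
  have e2 : ∫ y in Lam, W y * fracIntLeft ρ ψ y = ∫ y in Lam, W y * fracConv ρ ψ y :=
    setIntegral_congr_fun measurableSet_Lam fun y hy => by simp only [fracIntLeft_test ρ hψ hy]
  rw [e1, e2]
  -- The function `fracConv ρ ψ` is smooth but need not vanish near `1`. This is where the zero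
  -- trace of `w` is used.
  exact h.2.2 _ (contDiff_fracConv h0 hψ)

lemma contDiff_eval (p : ℝ[X]) : ContDiff ℝ ((⊤ : ℕ∞) : WithTop ℕ∞) (fun x => p.eval x) := by
  simpa using p.contDiff_aeval (𝕜 := ℝ) _

lemma iteratedDeriv_eval (p : ℝ[X]) (n : ℕ) :
    iteratedDeriv n (fun x => p.eval x) = fun x => (derivative^[n] p).eval x := by
  induction n with
  | zero => simp
  | succ n ih =>
    rw [iteratedDeriv_succ, ih, Function.iterate_succ_apply']
    ext x
    exact Polynomial.deriv _

/-- The adjoint of the right fractional derivative on `q ω^{(0,-ρ)}`. -/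
lemma IsZeroTraceDeriv.integral_fracInt_mul_eval {ρ : ℝ} (h0 : 0 < ρ) (h1 : ρ < 1) {k : ℕ}
    {w W : ℝ → ℝ} (h : IsZeroTraceDeriv k w W) (q : ℝ[X]) :
    ∫ x in Lam, (-1) ^ k * fracInt ρ W x * q.eval x * weight 0 (-ρ) x
      = ∫ x in Lam, w x * (derivative^[k] (diagLeft (fracCoeff ρ) q)).eval x := by
  obtain ⟨K, hK⟩ : ∃ K, ∀ x ∈ Icc (-1 : ℝ) 1, ‖q.eval x‖ ≤ K :=
    isCompact_Icc.exists_bound_of_continuousOn q.continuous.continuousOn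
  have h2 := h.2.2 _ (contDiff_eval (diagLeft (fracCoeff ρ) q))
  rw [iteratedDeriv_eval] at h2
  rw [h2, ← integral_const_mul]
  have h3 := integral_fracInt_mul h0 h1 h.2.1 (z := fun x => q.eval x * (1 + x) ^ (-ρ)) (K := K)
    (Measurable.aestronglyMeasurable (by
      have := q.continuous.measurable
      fun_prop)) (fun x hx => by
      have hr : 0 ≤ (1 + x) ^ (-ρ) := Real.rpow_nonneg (by linarith [hx.1]) _
      rw [abs_mul, abs_of_nonneg hr]
      exact mul_le_mul_of_nonneg_right (hK x (Ioo_subset_Icc_self hx)) hr)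
  have e1 : ∫ y in Lam, W y * fracIntLeft ρ (fun x => q.eval x * (1 + x) ^ (-ρ)) y
      = ∫ y in Lam, W y * (diagLeft (fracCoeff ρ) q).eval y :=
    setIntegral_congr_fun measurableSet_Lam fun y hy => by
      simp only [fracIntLeft_eval_mul h0 h1 q hy]
  rw [integral_const_mul, ← e1, ← h3, ← integral_const_mul]
  congr 1; ext x
  simp only [weight, Real.rpow_zero]
  ring

/-! ### Cutoff functions and weak integration by parts -/

/-- A smooth function on the line that vanishes for `t ≤ 1` and is `1` for `t ≥ 2`. -/
def cutProfile (t : ℝ) : ℝ := Real.smoothTransition (t - 1)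

lemma contDiff_cutProfile : ContDiff ℝ ((⊤ : ℕ∞) : WithTop ℕ∞) cutProfile :=
  Real.smoothTransition.contDiff.comp (contDiff_id.sub contDiff_const)

lemma cutProfile_of_le {t : ℝ} (h : t ≤ 1) : cutProfile t = 0 :=
  Real.smoothTransition.zero_of_nonpos (by linarith)

lemma cutProfile_of_ge {t : ℝ} (h : 2 ≤ t) : cutProfile t = 1 :=
  Real.smoothTransition.one_of_one_le (by linarith)

/-- The profile is constant beyond `t = 2`, so only a compact range matters, apart from the trivial
bound for `i = 0`. -/
lemma exists_bound_cutProfile (i : ℕ) :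
    ∃ K, ∀ t, 0 ≤ t → |iteratedDeriv i cutProfile t| * t ^ i ≤ K := by
  have hc : Continuous fun t : ℝ => |iteratedDeriv i cutProfile t| * t ^ i :=
    (contDiff_cutProfile.continuous_iteratedDeriv i (by exact_mod_cast le_top)).abs.mul
      (continuous_pow i)
  obtain ⟨K, hK⟩ := isCompact_Icc.exists_bound_of_continuousOn
    (s := Icc (0 : ℝ) 3) hc.continuousOn
  refine ⟨max K 1, fun t ht => ?_⟩
  rcases le_or_gt t 3 with h3 | h3
  · exact (le_abs_self _).trans ((hK t ⟨ht, h3⟩).trans (le_max_left _ _))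
  · have : cutProfile =ᶠ[nhds t] fun _ => 1 := by
      filter_upwards [lt_mem_nhds h3] with y hy
      exact cutProfile_of_ge (by linarith)
    rw [this.iteratedDeriv_eq i, iteratedDeriv_const]
    split_ifs with hi
    · simp [hi]
    · simp

/-- The cutoff at the left end of `Λ`, at scale `1 / c`. -/
def edgeCut (c x : ℝ) : ℝ := cutProfile (c * (1 + x))

/-- The cutoff at both ends of `Λ`, at scale `1 / c`. -/
def cutoff (c x : ℝ) : ℝ := edgeCut c x * edgeCut c (-x)

lemma contDiff_edgeCut (c : ℝ) : ContDiff ℝ ((⊤ : ℕ∞) : WithTop ℕ∞) (edgeCut c) :=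
  contDiff_cutProfile.comp (contDiff_const.mul (contDiff_const.add contDiff_id))

lemma contDiff_edgeCut_neg (c : ℝ) :
    ContDiff ℝ ((⊤ : ℕ∞) : WithTop ℕ∞) (fun x => edgeCut c (-x)) :=
  (contDiff_edgeCut c).comp contDiff_neg

lemma contDiff_cutoff (c : ℝ) : ContDiff ℝ ((⊤ : ℕ∞) : WithTop ℕ∞) (cutoff c) :=
  (contDiff_edgeCut c).mul (contDiff_edgeCut_neg c)

lemma iteratedDeriv_edgeCut (c : ℝ) (i : ℕ) (x : ℝ) :
    iteratedDeriv i (edgeCut c) x = c ^ i * iteratedDeriv i cutProfile (c * (1 + x)) := by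
  have h1 := congrFun (iteratedDeriv_comp_const_add i (fun z => cutProfile (c * z)) 1) x
  have h2 := congrFun (iteratedDeriv_comp_const_mul (n := i)
    (contDiff_cutProfile.of_le (by exact_mod_cast le_top)) c) (1 + x)
  exact h1.trans h2

/-- Scale invariance: `c^i (1+x)^i = (c (1+x))^i`, so the bound on the profile is uniform in `c`. -/
lemma exists_bound_edgeCut (i : ℕ) :
    ∃ K, ∀ c x : ℝ, 0 < c → -1 < x → |iteratedDeriv i (edgeCut c) x| * (1 + x) ^ i ≤ K := by
  obtain ⟨K, hK⟩ := exists_bound_cutProfile i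
  refine ⟨K, fun c x hc hx => ?_⟩
  have := hK (c * (1 + x)) (mul_nonneg hc.le (by linarith))
  rw [iteratedDeriv_edgeCut, abs_mul, abs_of_nonneg (pow_nonneg hc.le i)]
  rw [mul_pow] at this
  linarith

/-- In Leibniz' rule `i` derivatives at the left end consume `(1+x)^i` and `j - i` at the right end
consume `(1-x)^{j-i}`. The surplus powers are at most `2^j`. -/
lemma exists_bound_cutoff (j : ℕ) :
    ∃ K, 0 ≤ K ∧ ∀ c x : ℝ, 0 < c → x ∈ Lam →
      |iteratedDeriv j (cutoff c) x| * ((1 - x) * (1 + x)) ^ j ≤ K := by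
  choose K hK using exists_bound_edgeCut
  have hK0 : ∀ i, 0 ≤ K i := fun i => le_trans (by positivity) (hK i 1 0 one_pos (by norm_num))
  refine ⟨∑ i ∈ Finset.range (j + 1), (j.choose i : ℝ) * (K i * K (j - i)) * 2 ^ j,
    Finset.sum_nonneg fun i _ => by have := hK0 i; have := hK0 (j - i); positivity,
    fun c x hc hx => ?_⟩
  have h1 : 0 < 1 - x := by linarith [hx.2]
  have h2 : 0 < 1 + x := by linarith [hx.1]
  have hle : ((j : ℕ∞) : WithTop ℕ∞) ≤ ((⊤ : ℕ∞) : WithTop ℕ∞) := by exact_mod_cast le_top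
  have hmul : iteratedDeriv j (cutoff c) x = ∑ i ∈ Finset.range (j + 1),
      (j.choose i : ℝ) * iteratedDeriv i (edgeCut c) x
        * iteratedDeriv (j - i) (fun y => edgeCut c (-y)) x :=
    iteratedDeriv_mul ((contDiff_edgeCut c).contDiffAt.of_le hle)
      ((contDiff_edgeCut_neg c).contDiffAt.of_le hle)
  rw [hmul]
  refine (mul_le_mul_of_nonneg_right (Finset.abs_sum_le_sum_abs _ _) (by positivity)).trans ?_
  rw [Finset.sum_mul]
  refine Finset.sum_le_sum fun i hi => ?_
  have hij : i ≤ j := by simpa [Nat.lt_succ_iff] using hi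
  have hb1 := hK i c x hc hx.1
  have hb2 := hK (j - i) c (-x) hc (by linarith)
  rw [iteratedDeriv_comp_neg, abs_mul, abs_mul, Nat.abs_cast]
  simp only [smul_eq_mul, abs_mul, abs_pow, abs_neg, abs_one, one_pow, one_mul]
  have e : ((1 - x) * (1 + x)) ^ j
      = (1 + x) ^ i * (1 + -x) ^ (j - i) * ((1 - x) ^ i * (1 + x) ^ (j - i)) := by
    have e : ∀ t : ℝ, t ^ j = t ^ i * t ^ (j - i) := fun t => by
      rw [← pow_add, Nat.add_sub_of_le hij]
    rw [mul_pow, e (1 - x), e (1 + x)]; ring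
  have hle2 : (1 - x) ^ i * (1 + x) ^ (j - i) ≤ 2 ^ j := by
    nth_rewrite 2 [← Nat.add_sub_of_le hij]
    rw [pow_add]
    exact mul_le_mul (pow_le_pow_left₀ h1.le (by linarith [hx.1]) _)
      (pow_le_pow_left₀ h2.le (by linarith [hx.2]) _) (by positivity) (by positivity)
  rw [e]
  have h3 : 0 < 1 + -x := by linarith
  calc (j.choose i : ℝ) * |iteratedDeriv i (edgeCut c) x| * |iteratedDeriv (j - i) (edgeCut c) (-x)|
        * ((1 + x) ^ i * (1 + -x) ^ (j - i) * ((1 - x) ^ i * (1 + x) ^ (j - i)))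
      = (j.choose i : ℝ) * ((|iteratedDeriv i (edgeCut c) x| * (1 + x) ^ i)
        * (|iteratedDeriv (j - i) (edgeCut c) (-x)| * (1 + -x) ^ (j - i)))
        * ((1 - x) ^ i * (1 + x) ^ (j - i)) := by ring
    _ ≤ (j.choose i : ℝ) * (K i * K (j - i)) * 2 ^ j := by
      refine mul_le_mul (mul_le_mul_of_nonneg_left ?_ (by positivity)) hle2 (by positivity) ?_
      · exact mul_le_mul hb1 hb2 (by positivity) (hK0 i)
      · have := hK0 i; have := hK0 (j - i); positivity

lemma abs_cutoff_le_one (c x : ℝ) : |cutoff c x| ≤ 1 := by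
  rw [cutoff, abs_mul]
  have h : ∀ y, |edgeCut c y| ≤ 1 := fun y =>
    abs_le.2 ⟨by linarith [Real.smoothTransition.nonneg (c * (1 + y) - 1),
      show edgeCut c y = Real.smoothTransition (c * (1 + y) - 1) from rfl],
      Real.smoothTransition.le_one _⟩
  exact mul_le_one₀ (h x) (abs_nonneg _) (h (-x))

lemma cutoff_eq_zero {c x : ℝ} (hc : 0 < c) (hx : x ∉ Icc (-1 + 1 / c) (1 - 1 / c)) :
    cutoff c x = 0 := by
  rw [mem_Icc, not_and_or, not_le, not_le] at hx
  rcases hx with h | h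
  · have : edgeCut c x = 0 := cutProfile_of_le (by
      have := mul_lt_mul_of_pos_left (show 1 + x < 1 / c by linarith) hc
      rw [mul_one_div_cancel hc.ne'] at this
      exact this.le)
    rw [cutoff, this, zero_mul]
  · have : edgeCut c (-x) = 0 := cutProfile_of_le (by
      have := mul_lt_mul_of_pos_left (show 1 + -x < 1 / c by linarith) hc
      rw [mul_one_div_cancel hc.ne'] at this
      exact this.le)
    rw [cutoff, this, mul_zero]

lemma cutoff_eq_one {c x : ℝ} (h1 : 2 ≤ c * (1 + x)) (h2 : 2 ≤ c * (1 - x)) :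
    cutoff c x = 1 := by
  rw [cutoff, edgeCut, edgeCut, cutProfile_of_ge h1, cutProfile_of_ge (by rwa [← sub_eq_add_neg]),
    one_mul]

lemma contDiffAt_weight (a b : ℝ) (n : WithTop ℕ∞) {x : ℝ} (hx : x ∈ Lam) :
    ContDiffAt ℝ n (weight a b) x :=
  ((contDiffAt_const.sub contDiffAt_id).rpow_const_of_ne (by simp; linarith [hx.2])).mul
    ((contDiffAt_const.add contDiffAt_id).rpow_const_of_ne (by simp; linarith [hx.1]))

lemma contDiffAt_eval_mul_weight (a b : ℝ) (p : ℝ[X]) {x : ℝ} (hx : x ∈ Lam) :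
    ContDiffAt ℝ ((⊤ : ℕ∞) : WithTop ℕ∞) (fun y => p.eval y * weight a b y) x :=
  (contDiff_eval p).contDiffAt.mul (contDiffAt_weight a b _ hx)

lemma isTestFun_cutoff_mul (a b : ℝ) (p : ℝ[X]) {c : ℝ} (hc : 0 < c) :
    IsTestFun (fun x => p.eval x * weight a b x * cutoff c x) := by
  have hsupp : (Function.support fun x => p.eval x * weight a b x * cutoff c x)
      ⊆ Icc (-1 + 1 / c) (1 - 1 / c) := by
    intro x hx
    by_contra h
    exact hx (by simp [cutoff_eq_zero hc h])
  have hcc : 0 < 1 / c := by positivity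
  refine ⟨contDiff_iff_contDiffAt.2 fun x => ?_,
    HasCompactSupport.of_support_subset_isCompact isCompact_Icc hsupp, ?_⟩
  · by_cases hx : x ∈ Lam
    · exact (contDiffAt_eval_mul_weight a b p hx).mul (contDiff_cutoff c).contDiffAt
    · have : (fun x => p.eval x * weight a b x * cutoff c x) =ᶠ[nhds x] fun _ => 0 := by
        have hx' : x ∈ (Icc (-1 + 1 / c) (1 - 1 / c))ᶜ := fun h =>
          hx ⟨by linarith [h.1], by linarith [h.2]⟩
        filter_upwards [isClosed_Icc.isOpen_compl.mem_nhds hx'] with y hy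
        simp [cutoff_eq_zero hc hy]
      exact contDiffAt_const.congr_of_eventuallyEq this
  · refine (closure_minimal hsupp isClosed_Icc).trans fun x hx => ?_
    exact ⟨by linarith [hx.1], by linarith [hx.2]⟩

lemma weight_add_nat (a b : ℝ) (j : ℕ) {x : ℝ} (hx : x ∈ Lam) :
    weight (a + j) (b + j) x = ((1 - x) * (1 + x)) ^ j * weight a b x := by
  have h1 : 0 < 1 - x := by linarith [hx.2]
  have h2 : 0 < 1 + x := by linarith [hx.1]
  unfold weight
  rw [Real.rpow_add_natCast h1.ne', Real.rpow_add_natCast h2.ne', mul_pow]; ring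

/-- The orders balance in Leibniz' rule. After `i` derivatives the weight retains `m - i` extra
powers of `(1-x)(1+x)`, exactly what the remaining `m - i` derivatives of the cutoff cost. The bound
is uniform in `c`, as dominated convergence requires. -/
lemma exists_bound_iteratedDeriv_cutoff_mul (a b : ℝ) (m : ℕ) (p : ℝ[X]) :
    ∃ K, ∀ c x : ℝ, 0 < c → x ∈ Lam →
      |iteratedDeriv m (fun x => p.eval x * weight (a + m) (b + m) x * cutoff c x) x|
        ≤ K * weight a b x := by
  choose K hK0 hK using exists_bound_cutoff
  have hq : ∀ i, ∃ Q, 0 ≤ Q ∧ ∀ x ∈ Lam, |(jacobiIter (a + m) (b + m) i p).eval x| ≤ Q := by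
    intro i
    obtain ⟨Q, hQ⟩ := isCompact_Icc.exists_bound_of_continuousOn (s := Icc (-1 : ℝ) 1)
      (jacobiIter (a + m) (b + m) i p).continuous.continuousOn
    exact ⟨Q, (norm_nonneg _).trans (hQ 0 (by simp)), fun x hx => hQ x (Ioo_subset_Icc_self hx)⟩
  choose Q hQ0 hQ using hq
  refine ⟨∑ i ∈ Finset.range (m + 1), (m.choose i : ℝ) * (Q i * K (m - i)), fun c x hc hx => ?_⟩
  have hle : ((m : ℕ∞) : WithTop ℕ∞) ≤ ((⊤ : ℕ∞) : WithTop ℕ∞) := by exact_mod_cast le_top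
  have hmul : iteratedDeriv m (fun x => p.eval x * weight (a + m) (b + m) x * cutoff c x) x
      = ∑ i ∈ Finset.range (m + 1), (m.choose i : ℝ)
        * iteratedDeriv i (fun x => p.eval x * weight (a + m) (b + m) x) x
        * iteratedDeriv (m - i) (cutoff c) x :=
    iteratedDeriv_mul ((contDiffAt_eval_mul_weight _ _ p hx).of_le hle)
      ((contDiff_cutoff c).contDiffAt.of_le hle)
  rw [hmul]
  refine (Finset.abs_sum_le_sum_abs _ _).trans ?_
  rw [Finset.sum_mul]
  refine Finset.sum_le_sum fun i hi => ?_
  have him : i ≤ m := by simpa [Nat.lt_succ_iff] using hi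
  have hw := weight_pos (a := a) (b := b) hx
  have e : weight (a + m - i) (b + m - i) x
      = ((1 - x) * (1 + x)) ^ (m - i) * weight a b x := by
    rw [← weight_add_nat _ _ _ hx, Nat.cast_sub him]
    congr 1 <;> ring
  have h12 : 0 < (1 - x) * (1 + x) :=
    mul_pos (by linarith [hx.2]) (by linarith [hx.1])
  rw [iteratedDeriv_eval_mul_weight _ _ _ _ hx, e, abs_mul, abs_mul, abs_mul, Nat.abs_cast,
    abs_of_pos (mul_pos (pow_pos h12 _) hw)]
  have hb := hK (m - i) c x hc hx
  calc (m.choose i : ℝ) * (|(jacobiIter (a + m) (b + m) i p).eval x|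
        * (((1 - x) * (1 + x)) ^ (m - i) * weight a b x)) * |iteratedDeriv (m - i) (cutoff c) x|
      = (m.choose i : ℝ) * (|(jacobiIter (a + m) (b + m) i p).eval x|
        * (|iteratedDeriv (m - i) (cutoff c) x| * ((1 - x) * (1 + x)) ^ (m - i)))
        * weight a b x := by ring
    _ ≤ _ := by
      refine mul_le_mul_of_nonneg_right (mul_le_mul_of_nonneg_left ?_ (by positivity)) hw.le
      exact mul_le_mul (hQ i x hx) hb (by positivity) (hQ0 i)

lemma cutoff_eventually_eq_one {x : ℝ} (hx : x ∈ Lam) :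
    ∀ᶠ n : ℕ in Filter.atTop, ∀ᶠ y in nhds x, cutoff ((n : ℝ) + 1) y = 1 := by
  set d := min (1 + x) (1 - x) / 2 with hd
  have hd0 : 0 < d := by
    have : 0 < min (1 + x) (1 - x) := lt_min (by linarith [hx.1]) (by linarith [hx.2])
    rw [hd]; linarith
  obtain ⟨n₀, hn₀⟩ := exists_nat_ge (2 / d)
  filter_upwards [Filter.eventually_ge_atTop n₀] with n hn
  have hn' : 2 ≤ ((n : ℝ) + 1) * d := by
    have h1 : (n₀ : ℝ) ≤ n := by exact_mod_cast hn
    have h2 : 2 / d ≤ (n : ℝ) + 1 := by linarith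
    rwa [div_le_iff₀ hd0] at h2
  filter_upwards [Metric.ball_mem_nhds x hd0] with y hy
  rw [Metric.mem_ball, Real.dist_eq, abs_lt] at hy
  have m1 := min_le_left (1 + x) (1 - x)
  have m2 := min_le_right (1 + x) (1 - x)
  have hn0 : (0 : ℝ) < (n : ℝ) + 1 := by positivity
  refine cutoff_eq_one (hn'.trans (mul_le_mul_of_nonneg_left ?_ hn0.le))
    (hn'.trans (mul_le_mul_of_nonneg_left ?_ hn0.le)) <;> linarith [hy.1, hy.2]

/-- Weak differentiation may be tested with `p ω^{(a+m,b+m)}`. -/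
lemma integral_weak_parts {a b : ℝ} (ha : -1 < a) (hb : -1 < b) {m : ℕ} {g G : ℝ → ℝ}
    (hg : MemL2w a b g) (hG : MemL2w (a + m) (b + m) G) {σ : ℝ}
    (H : ∀ φ, IsTestFun φ → ∫ x in Lam, g x * iteratedDeriv m φ x = σ * ∫ x in Lam, G x * φ x)
    (p : ℝ[X]) :
    ∫ x in Lam, g x * (jacobiIter (a + m) (b + m) m p).eval x * weight a b x
      = σ * ∫ x in Lam, G x * p.eval x * weight (a + m) (b + m) x := by
  have hm : (0 : ℝ) ≤ m := Nat.cast_nonneg m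
  set φ : ℕ → ℝ → ℝ := fun n x => p.eval x * weight (a + m) (b + m) x * cutoff ((n : ℝ) + 1) x
    with hφ
  have hpos : ∀ n : ℕ, (0 : ℝ) < (n : ℝ) + 1 := fun n => by positivity
  have htest : ∀ n, IsTestFun (φ n) := fun n => isTestFun_cutoff_mul _ _ p (hpos n)
  obtain ⟨K, hK⟩ := exists_bound_iteratedDeriv_cutoff_mul a b m p
  have t1 : Filter.Tendsto (fun n => ∫ x in Lam, g x * iteratedDeriv m (φ n) x) Filter.atTop
      (nhds (∫ x in Lam, g x * (jacobiIter (a + m) (b + m) m p).eval x * weight a b x)) := by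
    -- The factor `1` presents `g ω^{(a,b)}` as a product of two elements of `L²_{ω^{(a,b)}}`, hence
    -- integrable, since the weight has finite mass.
    refine tendsto_integral_of_dominated_convergence (fun x => K * |g x * 1 * weight a b x|)
      (fun n => hg.1.mul ((htest n).iteratedDeriv m).1.continuous.aestronglyMeasurable) ?_ ?_ ?_
    · exact (hg.integrableOn_mul (memL2w_continuous ha hb continuous_const)).abs.const_mul K
    · intro n
      filter_upwards [ae_restrict_mem measurableSet_Lam] with x hx
      have := hK _ x (hpos n) hx
      have hw := weight_pos (a := a) (b := b) hx
      rw [Real.norm_eq_abs, abs_mul, mul_one, abs_mul, abs_of_pos hw]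
      calc |g x| * |iteratedDeriv m (φ n) x| ≤ |g x| * (K * weight a b x) :=
            mul_le_mul_of_nonneg_left this (abs_nonneg _)
        _ = _ := by ring
    · filter_upwards [ae_restrict_mem measurableSet_Lam] with x hx
      refine tendsto_nhds_of_eventually_eq ?_
      filter_upwards [cutoff_eventually_eq_one hx] with n hn
      have : φ n =ᶠ[nhds x] fun y => p.eval y * weight (a + m) (b + m) y := by
        filter_upwards [hn] with y hy
        simp [hφ, hy]
      rw [this.iteratedDeriv_eq m, iteratedDeriv_eval_mul_weight _ _ _ _ hx,
        add_sub_cancel_right, add_sub_cancel_right]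
      ring
  have t2 : Filter.Tendsto (fun n => ∫ x in Lam, G x * φ n x) Filter.atTop
      (nhds (∫ x in Lam, G x * p.eval x * weight (a + m) (b + m) x)) := by
    have hi := hG.integrableOn_mul (memL2w_eval (by linarith) (by linarith) p)
    refine tendsto_integral_of_dominated_convergence
      (fun x => |G x * p.eval x * weight (a + m) (b + m) x|)
      (fun n => hG.1.mul (htest n).1.continuous.aestronglyMeasurable) hi.abs ?_ ?_
    · intro n
      refine Filter.Eventually.of_forall fun x => ?_
      rw [Real.norm_eq_abs, hφ, show G x * (p.eval x * weight (a + m) (b + m) x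
        * cutoff ((n : ℝ) + 1) x) = (G x * p.eval x * weight (a + m) (b + m) x)
        * cutoff ((n : ℝ) + 1) x by ring, abs_mul]
      exact mul_le_of_le_one_right (abs_nonneg _) (abs_cutoff_le_one _ _)
    · filter_upwards [ae_restrict_mem measurableSet_Lam] with x hx
      refine tendsto_nhds_of_eventually_eq ?_
      filter_upwards [cutoff_eventually_eq_one hx] with n hn
      simp only [hφ, hn.self_of_nhds]
      ring
  refine tendsto_nhds_unique t1 ?_
  simp only [H _ (htest _)]
  exact t2.const_mul σ

/-! ### Riemann-Liouville derivatives of functions with zero trace -/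

lemma floor_add_one_eq {n : ℕ} {r : ℝ} (hn : 1 ≤ n) (h1 : (n : ℝ) - 1 < r) (h2 : r < n) :
    ⌊r⌋₊ + 1 = n := by
  obtain ⟨l, rfl⟩ : ∃ l, n = l + 1 := ⟨n - 1, by omega⟩
  push_cast at h1 h2
  have h0 : (0 : ℝ) ≤ l := Nat.cast_nonneg l
  rw [(Nat.floor_eq_iff (by linarith)).2 ⟨by linarith, h2⟩]

lemma hasRL_iff {n : ℕ} {r : ℝ} (hn : 1 ≤ n) (h1 : (n : ℝ) - 1 < r) (h2 : r < n) (u : ℝ → ℝ) :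
    HasRL r u ↔ IntegrableOn u Lam ∧ HasWeakDeriv n (fracInt (n - r) u) := by
  rw [HasRL, floor_add_one_eq hn h1 h2]

lemma rlDeriv_eq {n : ℕ} {r : ℝ} (hn : 1 ≤ n) (h1 : (n : ℝ) - 1 < r) (h2 : r < n) (u : ℝ → ℝ) :
    rlDeriv r u = fun x => (-1) ^ n * weakDeriv n (fracInt (n - r) u) x := by
  ext x
  rw [rlDeriv, floor_add_one_eq hn h1 h2]

lemma rlDeriv_sub_ae {k : ℕ} {s : ℝ} (hk : 1 ≤ k) (h1 : (k : ℝ) - 1 < s) (h2 : s < k)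
    {u v : ℝ → ℝ} (hu : HasRL s u) (hv : HasRL s v) :
    rlDeriv s (fun x => u x - v x) =ᵐ[volume.restrict Lam]
      fun x => rlDeriv s u x - rlDeriv s v x := by
  rw [hasRL_iff hk h1 h2] at hu hv
  have h := (hu.2.isWeakDeriv.sub hv.2.isWeakDeriv).congr
    (fracInt_sub_ae (by linarith) (by linarith) hu.1 hv.1)
  simp only [rlDeriv_eq hk h1 h2]
  filter_upwards [h.weakDeriv_ae_eq] with x hx
  rw [hx]; ring

lemma IsZeroTraceDeriv.hasRL {k : ℕ} {s : ℝ} (hk : 1 ≤ k) (h1 : (k : ℝ) - 1 < s) (h2 : s < k)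
    {w W : ℝ → ℝ} (h : IsZeroTraceDeriv k w W) : HasRL s w :=
  (hasRL_iff hk h1 h2 w).2
    ⟨h.1, _, h.isWeakDeriv_fracInt (by linarith) (by linarith)⟩

lemma IsZeroTraceDeriv.rlDeriv_ae_eq {k : ℕ} {s : ℝ} (hk : 1 ≤ k) (h1 : (k : ℝ) - 1 < s)
    (h2 : s < k) {w W : ℝ → ℝ} (h : IsZeroTraceDeriv k w W) :
    rlDeriv s w =ᵐ[volume.restrict Lam] fun x => (-1) ^ k * fracInt (k - s) W x := by
  rw [rlDeriv_eq hk h1 h2]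
  filter_upwards [(h.isWeakDeriv_fracInt (ρ := k - s) (by linarith)
    (by linarith)).weakDeriv_ae_eq] with x hx
  rw [hx]

/-- The operator `q ↦ D_-^s (q ω^{(0,s-k)})` on polynomials. -/
def leftDerivOp (s : ℝ) (k : ℕ) : ℝ[X] →ₗ[ℝ] ℝ[X] :=
  (derivative ^ k : Module.End ℝ ℝ[X]) ∘ₗ diagLeft (fracCoeff (k - s))

/-- The operator `r ↦ D_+^s (r ω^{(s,k)})` on polynomials. -/
def rightDerivOp (s : ℝ) (k : ℕ) : ℝ[X] →ₗ[ℝ] ℝ[X] :=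
  (-1 : ℝ) ^ k • (reflect ∘ₗ diagLeft (fracCoeff (k - s)) ∘ₗ reflect ∘ₗ jacobiIter s k k)

lemma leftDerivOp_apply (s : ℝ) (k : ℕ) (q : ℝ[X]) :
    leftDerivOp s k q = derivative^[k] (diagLeft (fracCoeff (k - s)) q) := by
  rw [leftDerivOp, LinearMap.comp_apply, Module.End.pow_apply]

lemma rightDerivOp_apply (s : ℝ) (k : ℕ) (r : ℝ[X]) :
    rightDerivOp s k r = (-1 : ℝ) ^ k •
      reflect (diagLeft (fracCoeff (k - s)) (reflect (jacobiIter s k k r))) := rfl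

lemma IsZeroTraceDeriv.integral_rlDeriv_mul {k : ℕ} {s : ℝ} (hk : 1 ≤ k) (h1 : (k : ℝ) - 1 < s)
    (h2 : s < k) {w W : ℝ → ℝ} (h : IsZeroTraceDeriv k w W) (q : ℝ[X]) :
    ∫ x in Lam, rlDeriv s w x * q.eval x * weight 0 (s - k) x
      = ∫ x in Lam, w x * (leftDerivOp s k q).eval x := by
  rw [leftDerivOp_apply, ← h.integral_fracInt_mul_eval (by linarith) (by linarith), neg_sub]
  refine integral_congr_ae ?_
  filter_upwards [h.rlDeriv_ae_eq hk h1 h2] with x hx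
  rw [hx]

lemma isZeroTraceDeriv_weight {a b : ℝ} {k : ℕ} (hk : 1 ≤ k) (ha : (k : ℝ) - 1 < a)
    (hb : (k : ℝ) - 1 < b) (r : ℝ[X]) {w : ℝ → ℝ}
    (hw : EqOn w (fun x => r.eval x * weight a b x) Lam) :
    IsZeroTraceDeriv k w (fun x => (jacobiIter a b k r).eval x * weight (a - k) (b - k) x) := by
  have hk' : (1 : ℝ) ≤ k := by exact_mod_cast hk
  refine ⟨?_, integrableOn_continuous_mul_weight (by linarith) (by linarith) (by fun_prop),
    fun Ψ hΨ => ?_⟩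
  · exact (integrableOn_continuous_mul_weight (a := a) (b := b) (by linarith) (by linarith)
      r.continuous).congr_fun hw.symm measurableSet_Lam
  · rw [← integral_eval_mul_weight_mul_iteratedDeriv k ha hb r hΨ]
    exact setIntegral_congr_fun measurableSet_Lam fun x hx => by simp only [hw hx]

lemma IsTestFun.isZeroTraceDeriv {φ : ℝ → ℝ} (h : IsTestFun φ) (k : ℕ) :
    IsZeroTraceDeriv k φ (_root_.iteratedDeriv k φ) :=
  ⟨h.integrableOn, (h.iteratedDeriv k).integrableOn, fun _ hΨ => h.integral_mul_iteratedDeriv k hΨ⟩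

/-- Differentiating `k` times leaves a polynomial times `(1-x)^{-(k-s)}`, the very weight for which
the right fractional integral of order `k - s` returns polynomials. -/
lemma rlDeriv_weight_ae_eq {k : ℕ} {s : ℝ} (hk : 1 ≤ k) (h1 : (k : ℝ) - 1 < s) (h2 : s < k)
    (r : ℝ[X]) {w : ℝ → ℝ} (hw : EqOn w (fun x => r.eval x * weight s k x) Lam) :
    rlDeriv s w =ᵐ[volume.restrict Lam] fun x => (rightDerivOp s k r).eval x := by
  filter_upwards [(isZeroTraceDeriv_weight hk h1 (by linarith) r hw).rlDeriv_ae_eq hk h1 h2,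
    ae_restrict_mem measurableSet_Lam] with x hx hxL
  rw [hx, rightDerivOp_apply, eval_smul, smul_eq_mul,
    ← fracInt_eval_mul (by linarith) (by linarith) _ hxL]
  congr 2
  ext y
  simp [weight]

/-! ### Test functions in the weighted spaces -/

lemma IsTestFun.memL2w {φ : ℝ → ℝ} (h : IsTestFun φ) (a b : ℝ) : MemL2w a b φ := by
  refine ⟨h.1.continuous.aestronglyMeasurable, ?_⟩
  have hc : ContinuousOn (fun x => φ x * weight a b x) Lam := fun x hx =>
    (h.1.continuous.continuousAt.mul
      (contDiffAt_weight a b 0 hx).continuousAt).continuousWithinAt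
  refine (LocallyIntegrableOn.integrableOn_mul_test
    (hc.locallyIntegrableOn measurableSet_Lam) h).congr_fun (fun x _ => ?_) measurableSet_Lam
  simp only; ring

lemma abs_fracIntLeft_le {ρ : ℝ} (h0 : 0 < ρ) (h1 : ρ < 1) {z : ℝ → ℝ} {K : ℝ}
    (hz : ∀ x ∈ Lam, |z x| ≤ K * (1 + x) ^ (-ρ)) {y : ℝ} (hy : y ∈ Lam) :
    |fracIntLeft ρ z y| ≤ K * Real.Gamma (1 - ρ) := by
  have hG := Real.Gamma_pos_of_pos h0
  obtain ⟨hi, hv⟩ := integral_fracKernel_weight h0 h1 hy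
  rw [fracIntLeft_eq _ _ hy, abs_mul, abs_of_pos (inv_pos.2 hG), inv_mul_le_iff₀ hG]
  have : ‖∫ x in Lam, z x * fracKernel ρ (y - x)‖
      ≤ ∫ x in Lam, K * ((1 + x) ^ (-ρ) * fracKernel ρ (y - x)) := by
    refine norm_integral_le_of_norm_le (hi.const_mul K) ?_
    filter_upwards [ae_restrict_mem measurableSet_Lam] with x hx
    rw [norm_mul, Real.norm_eq_abs, Real.norm_of_nonneg (fracKernel_nonneg _ _), ← mul_assoc]
    exact mul_le_mul_of_nonneg_right (hz x hx) (fracKernel_nonneg _ _)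
  rw [integral_const_mul, hv] at this
  rw [← Real.norm_eq_abs]
  linarith

lemma IsTestFun.comp_neg {φ : ℝ → ℝ} (h : IsTestFun φ) : IsTestFun (fun x => φ (-x)) := by
  refine ⟨h.1.comp contDiff_neg, h.2.1.comp_homeomorph (Homeomorph.neg ℝ), ?_⟩
  have : tsupport (fun x => φ (-x)) ⊆ (fun x : ℝ => -x) ⁻¹' tsupport φ := by
    refine closure_minimal (fun x hx => subset_tsupport φ hx)
      ((isClosed_tsupport φ).preimage continuous_neg)
  intro x hx
  have := h.2.2 (this hx)
  exact ⟨by linarith [this.2], by linarith [this.1]⟩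

lemma memL2w_of_bounded {a b K : ℝ} (ha : -1 < a) (hb : -1 < b) {f : ℝ → ℝ}
    (hf : AEStronglyMeasurable f (volume.restrict Lam)) (hK : ∀ x ∈ Lam, |f x| ≤ K) :
    MemL2w a b f := by
  refine ⟨hf, ((integrableOn_weight ha hb).const_mul (K ^ 2)).mono'
    ((hf.pow 2).mul (measurable_weight a b).aestronglyMeasurable) ?_⟩
  filter_upwards [ae_restrict_mem measurableSet_Lam] with x hx
  have hw := weight_pos (a := a) (b := b) hx
  rw [Real.norm_of_nonneg (mul_nonneg (sq_nonneg _) hw.le)]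
  refine mul_le_mul_of_nonneg_right ?_ hw.le
  rw [← sq_abs]
  exact pow_le_pow_left₀ (abs_nonneg _) (hK x hx) 2

lemma IsTestFun.memL2w_rlDeriv {k : ℕ} {s : ℝ} (hk : 1 ≤ k) (h1 : (k : ℝ) - 1 < s) (h2 : s < k)
    {φ : ℝ → ℝ} (h : IsTestFun φ) : MemL2w 0 (s - k) (rlDeriv s φ) := by
  have hρ0 : 0 < (k : ℝ) - s := by linarith
  have hρ1 : (k : ℝ) - s < 1 := by linarith
  have hd := h.iteratedDeriv k
  obtain ⟨K, hK⟩ := hd.comp_neg.exists_bound hρ0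
  refine MemL2w.congr (memL2w_of_bounded (K := K * Real.Gamma (1 - (k - s))) (by norm_num)
    (by linarith) ?_ ?_) ((h.isZeroTraceDeriv k).rlDeriv_ae_eq hk h1 h2).symm
  · exact (integrableOn_fracInt hρ0 hρ1 hd.integrableOn).aestronglyMeasurable.const_mul _
  · intro x hx
    rw [abs_mul, abs_pow, abs_neg, abs_one, one_pow, one_mul, fracInt_eq_fracIntLeft]
    exact abs_fracIntLeft_le hρ0 hρ1 hK ⟨by linarith [hx.2], by linarith [hx.1]⟩

lemma normL2w_le_normU (s : ℝ) (k : ℕ) (u : ℝ → ℝ) : normL2w (-s) (-k) u ≤ normU s k u :=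
  Real.le_sqrt_of_sq_le (by nlinarith [sq_nonneg (normL2w 0 (s - k) (rlDeriv s u))])

lemma normL2w_rlDeriv_le_normU (s : ℝ) (k : ℕ) (u : ℝ → ℝ) :
    normL2w 0 (s - k) (rlDeriv s u) ≤ normU s k u :=
  Real.le_sqrt_of_sq_le (by nlinarith [sq_nonneg (normL2w (-s) (-k) u)])

lemma memL2w_eval_mul_weight {a b : ℝ} (ha : -1 < a) (hb : -1 < b) (p : ℝ[X]) :
    MemL2w (-a) (-b) (fun x => p.eval x * weight a b x) := by
  refine ⟨(p.continuous.measurable.mul (measurable_weight a b)).aestronglyMeasurable, ?_⟩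
  refine (integrableOn_continuous_mul_weight ha hb (p.continuous.pow 2)).congr_fun
    (fun x hx => ?_) measurableSet_Lam
  have := weight_mul (a := a) (b := b) (c := -a) (d := -b) hx
  simp only [add_neg_cancel, weight_zero] at this
  simp only [Pi.pow_apply]
  linear_combination (-p.eval x ^ 2 * weight a b x) * this

lemma integral_mul_eval_eq {a b : ℝ} (e : ℝ → ℝ) (p : ℝ[X]) :
    ∫ x in Lam, e x * (p.eval x * weight a b x) * weight (-a) (-b) x
      = ∫ x in Lam, e x * p.eval x := by
  refine setIntegral_congr_fun measurableSet_Lam fun x hx => ?_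
  have := weight_mul (a := a) (b := b) (c := -a) (d := -b) hx
  simp only [add_neg_cancel, weight_zero] at this
  linear_combination (e x * p.eval x) * this

lemma MemL2w.integrableOn_mul_eval {a b : ℝ} (ha : -1 < a) (hb : -1 < b) {e : ℝ → ℝ}
    (he : MemL2w (-a) (-b) e) (p : ℝ[X]) : IntegrableOn (fun x => e x * p.eval x) Lam := by
  refine (he.integrableOn_mul (memL2w_eval_mul_weight ha hb p)).congr_fun (fun x hx => ?_)
    measurableSet_Lam
  have := weight_mul (a := a) (b := b) (c := -a) (d := -b) hx
  simp only [add_neg_cancel, weight_zero] at this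
  linear_combination (e x * p.eval x) * this

/-- The adjoint relation extends to the solution space by density of test functions. -/
lemma MemU.integral_rlDeriv_mul {k : ℕ} {s : ℝ} (hk : 1 ≤ k) (h1 : (k : ℝ) - 1 < s)
    (h2 : s < k) {u : ℝ → ℝ} (hu : MemU s k u) (q : ℝ[X]) :
    ∫ x in Lam, rlDeriv s u x * q.eval x * weight 0 (s - k) x
      = ∫ x in Lam, u x * (leftDerivOp s k q).eval x := by
  have hk' : (1 : ℝ) ≤ k := by exact_mod_cast hk
  have hs : -1 < s := by linarith
  have hkk : -1 < (k : ℝ) := by linarith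
  have hb : -1 < s - k := by linarith
  set p := leftDerivOp s k q with hp
  set M := normL2w 0 (s - k) (fun x => q.eval x)
    + normL2w (-s) (-k) (fun x => p.eval x * weight s k x) with hM
  have hM0 : 0 ≤ M := add_nonneg (normL2w_nonneg _ _ _) (normL2w_nonneg _ _ _)
  have hq := memL2w_eval (a := 0) (by norm_num) hb q
  -- Both sides of the identity are continuous in the `U` norm, with combined constant `M`, and they
  -- agree on test functions.
  have key : ∀ ε > 0, |(∫ x in Lam, rlDeriv s u x * q.eval x * weight 0 (s - k) x)
      - ∫ x in Lam, u x * p.eval x| ≤ ε * M := by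
    intro ε hε
    obtain ⟨φ, hφ, hlt⟩ := hu.2.2.2 ε hε
    have hz := hφ.isZeroTraceDeriv k
    have hadj := hz.integral_rlDeriv_mul hk h1 h2 q
    rw [← hp] at hadj
    have hsub := rlDeriv_sub_ae hk h1 h2 hu.2.1 (hz.hasRL hk h1 h2)
    have hRφ := hφ.memL2w_rlDeriv hk h1 h2
    have hd : MemL2w 0 (s - k) (rlDeriv s (fun x => u x - φ x)) :=
      (hu.2.2.1.sub hRφ).congr hsub.symm
    have he : MemL2w (-s) (-k) (fun x => u x - φ x) := hu.1.sub (hφ.memL2w _ _)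
    have b1 := hd.abs_integral_mul_le hq
    have b2 := he.abs_integral_mul_le (memL2w_eval_mul_weight hs hkk p)
    rw [integral_mul_eval_eq] at b2
    have e1 : ∫ x in Lam, rlDeriv s (fun x => u x - φ x) x * q.eval x * weight 0 (s - k) x
        = (∫ x in Lam, rlDeriv s u x * q.eval x * weight 0 (s - k) x)
          - ∫ x in Lam, rlDeriv s φ x * q.eval x * weight 0 (s - k) x := by
      rw [← integral_sub (hu.2.2.1.integrableOn_mul hq) (hRφ.integrableOn_mul hq)]
      refine integral_congr_ae ?_
      filter_upwards [hsub] with x hx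
      rw [hx]; ring
    have e2 : ∫ x in Lam, (u x - φ x) * p.eval x
        = (∫ x in Lam, u x * p.eval x) - ∫ x in Lam, φ x * p.eval x := by
      rw [← integral_sub (hu.1.integrableOn_mul_eval hs hkk p)
        ((hφ.memL2w _ _).integrableOn_mul_eval hs hkk p)]
      congr 1; ext x; ring
    rw [e1] at b1
    rw [e2] at b2
    have c1 := mul_le_mul_of_nonneg_right ((normL2w_rlDeriv_le_normU s k _).trans hlt.le)
      (normL2w_nonneg 0 (s - k) (fun x => q.eval x))
    have c2 := mul_le_mul_of_nonneg_right ((normL2w_le_normU s k _).trans hlt.le)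
      (normL2w_nonneg (-s) (-k) (fun x => p.eval x * weight s k x))
    rw [hadj] at b1
    rw [hM, mul_add]
    have d1 := abs_le.1 (b1.trans c1)
    have d2 := abs_le.1 (b2.trans c2)
    rw [abs_le]
    constructor <;> linarith [d1.1, d1.2, d2.1, d2.2]
  by_contra hne
  have hpos : 0 < |(∫ x in Lam, rlDeriv s u x * q.eval x * weight 0 (s - k) x)
      - ∫ x in Lam, u x * p.eval x| := abs_pos.2 (sub_ne_zero.2 hne)
  set d := |(∫ x in Lam, rlDeriv s u x * q.eval x * weight 0 (s - k) x)
      - ∫ x in Lam, u x * p.eval x| with hdd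
  have := key (d / (2 * (M + 1))) (by positivity)
  rw [div_mul_eq_mul_div, le_div_iff₀ (by positivity)] at this
  nlinarith

/-! ### Stability of the fractional derivative -/

lemma iterate_derivative_mem_degreeLT {n m : ℕ} {p : ℝ[X]} (hp : p ∈ degreeLT ℝ (n + m)) :
    derivative^[m] p ∈ degreeLT ℝ n := by
  rw [mem_degreeLT_iff_coeff] at hp ⊢
  intro i hi
  rw [coeff_iterate_derivative, hp _ (by omega), smul_zero]

lemma iterate_derivative_eq_zero_of_mem {n m : ℕ} (hnm : n ≤ m) {p : ℝ[X]}
    (hp : p ∈ degreeLT ℝ n) : derivative^[m] p = 0 := by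
  rw [mem_degreeLT_iff_coeff] at hp
  ext i
  rw [coeff_iterate_derivative, hp _ (by omega), smul_zero, coeff_zero]

lemma rightDerivOp_mem_degreeLT (s : ℝ) (k : ℕ) {n : ℕ} {p : ℝ[X]} (hp : p ∈ degreeLT ℝ n) :
    rightDerivOp s k p ∈ degreeLT ℝ (n + k) :=
  Submodule.smul_mem _ _ (reflect_mem_degreeLT (diagLeft_mem_degreeLT _
    (reflect_mem_degreeLT (jacobiIter_mem_degreeLT _ _ hp k))))

lemma leftDerivOp_mem_degreeLT (s : ℝ) (k : ℕ) {n : ℕ} {p : ℝ[X]} (hp : p ∈ degreeLT ℝ (n + k)) :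
    leftDerivOp s k p ∈ degreeLT ℝ n := by
  rw [leftDerivOp_apply]
  exact iterate_derivative_mem_degreeLT (diagLeft_mem_degreeLT _ hp)

lemma leftDerivOp_eq_zero (s : ℝ) (k : ℕ) {n : ℕ} (hnk : n ≤ k) {p : ℝ[X]}
    (hp : p ∈ degreeLT ℝ n) : leftDerivOp s k p = 0 := by
  rw [leftDerivOp_apply]
  exact iterate_derivative_eq_zero_of_mem hnk (diagLeft_mem_degreeLT _ hp)

/-- The eigenvalues of `D_-^s ω^{(0,s-k)} D_+^s ω^{(s,k)}` on polynomials. -/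
def fracEigen (s : ℝ) (k n : ℕ) : ℝ :=
  (n + k).descFactorial k * fracCoeff (k - s) (n + k) ^ 2
    * ∏ j ∈ Finset.range k, ((n : ℝ) + s + k - j)

lemma coeff_rightDerivOp (s : ℝ) (k : ℕ) {n : ℕ} {p : ℝ[X]} (hp : p ∈ degreeLT ℝ (n + 1)) :
    (rightDerivOp s k p).coeff (n + k) = fracCoeff (k - s) (n + k)
      * (∏ j ∈ Finset.range k, ((n : ℝ) + s + k - j)) * p.coeff n := by
  have hJ := jacobiIter_mem_degreeLT s k hp k
  rw [show n + 1 + k = n + k + 1 by ring] at hJ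
  rw [rightDerivOp_apply, coeff_smul, coeff_reflect, coeff_diagLeft _ (reflect_mem_degreeLT hJ),
    coeff_reflect, coeff_jacobiIter _ _ hp, smul_eq_mul]
  have e1 : ((-1 : ℝ) ^ k) * (-1) ^ k = 1 := by rw [← mul_pow]; simp
  have e2 : ((-1 : ℝ) ^ (n + k)) * (-1) ^ (n + k) = 1 := by rw [← mul_pow]; simp
  set P := ∏ j ∈ Finset.range k, ((n : ℝ) + s + k - j)
  linear_combination (fracCoeff (k - s) (n + k) * P * p.coeff n * ((-1 : ℝ) ^ (n + k)) ^ 2) * e1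
    + (fracCoeff (k - s) (n + k) * P * p.coeff n) * e2

lemma coeff_leftDerivOp (s : ℝ) (k : ℕ) {n : ℕ} {p : ℝ[X]} (hp : p ∈ degreeLT ℝ (n + k + 1)) :
    (leftDerivOp s k p).coeff n
      = (n + k).descFactorial k * (fracCoeff (k - s) (n + k) * p.coeff (n + k)) := by
  rw [leftDerivOp_apply, coeff_iterate_derivative, coeff_diagLeft _ hp, nsmul_eq_mul]

lemma coeff_left_rightDerivOp (s : ℝ) (k : ℕ) {n : ℕ} {p : ℝ[X]} (hp : p ∈ degreeLT ℝ (n + 1)) :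
    (leftDerivOp s k (rightDerivOp s k p)).coeff n = fracEigen s k n * p.coeff n := by
  have h := rightDerivOp_mem_degreeLT s k hp
  rw [show n + 1 + k = n + k + 1 by ring] at h
  rw [coeff_leftDerivOp s k h, coeff_rightDerivOp s k hp, fracEigen]; ring

lemma prod_shift_pos {k : ℕ} {s : ℝ} (h1 : (k : ℝ) - 1 < s) (n : ℕ) :
    0 < ∏ j ∈ Finset.range k, ((n : ℝ) + s + k - j) := by
  refine Finset.prod_pos fun j hj => ?_
  have h : (j : ℝ) + 1 ≤ k := by exact_mod_cast Finset.mem_range.1 hj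
  have h3 : (0 : ℝ) ≤ n := Nat.cast_nonneg n
  have h4 : (0 : ℝ) ≤ j := Nat.cast_nonneg j
  linarith

lemma fracEigen_pos {k : ℕ} {s : ℝ} (h1 : (k : ℝ) - 1 < s) (n : ℕ) :
    0 < fracEigen s k n := by
  have hc := fracCoeff_pos (ρ := k - s) (by linarith) (n + k)
  have hd : (0 : ℝ) < (n + k).descFactorial k := by
    exact_mod_cast Nat.pos_of_ne_zero fun h => by
      rw [Nat.descFactorial_eq_zero_iff_lt] at h; omega
  exact mul_pos (mul_pos hd (pow_pos hc 2)) (prod_shift_pos h1 n)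

lemma fracCoeff_succ {ρ : ℝ} (h1 : ρ < 1) (j : ℕ) :
    fracCoeff ρ (j + 1) * (j + 1) = fracCoeff ρ j * (j + 1 - ρ) := by
  have hj : (0 : ℝ) ≤ j := Nat.cast_nonneg j
  have e1 : Real.Gamma ((j + 1 : ℕ) + 1 - ρ) = (j + 1 - ρ) * Real.Gamma (j + 1 - ρ) := by
    rw [← Real.Gamma_add_one (by linarith)]; congr 1; push_cast; ring
  have e2 : Real.Gamma ((j + 1 : ℕ) + 1) = (j + 1) * Real.Gamma (j + 1) := by
    rw [← Real.Gamma_add_one (by linarith)]; congr 1; push_cast; ring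
  have h3 := (Real.Gamma_pos_of_pos (by linarith : (0 : ℝ) < j + 1)).ne'
  have h4 : (j : ℝ) + 1 ≠ 0 := by linarith
  rw [fracCoeff, fracCoeff, e1, e2]
  field_simp

/-- The ratio of consecutive eigenvalues is `(n+1+s)(n+1+s+k) / ((n+1)(n+k+1))`, which is at least
`1`. -/
lemma fracEigen_le_succ {k : ℕ} {s : ℝ} (hk : 1 ≤ k) (h1 : (k : ℝ) - 1 < s) (n : ℕ) :
    fracEigen s k n ≤ fracEigen s k (n + 1) := by
  have hk' : (1 : ℝ) ≤ k := by exact_mod_cast hk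
  have hs : 0 < s := by linarith
  have hn : (0 : ℝ) ≤ n := Nat.cast_nonneg n
  have hP : (∏ j ∈ Finset.range k, (((n + 1 : ℕ) : ℝ) + s + k - j)) * (n + 1 + s)
      = (n + 1 + s + k) * ∏ j ∈ Finset.range k, ((n : ℝ) + s + k - j) := by
    have a1 := Finset.prod_range_succ (fun j : ℕ => (((n + 1 : ℕ) : ℝ) + s + k - j)) k
    have a2 := Finset.prod_range_succ' (fun j : ℕ => (((n + 1 : ℕ) : ℝ) + s + k - j)) k
    have a3 : ∏ j ∈ Finset.range k, (((n + 1 : ℕ) : ℝ) + s + k - ((j + 1 : ℕ) : ℝ))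
        = ∏ j ∈ Finset.range k, ((n : ℝ) + s + k - j) :=
      Finset.prod_congr rfl fun j _ => by push_cast; ring
    rw [a3] at a2
    rw [a1] at a2
    push_cast at a2 ⊢
    linear_combination a2
  have hD : ((n + 1 : ℝ)) * ((n + 1 + k).descFactorial k : ℝ)
      = (n + k + 1) * ((n + k).descFactorial k : ℝ) := by
    have := Nat.succ_descFactorial (n + k) k
    rw [show n + k + 1 - k = n + 1 by omega, show n + k + 1 = n + 1 + k by ring] at this
    have h' : ((n + 1 : ℕ) : ℝ) * ((n + 1 + k).descFactorial k : ℝ)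
      = ((n + 1 + k : ℕ) : ℝ) * ((n + k).descFactorial k : ℝ) := by exact_mod_cast this
    push_cast at h'
    linear_combination h'
  have hF : fracCoeff (k - s) (n + 1 + k) * (n + k + 1)
      = fracCoeff (k - s) (n + k) * (n + 1 + s) := by
    have := fracCoeff_succ (ρ := k - s) (by linarith) (n + k)
    rw [show n + k + 1 = n + 1 + k by ring] at this
    push_cast at this
    linear_combination this
  have hpos := fracEigen_pos h1 n
  have key : fracEigen s k (n + 1) * ((n + 1) * (n + k + 1))
      = fracEigen s k n * ((n + 1 + s) * (n + 1 + s + k)) := by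
    unfold fracEigen
    set D := ((n + k).descFactorial k : ℝ)
    set D' := ((n + 1 + k).descFactorial k : ℝ)
    set F := fracCoeff (k - s) (n + k)
    set F' := fracCoeff (k - s) (n + 1 + k)
    set P := ∏ j ∈ Finset.range k, ((n : ℝ) + s + k - j)
    set P' := ∏ j ∈ Finset.range k, (((n + 1 : ℕ) : ℝ) + s + k - j)
    have hne : ((n : ℝ) + 1 + s) * (n + k + 1) ≠ 0 := by positivity
    refine mul_right_cancel₀ hne ?_
    calc D' * F' ^ 2 * P' * ((n + 1) * (n + k + 1)) * (((n : ℝ) + 1 + s) * (n + k + 1))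
        = ((n + 1) * D') * (F' * (n + k + 1)) ^ 2 * (P' * (n + 1 + s)) := by ring
      _ = D * F ^ 2 * P * ((n + 1 + s) * (n + 1 + s + k)) * ((n + 1 + s) * (n + k + 1)) := by
        rw [hD, hF, hP]; ring
  have hle : ((n : ℝ) + 1) * (n + k + 1) ≤ (n + 1 + s) * (n + 1 + s + k) :=
    mul_le_mul (by linarith) (by linarith) (by positivity) (by positivity)
  have h0 : (0 : ℝ) < ((n : ℝ) + 1) * (n + k + 1) := by positivity
  refine le_of_mul_le_mul_right ?_ h0
  rw [key]
  exact mul_le_mul_of_nonneg_left hle hpos.le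

lemma fracEigen_zero_le {k : ℕ} {s : ℝ} (hk : 1 ≤ k) (h1 : (k : ℝ) - 1 < s) (n : ℕ) :
    fracEigen s k 0 ≤ fracEigen s k n :=
  monotone_nat_of_le_succ (fracEigen_le_succ hk h1) (Nat.zero_le n)

/-- The two operators are adjoint. Hence their composition is symmetric, and its quadratic form at
`r` is the squared norm of `rightDerivOp s k r`. -/
lemma jacobiForm_leftDerivOp {k : ℕ} {s : ℝ} (hk : 1 ≤ k) (h1 : (k : ℝ) - 1 < s) (h2 : s < k)
    (hs : -1 < s) (hkk : -1 < (k : ℝ)) (h0 : (-1 : ℝ) < 0) (hb : -1 < s - k) (q r : ℝ[X]) :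
    jacobiForm s k hs hkk (leftDerivOp s k q) r
      = jacobiForm 0 (s - k) h0 hb q (rightDerivOp s k r) := by
  have h := (isZeroTraceDeriv_weight hk h1 (by linarith) r
    (eqOn_refl (fun x => r.eval x * weight s k x) Lam)).integral_rlDeriv_mul hk h1 h2 q
  rw [jacobiForm_apply, jacobiForm_apply]
  calc _ = ∫ x in Lam, r.eval x * weight s k x * (leftDerivOp s k q).eval x := by
        congr 1; ext x; ring
    _ = _ := by
      rw [← h]
      refine integral_congr_ae ?_
      filter_upwards [rlDeriv_weight_ae_eq hk h1 h2 r (eqOn_refl _ Lam)] with x hx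
      rw [hx]; ring

/-- The norm of `e` is controlled by that of its fractional derivative `h`. -/
lemma normL2w_le_of_adjoint {k : ℕ} {s : ℝ} (hk : 1 ≤ k) (h1 : (k : ℝ) - 1 < s) (h2 : s < k)
    {e h : ℝ → ℝ} (he : MemL2w (-s) (-k) e) (hh : MemL2w 0 (s - k) h)
    (H : ∀ q : ℝ[X], ∫ x in Lam, h x * q.eval x * weight 0 (s - k) x
      = ∫ x in Lam, e x * (leftDerivOp s k q).eval x) :
    normL2w (-s) (-k) e ≤ √((fracEigen s k 0)⁻¹) * normL2w 0 (s - k) h := by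
  have hk' : (1 : ℝ) ≤ k := by exact_mod_cast hk
  have hs : -1 < s := by linarith
  have hkk : -1 < (k : ℝ) := by linarith
  have hb : -1 < s - k := by linarith
  have h0 : (-1 : ℝ) < 0 := by norm_num
  set c := fracEigen s k 0 with hc
  have hc0 : 0 < c := fracEigen_pos h1 0
  -- The weight `ω^{(-s,-k)}` is not integrable, so polynomials are unavailable there.
  -- Multiplication by it is an isometry onto `L²_{ω^{(s,k)}}`, where they are dense.
  set E : ℝ → ℝ := fun x => e x * weight (-s) (-k) x with hE
  have hw : ∀ x ∈ Lam, weight (-s) (-k) x * weight s k x = 1 := fun x hx => by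
    have := weight_mul (a := -s) (b := -k) (c := s) (d := k) hx
    simpa [weight_zero] using this
  have hEsq : EqOn (fun x => e x ^ 2 * weight (-s) (-k) x) (fun x => E x ^ 2 * weight s k x)
      Lam := fun x hx => by
    simp only [hE]
    linear_combination (-e x ^ 2 * weight (-s) (-k) x) * hw x hx
  have hEm : MemL2w s k E :=
    ⟨he.1.mul (measurable_weight _ _).aestronglyMeasurable,
      he.2.congr_fun hEsq measurableSet_Lam⟩
  have hEn : normL2w (-s) (-k) e = normL2w s k E := by
    unfold normL2w
    rw [setIntegral_congr_fun measurableSet_Lam hEsq]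
  rw [hEn]
  refine normL2w_le_of_forall_polynomial hs hkk hEm
    (mul_nonneg (Real.sqrt_nonneg _) (normL2w_nonneg _ _ _)) fun p => ?_
  have hadj := jacobiForm_leftDerivOp hk h1 h2 hs hkk h0 hb
  have hB := isPosDefForm_jacobiForm hs hkk
  have hB' := isPosDefForm_jacobiForm h0 hb
  obtain ⟨r, hr, hle⟩ := hB.exists_preimage
    (S := leftDerivOp s k ∘ₗ rightDerivOp s k)
    (fun p q => by
      simp only [LinearMap.comp_apply]
      rw [hadj, hB.symm p, hadj, hB'.symm])
    (fun n p hp => leftDerivOp_mem_degreeLT s k (rightDerivOp_mem_degreeLT s k hp))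
    (M := 0) (ev := fracEigen s k) (c := c) (fun n _ p hp => coeff_left_rightDerivOp s k hp)
    hc0 (fun n _ => fracEigen_zero_le hk h1 n) (p := p) (fun x hx => by
      have : x = 0 := by
        ext i; simpa using mem_degreeLT_iff_coeff.1 hx i (Nat.zero_le _)
      simp [this])
  set q := rightDerivOp s k r with hq
  have hr' : leftDerivOp s k q = p := hr
  -- With `p = D_-^s(q ω^{(0,s-k)})`, the pairing of `e` with `p` becomes the pairing of `h` with
  -- `q`.
  have e1 : ∫ x in Lam, E x * p.eval x * weight s k x
      = ∫ x in Lam, h x * q.eval x * weight 0 (s - k) x := by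
    rw [H q, hr']
    refine setIntegral_congr_fun measurableSet_Lam fun x hx => ?_
    simp only [hE]
    linear_combination (e x * p.eval x) * hw x hx
  rw [e1]
  refine (hh.abs_integral_mul_le (memL2w_eval h0 hb q)).trans ?_
  have e2 : c * normL2w 0 (s - k) (fun x => q.eval x) ^ 2
      ≤ normL2w s k (fun x => p.eval x) ^ 2 := by
    rw [normL2w_eval_sq h0 hb, normL2w_eval_sq hs hkk]
    refine le_of_eq_of_le ?_ hle
    rw [LinearMap.comp_apply, ← hq, hadj]
  have e3 : normL2w 0 (s - k) (fun x => q.eval x)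
      ≤ √(c⁻¹) * normL2w s k (fun x => p.eval x) := by
    refine (sq_le_sq₀ (normL2w_nonneg _ _ _)
      (mul_nonneg (Real.sqrt_nonneg _) (normL2w_nonneg _ _ _))).1 ?_
    rw [mul_pow, Real.sq_sqrt (inv_nonneg.2 hc0.le), ← div_eq_inv_mul, le_div_iff₀ hc0]
    linarith
  calc _ ≤ normL2w 0 (s - k) h * (√(c⁻¹) * normL2w s k (fun x => p.eval x)) :=
        mul_le_mul_of_nonneg_left e3 (normL2w_nonneg _ _ _)
    _ = _ := by ring

/-! ### The Jacobi projection error -/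

/-- The operator `q ↦ (-1)^m ω^{(0,-b)} D^m (ω^{(m,b+m)} D^m q)` on polynomials. -/
def sturmOp (b : ℝ) (m : ℕ) : ℝ[X] →ₗ[ℝ] ℝ[X] :=
  (-1 : ℝ) ^ m • (jacobiIter (0 + m) (b + m) m ∘ₗ (derivative ^ m : Module.End ℝ ℝ[X]))

lemma sturmOp_apply (b : ℝ) (m : ℕ) (p : ℝ[X]) :
    sturmOp b m p = (-1 : ℝ) ^ m • jacobiIter (0 + m) (b + m) m (derivative^[m] p) := by
  rw [sturmOp, LinearMap.smul_apply, LinearMap.comp_apply, Module.End.pow_apply]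

/-- The weight `ω^{(m,b+m)}` removes all boundary terms in the `m` integrations by parts. The right
side shows both symmetry and the energy identity used in the projection error. -/
lemma jacobiForm_sturmOp {b : ℝ} (m : ℕ) (h0 : (-1 : ℝ) < 0) (hb : -1 < b)
    (hm : (-1 : ℝ) < 0 + m) (hbm : -1 < b + m) (p q : ℝ[X]) :
    jacobiForm 0 b h0 hb (sturmOp b m p) q
      = jacobiForm (0 + m) (b + m) hm hbm (derivative^[m] p) (derivative^[m] q) := by
  have h := integral_eval_mul_weight_mul_iteratedDeriv (a := 0 + m) (b := b + m) m (by linarith)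
    (by linarith) (derivative^[m] p) (contDiff_eval q)
  rw [iteratedDeriv_eval, add_sub_cancel_right, add_sub_cancel_right] at h
  rw [jacobiForm_apply, jacobiForm_apply]
  calc _ = (-1) ^ m * ∫ x in Lam, (jacobiIter (0 + m) (b + m) m (derivative^[m] p)).eval x
          * weight 0 b x * q.eval x := by
        rw [← integral_const_mul, sturmOp_apply]
        congr 1; ext x
        rw [eval_smul, smul_eq_mul]; ring
    _ = _ := by
      rw [← h]
      congr 1; ext x; ring

lemma sturmOp_mem_degreeLT (b : ℝ) (m : ℕ) {n : ℕ} {p : ℝ[X]} (hp : p ∈ degreeLT ℝ n) :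
    sturmOp b m p ∈ degreeLT ℝ n := by
  rw [sturmOp_apply]
  refine Submodule.smul_mem _ _ ?_
  rcases le_total n m with h | h
  · rw [iterate_derivative_eq_zero_of_mem h hp, map_zero]
    exact Submodule.zero_mem _
  · have : derivative^[m] p ∈ degreeLT ℝ (n - m) :=
      iterate_derivative_mem_degreeLT (by rwa [Nat.sub_add_cancel h])
    have := jacobiIter_mem_degreeLT (0 + m) (b + m) this m
    rwa [Nat.sub_add_cancel h] at this

lemma coeff_sturmOp (b : ℝ) (m : ℕ) {n : ℕ} (hmn : m ≤ n) {p : ℝ[X]}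
    (hp : p ∈ degreeLT ℝ (n + 1)) :
    (sturmOp b m p).coeff n = n.descFactorial m
      * (∏ j ∈ Finset.range m, ((n : ℝ) + b + m - j)) * p.coeff n := by
  obtain ⟨l, rfl⟩ := Nat.exists_eq_add_of_le' hmn
  have hd : derivative^[m] p ∈ degreeLT ℝ (l + 1) :=
    iterate_derivative_mem_degreeLT (by rwa [show l + 1 + m = l + m + 1 by ring])
  rw [sturmOp_apply, coeff_smul, coeff_jacobiIter _ _ hd, coeff_iterate_derivative, smul_eq_mul,
    nsmul_eq_mul]
  have e1 : ((-1 : ℝ) ^ m) * (-1) ^ m = 1 := by rw [← mul_pow]; simp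
  have e2 : ∏ j ∈ Finset.range m, ((l : ℝ) + (0 + m) + (b + m) - j)
      = ∏ j ∈ Finset.range m, (((l + m : ℕ) : ℝ) + b + m - j) :=
    Finset.prod_congr rfl fun j _ => by push_cast; ring
  rw [e2]
  linear_combination (((l + m).descFactorial m : ℝ)
    * (∏ j ∈ Finset.range m, (((l + m : ℕ) : ℝ) + b + m - j)) * p.coeff (l + m)) * e1

/-- Bounds the eigenvalues of `sturmOp` beyond degree `N`: the falling factorial is monotone, and `n
+ b + m - j > N` because `j ≤ m - 1` and `b > -1`. -/
lemma pow_mul_descFactorial_le {b : ℝ} (hb : -1 < b) {m N n : ℕ} (hn : N + 1 ≤ n) :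
    (N : ℝ) ^ m * (N + 1).descFactorial m
      ≤ n.descFactorial m * ∏ j ∈ Finset.range m, ((n : ℝ) + b + m - j) := by
  rw [mul_comm]
  refine mul_le_mul ?_ ?_ (by positivity) (by positivity)
  · exact_mod_cast Nat.descFactorial_le m hn
  · calc (N : ℝ) ^ m = ∏ j ∈ Finset.range m, (N : ℝ) := by simp
      _ ≤ _ := by
        refine Finset.prod_le_prod (fun _ _ => Nat.cast_nonneg N) fun j hj => ?_
        have h1 : (j : ℝ) + 1 ≤ m := by exact_mod_cast Finset.mem_range.1 hj
        have h2 : (N : ℝ) + 1 ≤ n := by exact_mod_cast hn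
        linarith

/-- The error of the `L²_{ω^{(0,b)}}` projection onto polynomials of degree at most `N`. -/
lemma normL2w_projection_error_le {b : ℝ} (hb : -1 < b) {m N : ℕ} (hmN : m ≤ N) {g G : ℝ → ℝ}
    (hg : MemL2w 0 b g) (hG : MemL2w m (b + m) G) {σ : ℝ} (hσ : |σ| = 1)
    (H : ∀ φ, IsTestFun φ → ∫ x in Lam, g x * iteratedDeriv m φ x = σ * ∫ x in Lam, G x * φ x)
    {P : ℝ[X]} (hP : P ∈ degreeLT ℝ (N + 1))
    (hort : ∀ p ∈ degreeLT ℝ (N + 1), ∫ x in Lam, (g x - P.eval x) * p.eval x * weight 0 b x = 0) :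
    normL2w 0 b (fun x => g x - P.eval x)
      ≤ √(((N : ℝ) ^ m * (N + 1).descFactorial m)⁻¹) * normL2w m (b + m) G := by
  have h0 : (-1 : ℝ) < 0 := by norm_num
  have hm0 : (0 : ℝ) ≤ m := Nat.cast_nonneg m
  have hm : (-1 : ℝ) < 0 + m := by linarith
  have hbm : -1 < b + m := by linarith
  replace hG : MemL2w (0 + m) (b + m) G := by rwa [zero_add]
  rw [show normL2w m (b + m) G = normL2w (0 + m) (b + m) G by rw [zero_add]]
  set c := (N : ℝ) ^ m * (N + 1).descFactorial m with hc
  have hc0 : 0 < c := by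
    refine mul_pos ?_ ?_
    -- For `m = 0` the value `N = 0` is allowed and `0 ^ 0 = 1`; otherwise `N ≥ m > 0`.
    · rcases Nat.eq_zero_or_pos m with h | h
      · simp [h]
      · exact pow_pos (by exact_mod_cast (by omega : 0 < N)) m
    · exact_mod_cast Nat.pos_of_ne_zero fun h => by
        rw [Nat.descFactorial_eq_zero_iff_lt] at h; omega
  have hPm := memL2w_eval h0 hb P
  have hB := isPosDefForm_jacobiForm h0 hb
  have hform := jacobiForm_sturmOp m h0 hb hm hbm
  refine normL2w_le_of_forall_polynomial h0 hb (hg.sub hPm)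
    (mul_nonneg (Real.sqrt_nonneg _) (normL2w_nonneg _ _ _)) fun p => ?_
  obtain ⟨p₀, p₁, hp, hp₀, hp₁⟩ := hB.exists_decomp (N + 1) p
  obtain ⟨r, hr, hle⟩ := hB.exists_preimage (S := sturmOp b m)
    (fun p q => by rw [hform, hB.symm p, hform, (isPosDefForm_jacobiForm hm hbm).symm])
    (fun n p hp => sturmOp_mem_degreeLT b m hp) (M := N + 1)
    (ev := fun n => n.descFactorial m * ∏ j ∈ Finset.range m, ((n : ℝ) + b + m - j)) (c := c)
    (fun n hn p hp => coeff_sturmOp b m (by omega) hp) hc0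
    (fun n hn => pow_mul_descFactorial_le hb hn) hp₁
  have hi := (hg.sub hPm).integrableOn_mul (memL2w_eval h0 hb p₀)
  have hi1 := (hg.sub hPm).integrableOn_mul (memL2w_eval h0 hb p₁)
  -- The low-degree part `p₀` of `p` is annihilated by the error, and `P` is annihilated by the
  -- high-degree part `p₁`.
  have e1 : ∫ x in Lam, (g x - P.eval x) * p.eval x * weight 0 b x
      = ∫ x in Lam, g x * p₁.eval x * weight 0 b x := by
    have a1 : ∫ x in Lam, (g x - P.eval x) * p.eval x * weight 0 b x
        = (∫ x in Lam, (g x - P.eval x) * p₀.eval x * weight 0 b x)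
          + ∫ x in Lam, (g x - P.eval x) * p₁.eval x * weight 0 b x := by
      rw [← integral_add hi hi1]
      congr 1; ext x
      rw [hp, eval_add]; ring
    have a2 : ∫ x in Lam, (g x - P.eval x) * p₁.eval x * weight 0 b x
        = (∫ x in Lam, g x * p₁.eval x * weight 0 b x)
          - ∫ x in Lam, P.eval x * p₁.eval x * weight 0 b x := by
      rw [← integral_sub (hg.integrableOn_mul (memL2w_eval h0 hb p₁))
        (hPm.integrableOn_mul (memL2w_eval h0 hb p₁))]
      congr 1; ext x; ring
    have a3 : ∫ x in Lam, P.eval x * p₁.eval x * weight 0 b x = 0 := by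
      have := hp₁ P hP
      rw [hB.symm] at this
      exact this
    rw [a1, hort p₀ hp₀, a2, a3]; ring
  -- Since `p₁ = sturmOp b m r`, weak integration by parts moves `m` derivatives onto `g` and leaves
  -- the other `m` on `r`.
  have e2 : ∫ x in Lam, g x * p₁.eval x * weight 0 b x
      = (-1) ^ m * (σ * ∫ x in Lam, G x * (derivative^[m] r).eval x
        * weight (0 + m) (b + m) x) := by
    rw [← integral_weak_parts h0 hb hg hG H, ← integral_const_mul, ← hr, sturmOp_apply]
    congr 1; ext x
    rw [eval_smul, smul_eq_mul]; ring
  rw [e1, e2, abs_mul, abs_mul, hσ, abs_pow, abs_neg, abs_one, one_pow, one_mul, one_mul]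
  refine (hG.abs_integral_mul_le (memL2w_eval hm hbm _)).trans ?_
  have e3 : c * normL2w (0 + m) (b + m) (fun x => (derivative^[m] r).eval x) ^ 2
      ≤ normL2w 0 b (fun x => p.eval x) ^ 2 := by
    rw [normL2w_eval_sq h0 hb, normL2w_eval_sq hm hbm, ← hform]
    refine hle.trans ?_
    have : jacobiForm 0 b h0 hb p p = jacobiForm 0 b h0 hb p₀ p₀ + jacobiForm 0 b h0 hb p₁ p₁ := by
      rw [hp]
      simp only [map_add, LinearMap.add_apply]
      rw [hB.symm p₀ p₁, hp₁ p₀ hp₀]; ring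
    rw [this]
    linarith [hB.nonneg p₀]
  have e4 : normL2w (0 + m) (b + m) (fun x => (derivative^[m] r).eval x)
      ≤ √(c⁻¹) * normL2w 0 b (fun x => p.eval x) := by
    refine (sq_le_sq₀ (normL2w_nonneg _ _ _)
      (mul_nonneg (Real.sqrt_nonneg _) (normL2w_nonneg _ _ _))).1 ?_
    rw [mul_pow, Real.sq_sqrt (inv_nonneg.2 hc0.le), ← div_eq_inv_mul, le_div_iff₀ hc0]
    linarith
  calc _ ≤ normL2w (0 + m) (b + m) G * (√(c⁻¹) * normL2w 0 b (fun x => p.eval x)) :=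
        mul_le_mul_of_nonneg_left e4 (normL2w_nonneg _ _ _)
    _ = _ := by ring

/-! ### Trial and test spaces -/

lemma eval_iterate_derivative_of_dvd {p : ℝ[X]} {a : ℝ} {k l : ℕ} (h : (X - C a) ^ k ∣ p)
    (hl : l < k) : (derivative^[l] p).eval a = 0 := by
  by_cases hp : p = 0
  · simp [hp]
  · exact isRoot_iterate_derivative_of_lt_rootMultiplicity
      (hl.trans_le ((le_rootMultiplicity_iff hp).2 h))

lemma dvd_of_eval_iterate_derivative {p : ℝ[X]} {a : ℝ} {k : ℕ}
    (h : ∀ l < k, (derivative^[l] p).eval a = 0) : (X - C a) ^ k ∣ p := by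
  by_cases hp : p = 0
  · simp [hp]
  · cases k with
    | zero => simp
    | succ n =>
      exact (le_rootMultiplicity_iff hp).1 (lt_rootMultiplicity_of_isRoot_iterate_derivative hp
        fun m hm => h m (by omega))

/-- Vanishing to order `k` at `-1` factors `(1+x)^k` out of `ψ`. The cofactor loses `k` degrees,
which `rightDerivOp` gives back, so the fractional derivative has degree at most `N`. -/
lemma MemFplus.exists_eqOn {s : ℝ} {k N : ℕ} {φ : ℝ → ℝ} (h : MemFplus s k N φ) :
    ∃ r : ℝ[X], rightDerivOp s k r ∈ degreeLT ℝ (N + 1) ∧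
      EqOn φ (fun x => r.eval x * weight s k x) Lam := by
  obtain ⟨ψ, hdeg, hder, heq⟩ := h
  obtain ⟨r, hr⟩ := dvd_of_eval_iterate_derivative hder
  refine ⟨r, ?_, fun x hx => ?_⟩
  · by_cases h0 : r = 0
    · rw [h0, map_zero]; exact Submodule.zero_mem _
    · have hn : k + r.natDegree ≤ N := by
        rw [hr, natDegree_mul (pow_ne_zero _ (X_sub_C_ne_zero _)) h0, natDegree_pow,
          natDegree_X_sub_C, mul_one] at hdeg
        exact hdeg
      have hrm : r ∈ degreeLT ℝ (r.natDegree + 1) :=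
        mem_degreeLT_iff_coeff.2 fun i hi => coeff_eq_zero_of_natDegree_lt (by omega)
      exact degreeLT_mono (by omega) (rightDerivOp_mem_degreeLT s k hrm)
  · rw [heq hx, hr]
    simp only [eval_mul, eval_pow, eval_sub, eval_X, eval_C, weight, Real.rpow_natCast]
    rw [show x - -1 = 1 + x by ring]; ring

lemma memFminus_eval_mul_weight (s : ℝ) {k N : ℕ} {r : ℝ[X]} (hr : k + r.natDegree ≤ N) :
    MemFminus s k N (fun x => r.eval x * weight k s x) := by
  have hdvd : (X - C 1) ^ k ∣ (C 1 - X) ^ k * r := by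
    rw [show (C 1 - X : ℝ[X]) = -1 * (X - C 1) by ring, mul_pow]
    exact Dvd.intro_left _ (by ring : (-1) ^ k * r * (X - C 1) ^ k = _)
  refine ⟨(C 1 - X) ^ k * r, ?_, fun l hl => eval_iterate_derivative_of_dvd hdvd hl,
    fun x _ => ?_⟩
  · refine (natDegree_mul_le).trans ((Nat.add_le_add_right ?_ _).trans hr)
    refine natDegree_pow_le.trans ?_
    have : (C 1 - X : ℝ[X]).natDegree ≤ 1 := by
      refine (natDegree_sub_le _ _).trans ?_
      simp
    nlinarith
  · simp only [eval_mul, eval_pow, eval_sub, eval_X, eval_C, weight, Real.rpow_natCast]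
    ring

lemma contDiff_weight {a b : ℝ} {n : ℕ} (ha : n ≤ a) (hb : n ≤ b) :
    ContDiff ℝ n (weight a b) :=
  ((Real.contDiff_rpow_const_of_le ha).comp (contDiff_const.sub contDiff_id)).mul
    ((Real.contDiff_rpow_const_of_le hb).comp (contDiff_const.add contDiff_id))

lemma iteratedDerivWithin_Icc_eq {v : ℝ → ℝ} {n l : ℕ} (hv : ContDiff ℝ n v) (hl : l ≤ n) {x : ℝ}
    (hx : x ∈ Icc (-1 : ℝ) 1) :
    iteratedDerivWithin l v (Icc (-1) 1) x = iteratedDeriv l v x :=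
  iteratedDerivWithin_eq_iteratedDeriv (uniqueDiffOn_Icc (by norm_num))
    (hv.contDiffAt.of_le (by exact_mod_cast hl)) hx

lemma memV_eval_mul_weight {s : ℝ} {k : ℕ} (hk : 1 ≤ k) (h1 : (k : ℝ) - 1 < s) (h2 : s < k)
    (r : ℝ[X]) : MemV s k (fun x => r.eval x * weight k s x) := by
  have hk' : (1 : ℝ) ≤ k := by exact_mod_cast hk
  have hcast : ((k - 1 : ℕ) : ℝ) = k - 1 := by rw [Nat.cast_sub hk]; simp
  have hz := isZeroTraceDeriv_weight (a := k) (b := s) hk (by linarith) h1 r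
    (eqOn_refl (fun x => r.eval x * weight k s x) Lam)
  have hv : ContDiff ℝ (k - 1 : ℕ) (fun x => r.eval x * weight k s x) :=
    ((contDiff_eval r).of_le (WithTop.coe_le_coe.2 le_top)).mul
      (contDiff_weight (by rw [hcast]; linarith) (by rw [hcast]; linarith))
  have hder : ∀ l < k, ∀ x ∈ Icc (-1 : ℝ) 1,
      iteratedDeriv l (fun x => r.eval x * weight k s x) x
        = (jacobiIter k s l r).eval x * weight (k - l) (s - l) x := by
    intro l hl x hx
    have hl' : (l : ℝ) ≤ k - 1 := by
      have : (l : ℝ) + 1 ≤ k := by exact_mod_cast hl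
      linarith
    have hEq : EqOn (iteratedDeriv l (fun x => r.eval x * weight k s x))
        (fun x => (jacobiIter k s l r).eval x * weight (k - l) (s - l) x) Lam :=
      fun y hy => iteratedDeriv_eval_mul_weight _ _ _ _ hy
    -- The formula for the derivatives holds inside `Λ` and extends to the endpoints by continuity,
    -- as both exponents stay nonnegative for `l < k`; in fact they stay positive, whence the
    -- boundary zeros.
    have hc := hEq.closure (hv.continuous_iteratedDeriv l (by exact_mod_cast (by omega)))
      ((jacobiIter k s l r).continuous.mul (continuous_weight (by linarith) (by linarith)))
    rw [Lam, closure_Ioo (by norm_num)] at hc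
    exact hc hx
  refine ⟨memL2w_eval_mul_weight (by linarith) (by linarith) r, ⟨_, hz.isWeakDeriv⟩, ?_,
    hv.contDiffOn, fun l hl => ?_⟩
  · refine MemL2w.congr ?_ hz.isWeakDeriv.weakDeriv_ae_eq.symm
    have := memL2w_eval_mul_weight (a := (k : ℝ) - k) (b := s - k) (by linarith) (by linarith)
      (jacobiIter k s k r)
    rwa [neg_sub, neg_sub, show MemL2w ((k : ℝ) - k) = MemL2w 0 by rw [sub_self]] at this
  · have hl' : (l : ℝ) ≤ k - 1 := by
      have : (l : ℝ) + 1 ≤ k := by exact_mod_cast hl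
      linarith
    rw [iteratedDerivWithin_Icc_eq hv (by omega) (by simp),
      iteratedDerivWithin_Icc_eq hv (by omega) (by simp), hder l hl _ (by simp),
      hder l hl _ (by simp), weight_neg_one (by linarith), weight_one (by linarith), mul_zero,
      mul_zero]
    exact ⟨rfl, rfl⟩

lemma IsTestFun.memV {φ : ℝ → ℝ} (h : IsTestFun φ) (s : ℝ) (k : ℕ) : MemV s k φ := by
  have hc : ∀ n : ℕ, ContDiff ℝ n φ := fun n => h.1.of_le (by exact_mod_cast le_top)
  refine ⟨h.memL2w _ _, ⟨_, h.isWeakDeriv k⟩,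
    ((h.iteratedDeriv k).memL2w _ _).congr (h.isWeakDeriv k).weakDeriv_ae_eq.symm,
    (hc _).contDiffOn, fun l _ => ?_⟩
  rw [iteratedDerivWithin_Icc_eq (hc l) le_rfl (by simp),
    iteratedDerivWithin_Icc_eq (hc l) le_rfl (by simp)]
  exact ⟨(h.iteratedDeriv l).eq_zero (by simp [Lam]), (h.iteratedDeriv l).eq_zero (by simp [Lam])⟩

/-! ### Galerkin orthogonality and the error estimate -/

/-- The derivative `D^k` of the test function carries the weight `ω^{(0,s-k)}` itself, so the
bilinear form becomes a weighted inner product with a polynomial. -/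
lemma bilin_eval_mul_weight {s : ℝ} {k : ℕ} (hk : 1 ≤ k) (h1 : (k : ℝ) - 1 < s) (h2 : s < k)
    (u : ℝ → ℝ) (r : ℝ[X]) :
    bilin s k u (fun x => r.eval x * weight k s x)
      = ∫ x in Lam, rlDeriv s u x * (jacobiIter k s k r).eval x * weight 0 (s - k) x := by
  have hz := isZeroTraceDeriv_weight (a := k) (b := s) hk (by linarith) h1 r
    (eqOn_refl (fun x => r.eval x * weight k s x) Lam)
  refine integral_congr_ae ?_
  filter_upwards [hz.isWeakDeriv.weakDeriv_ae_eq] with x hx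
  rw [hx, sub_self]; ring

lemma galerkin_orthogonality {s : ℝ} {k N : ℕ} (hk : 1 ≤ k) (h1 : (k : ℝ) - 1 < s) (h2 : s < k)
    {f u uN : ℝ → ℝ} (hu : IsWeakSolution s k f u) (hN : IsDiscreteSolution s k N f uN)
    {P : ℝ[X]} (hP : rlDeriv s uN =ᵐ[volume.restrict Lam] fun x => P.eval x)
    (hadj : ∀ q : ℝ[X], ∫ x in Lam, (rlDeriv s u x - P.eval x) * q.eval x * weight 0 (s - k) x
      = ∫ x in Lam, (u x - uN x) * (leftDerivOp s k q).eval x)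
    {p : ℝ[X]} (hp : p ∈ degreeLT ℝ (N + 1)) :
    ∫ x in Lam, (rlDeriv s u x - P.eval x) * p.eval x * weight 0 (s - k) x = 0 := by
  have hk' : (1 : ℝ) ≤ k := by exact_mod_cast hk
  have hb : -1 < s - k := by linarith
  have h0 : (-1 : ℝ) < 0 := by norm_num
  have hg := hu.1.2.2.1
  have hPm := memL2w_eval h0 hb P
  have hint : ∀ q : ℝ[X], IntegrableOn
      (fun x => (rlDeriv s u x - P.eval x) * q.eval x * weight 0 (s - k) x) Lam :=
    fun q => (hg.sub hPm).integrableOn_mul (memL2w_eval h0 hb q)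
  have hgal : ∀ r : ℝ[X], k + r.natDegree ≤ N →
      ∫ x in Lam, (rlDeriv s u x - P.eval x) * (jacobiIter k s k r).eval x
        * weight 0 (s - k) x = 0 := by
    intro r hr
    have a1 := (hu.2 _ (memV_eval_mul_weight hk h1 h2 r)).2
    have a2 := hN.2 _ (memFminus_eval_mul_weight s hr)
    rw [← a2, bilin_eval_mul_weight hk h1 h2, bilin_eval_mul_weight hk h1 h2] at a1
    have a3 : ∫ x in Lam, rlDeriv s uN x * (jacobiIter k s k r).eval x * weight 0 (s - k) x
        = ∫ x in Lam, P.eval x * (jacobiIter k s k r).eval x * weight 0 (s - k) x := by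
      refine integral_congr_ae ?_
      filter_upwards [hP] with x hx
      rw [hx]
    rw [a3] at a1
    have hq := memL2w_eval h0 hb (jacobiIter k s k r)
    rw [← sub_eq_zero, ← integral_sub (hg.integrableOn_mul hq) (hPm.integrableOn_mul hq)] at a1
    refine Eq.trans ?_ a1
    congr 1; ext x; ring
  suffices h : ∀ n, n ≤ N + 1 → ∀ p ∈ degreeLT ℝ n,
      ∫ x in Lam, (rlDeriv s u x - P.eval x) * p.eval x * weight 0 (s - k) x = 0 from
    h (N + 1) le_rfl p hp
  intro n
  induction n with
  | zero =>
    intro _ p hp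
    rw [hadj, leftDerivOp_eq_zero s k (Nat.zero_le k) hp]; simp
  | succ n ih =>
    intro hn p hp
    -- No test function reaches degrees below `k`. There orthogonality comes from the adjoint
    -- relation, since `D^k` annihilates such polynomials.
    by_cases hnk : n + 1 ≤ k
    · rw [hadj, leftDerivOp_eq_zero s k hnk hp]; simp
    · push Not at hnk
      -- This test function produces `J` of exact degree `n`, which removes the leading term of `p`.
      set r : ℝ[X] := X ^ (n - k) with hr
      have hrd : r.natDegree = n - k := by rw [hr, natDegree_X_pow]
      have hrm : r ∈ degreeLT ℝ (n - k + 1) :=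
        mem_degreeLT_iff_coeff.2 fun i hi => coeff_eq_zero_of_natDegree_lt (by omega)
      have hnn : n - k + k = n := by omega
      set J := jacobiIter k s k r with hJ
      have hJm : J ∈ degreeLT ℝ (n + 1) := by
        have := jacobiIter_mem_degreeLT k s hrm k
        rwa [show n - k + 1 + k = n + 1 by omega] at this
      have hJc : J.coeff n ≠ 0 := by
        have := coeff_jacobiIter k s hrm k
        rw [hnn] at this
        rw [hJ, this, hr, coeff_X_pow, if_pos rfl, mul_one]
        refine mul_ne_zero (pow_ne_zero _ (by norm_num)) (ne_of_gt ?_)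
        have hpp := prod_shift_pos h1 (n - k)
        refine lt_of_lt_of_eq hpp (Finset.prod_congr rfl fun j _ => by ring)
      set t := p.coeff n / J.coeff n with ht
      have hlow : p - t • J ∈ degreeLT ℝ n := by
        have b1 := mem_degreeLT_iff_coeff.1 hp
        have b2 := mem_degreeLT_iff_coeff.1 hJm
        rw [mem_degreeLT_iff_coeff]
        intro i hi
        rcases hi.eq_or_lt with rfl | hi
        · rw [coeff_sub, coeff_smul, smul_eq_mul, ht, div_mul_cancel₀ _ hJc, sub_self]
        · simp [b1 i hi, b2 i hi]
      have c1 := ih (by omega) _ hlow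
      have c2 := hgal r (by omega)
      have c3 : ∫ x in Lam, (rlDeriv s u x - P.eval x) * p.eval x * weight 0 (s - k) x
          = (∫ x in Lam, (rlDeriv s u x - P.eval x) * (p - t • J).eval x * weight 0 (s - k) x)
            + ∫ x in Lam, t * ((rlDeriv s u x - P.eval x) * J.eval x * weight 0 (s - k) x) := by
        rw [← integral_add (hint _) ((hint J).const_mul t)]
        congr 1; ext x
        rw [eval_sub, eval_smul, smul_eq_mul]; ring
      rw [c3, c1, integral_const_mul, c2]; ring

/-- The error estimate in terms of a weak derivative `G` of order `m` of `D_+^s u`. -/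
lemma normU_sub_le {s : ℝ} {k m N : ℕ} (hk : 1 ≤ k) (h1 : (k : ℝ) - 1 < s) (h2 : s < k)
    (hmN : m ≤ N) {f u uN G : ℝ → ℝ} (hu : IsWeakSolution s k f u)
    (hN : IsDiscreteSolution s k N f uN) (hG : MemL2w m (s - k + m) G) {σ : ℝ} (hσ : |σ| = 1)
    (H : ∀ φ, IsTestFun φ →
      ∫ x in Lam, rlDeriv s u x * iteratedDeriv m φ x = σ * ∫ x in Lam, G x * φ x) :
    normU s k (fun x => u x - uN x) ≤ √((fracEigen s k 0)⁻¹ + 1)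
      * (√(((N : ℝ) ^ m * (N + 1).descFactorial m)⁻¹) * normL2w m (s - k + m) G) := by
  have hk' : (1 : ℝ) ≤ k := by exact_mod_cast hk
  have hs : -1 < s := by linarith
  have hkk : -1 < (k : ℝ) := by linarith
  have hb : -1 < s - k := by linarith
  have h0 : (-1 : ℝ) < 0 := by norm_num
  obtain ⟨r, hrm, hr⟩ := hN.1.exists_eqOn
  have hz := isZeroTraceDeriv_weight hk h1 (by linarith) r hr
  set P := rightDerivOp s k r with hPdef
  have hP := rlDeriv_weight_ae_eq hk h1 h2 r hr
  have hg := hu.1.2.2.1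
  have hPm := memL2w_eval h0 hb P
  have huN : MemL2w (-s) (-k) uN := by
    refine (memL2w_eval_mul_weight hs hkk r).congr ?_
    filter_upwards [ae_restrict_mem measurableSet_Lam] with x hx
    exact (hr hx).symm
  have he := hu.1.1.sub huN
  -- The adjoint relation holds for `u` by density and for `uN` by its explicit form, hence for the
  -- error.
  have hadj : ∀ q : ℝ[X],
      ∫ x in Lam, (rlDeriv s u x - P.eval x) * q.eval x * weight 0 (s - k) x
        = ∫ x in Lam, (u x - uN x) * (leftDerivOp s k q).eval x := by
    intro q
    have hq := memL2w_eval h0 hb q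
    have a1 := hu.1.integral_rlDeriv_mul hk h1 h2 q
    have a2 := hz.integral_rlDeriv_mul hk h1 h2 q
    have a3 : ∫ x in Lam, rlDeriv s uN x * q.eval x * weight 0 (s - k) x
        = ∫ x in Lam, P.eval x * q.eval x * weight 0 (s - k) x := by
      refine integral_congr_ae ?_
      filter_upwards [hP] with x hx
      rw [hx]
    have a4 : ∫ x in Lam, (u x - uN x) * (leftDerivOp s k q).eval x
        = (∫ x in Lam, u x * (leftDerivOp s k q).eval x)
          - ∫ x in Lam, uN x * (leftDerivOp s k q).eval x := by
      rw [← integral_sub (hu.1.1.integrableOn_mul_eval hs hkk _)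
        (huN.integrableOn_mul_eval hs hkk _)]
      congr 1; ext x; ring
    rw [a4, ← a1, ← a2, a3, ← integral_sub (hg.integrableOn_mul hq) (hPm.integrableOn_mul hq)]
    congr 1; ext x; ring
  have hstab := normL2w_le_of_adjoint hk h1 h2 he (hg.sub hPm) hadj
  have herr := normL2w_projection_error_le hb hmN hg hG hσ H hrm
    (fun p hp => galerkin_orthogonality hk h1 h2 hu hN hP hadj hp)
  have hrl : normL2w 0 (s - k) (rlDeriv s (fun x => u x - uN x))
      = normL2w 0 (s - k) (fun x => rlDeriv s u x - P.eval x) := by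
    refine normL2w_congr ?_
    filter_upwards [rlDeriv_sub_ae hk h1 h2 hu.1.2.1 (hz.hasRL hk h1 h2), hP] with x hx hx'
    rw [hx, hx']
  set n := normL2w 0 (s - k) (fun x => rlDeriv s u x - P.eval x) with hn
  have hn0 : 0 ≤ n := normL2w_nonneg _ _ _
  have hc0 : 0 ≤ (fracEigen s k 0)⁻¹ := (inv_pos.2 (fracEigen_pos h1 0)).le
  refine le_trans ?_ (mul_le_mul_of_nonneg_left herr (Real.sqrt_nonneg _))
  rw [normU, hrl]
  refine Real.sqrt_le_iff.2 ⟨mul_nonneg (Real.sqrt_nonneg _) hn0, ?_⟩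
  rw [mul_pow, Real.sq_sqrt (by linarith)]
  have := pow_le_pow_left₀ (normL2w_nonneg _ _ _) hstab 2
  rw [mul_pow, Real.sq_sqrt hc0] at this
  linarith

lemma inv_pow_mul_descFactorial {m N : ℕ} (h : m ≤ N) :
    ((N : ℝ) ^ m * (N + 1).descFactorial m)⁻¹ = (N : ℝ) ^ (-(m : ℤ)) *
      ((Nat.factorial (N - m + 1) : ℝ) / (Nat.factorial (N + 1) : ℝ)) := by
  have hf := Nat.factorial_mul_descFactorial (show m ≤ N + 1 by omega)
  rw [show N + 1 - m = N - m + 1 by omega] at hf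
  have h1 : (Nat.factorial (N - m + 1) : ℝ) ≠ 0 := by exact_mod_cast Nat.factorial_ne_zero _
  rw [mul_inv, zpow_neg, zpow_natCast, ← hf]
  congr 1
  push_cast
  rw [div_mul_eq_div_div, div_self h1, one_div]

/-- For `1 ≤ m ≤ N` each of the `m` factors of the falling factorial is at least `N + 2 - m`, and `N
≤ m (N + 2 - m)`; the total loss is `m^m`. -/
lemma inv_pow_mul_descFactorial_le {m N : ℕ} (h : m ≤ N) :
    ((N : ℝ) ^ m * (N + 1).descFactorial m)⁻¹ ≤ (m : ℝ) ^ m * ((N : ℝ) ^ (-(m : ℤ))) ^ 2 := by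
  rcases Nat.eq_zero_or_pos m with rfl | hm
  · simp
  · have hN : 0 < N := by omega
    have h1 : N ≤ m * (N + 2 - m) := by
      obtain ⟨d, rfl⟩ := Nat.exists_eq_add_of_le h
      rw [show m + d + 2 - m = d + 2 by omega]
      nlinarith
    have h2 : N ^ m ≤ m ^ m * (N + 1).descFactorial m := by
      calc N ^ m ≤ (m * (N + 2 - m)) ^ m := Nat.pow_le_pow_left h1 m
        _ = m ^ m * (N + 1 + 1 - m) ^ m := by rw [mul_pow]
        _ ≤ _ := Nat.mul_le_mul_left _ (Nat.pow_sub_le_descFactorial _ _)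
    have h3 : (N : ℝ) ^ m ≤ m ^ m * (N + 1).descFactorial m := by exact_mod_cast h2
    have hNm : (0 : ℝ) < (N : ℝ) ^ m := pow_pos (by exact_mod_cast hN) m
    have hD : (0 : ℝ) < (N + 1).descFactorial m := by
      exact_mod_cast Nat.pos_of_ne_zero fun h' => by
        rw [Nat.descFactorial_eq_zero_iff_lt] at h'; omega
    rw [zpow_neg, zpow_natCast, inv_pow, ← div_eq_mul_inv, inv_eq_one_div,
      div_le_div_iff₀ (by positivity) (by positivity)]
    nlinarith

lemma normU_sub_le_rates {s : ℝ} {k m N : ℕ} (hk : 1 ≤ k) (h1 : (k : ℝ) - 1 < s) (h2 : s < k)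
    (hmN : m ≤ N) {f u uN G : ℝ → ℝ} (hu : IsWeakSolution s k f u)
    (hN : IsDiscreteSolution s k N f uN) (hG : MemL2w m (s - k + m) G) {σ : ℝ} (hσ : |σ| = 1)
    (H : ∀ φ, IsTestFun φ →
      ∫ x in Lam, rlDeriv s u x * iteratedDeriv m φ x = σ * ∫ x in Lam, G x * φ x) :
    normU s k (fun x => u x - uN x) ≤ √((fracEigen s k 0)⁻¹ + 1) * √((m : ℝ) ^ m)
        * (N : ℝ) ^ (-(m : ℤ)) * normL2w m (s - k + m) G ∧
      normU s k (fun x => u x - uN x) ≤ √((fracEigen s k 0)⁻¹ + 1)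
        * √((N : ℝ) ^ (-(m : ℤ)) *
          ((Nat.factorial (N - m + 1) : ℝ) / (Nat.factorial (N + 1) : ℝ)))
        * normL2w m (s - k + m) G := by
  have h := normU_sub_le hk h1 h2 hmN hu hN hG hσ H
  refine ⟨h.trans ?_, ?_⟩
  · rw [mul_assoc, mul_assoc]
    refine mul_le_mul_of_nonneg_left ?_ (Real.sqrt_nonneg _)
    rw [← mul_assoc]
    refine mul_le_mul_of_nonneg_right ?_ (normL2w_nonneg _ _ _)
    refine (Real.sqrt_le_sqrt (inv_pow_mul_descFactorial_le hmN)).trans ?_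
    rw [Real.sqrt_mul (by positivity), Real.sqrt_sq (by positivity)]
  · rwa [inv_pow_mul_descFactorial hmN, ← mul_assoc] at h

/-- Since `(k + m) - (s + m) = k - s`, both derivatives differentiate the same fractional integral.
The signs of the Riemann-Liouville and weak derivatives cancel. -/
lemma integral_rlDeriv_mul_iteratedDeriv {s : ℝ} {k m : ℕ} (hk : 1 ≤ k) (h1 : (k : ℝ) - 1 < s)
    (h2 : s < k) {u : ℝ → ℝ} (hu : HasRL s u) (hum : HasRL (s + m) u) {φ : ℝ → ℝ}
    (hφ : IsTestFun φ) :
    ∫ x in Lam, rlDeriv s u x * iteratedDeriv m φ x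
      = ∫ x in Lam, rlDeriv (s + m) u x * φ x := by
  have hn : 1 ≤ k + m := by omega
  have h1' : ((k + m : ℕ) : ℝ) - 1 < s + m := by push_cast; linarith
  have h2' : s + m < ((k + m : ℕ) : ℝ) := by push_cast; linarith
  have e : ((k + m : ℕ) : ℝ) - (s + m) = k - s := by push_cast; ring
  rw [hasRL_iff hk h1 h2] at hu
  rw [hasRL_iff hn h1' h2', e] at hum
  rw [rlDeriv_eq hk h1 h2, rlDeriv_eq hn h1' h2', e]
  have a1 := hu.2.isWeakDeriv.2.2 _ (hφ.iteratedDeriv m)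
  have a2 := hum.2.isWeakDeriv.2.2 _ hφ
  have a3 : iteratedDeriv k (iteratedDeriv m φ) = iteratedDeriv (k + m) φ := by
    simp only [iteratedDeriv_eq_iterate, ← Function.iterate_add_apply]
  rw [a3, a2] at a1
  simp only [mul_assoc, integral_const_mul]
  exact a1.symm

/-- The equation is tested with `v = φ^{(m-k)}`, for which `D^k v = φ^{(m)}`; the `m - k`
derivatives then pass to `f`. -/
lemma IsWeakSolution.integral_rlDeriv_mul_iteratedDeriv {s : ℝ} {k m : ℕ} (hkm : k ≤ m)
    {f u : ℝ → ℝ} (hu : IsWeakSolution s k f u) (hf : HasWeakDeriv (m - k) f) {φ : ℝ → ℝ}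
    (hφ : IsTestFun φ) :
    ∫ x in Lam, rlDeriv s u x * iteratedDeriv m φ x
      = (-1) ^ (m - k) * ∫ x in Lam, weakDeriv (m - k) f x * φ x := by
  have hψ := hφ.iteratedDeriv (m - k)
  rw [← hf.isWeakDeriv.2.2 _ hφ, ← (hu.2 _ (hψ.memV s k)).2]
  refine integral_congr_ae ?_
  have a3 : iteratedDeriv k (iteratedDeriv (m - k) φ) = iteratedDeriv m φ := by
    simp only [iteratedDeriv_eq_iterate, ← Function.iterate_add_apply, Nat.add_sub_of_le hkm]
  filter_upwards [(hψ.isWeakDeriv k).weakDeriv_ae_eq] with x hx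
  rw [hx, a3]

end GJF

end

theorem theorem5p4 (k : ℕ) (hk : 1 ≤ k) (s : ℝ) (hs₁ : (k : ℝ) - 1 < s) (hs₂ : s < k) :
    ∃ (C : ℝ) (c : ℕ → ℝ), 0 < C ∧ (∀ m, 0 < c m) ∧
      ∀ (m N : ℕ) (f u uN : ℝ → ℝ), m ≤ N →
        GJF.IsWeakSolution s k f u → GJF.IsDiscreteSolution s k N f uN →
        (GJF.MemB s k m u →
          GJF.normU s k (fun x => u x - uN x) ≤
              c m * (N : ℝ) ^ (-(m : ℤ)) *
                GJF.normL2w m (s - k + m) (GJF.rlDeriv (s + m) u) ∧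
          GJF.normU s k (fun x => u x - uN x) ≤
              C * √((N : ℝ) ^ (-(m : ℤ)) *
                  ((Nat.factorial (N - m + 1) : ℝ) / (Nat.factorial (N + 1) : ℝ))) *
                GJF.normL2w m (s - k + m) (GJF.rlDeriv (s + m) u)) ∧
        (k ≤ m → GJF.HasWeakDeriv (m - k) f →
          GJF.MemL2w m (s - k + m) (GJF.weakDeriv (m - k) f) →
          GJF.normU s k (fun x => u x - uN x) ≤
              c m * (N : ℝ) ^ (-(m : ℤ)) *
                GJF.normL2w m (s - k + m) (GJF.weakDeriv (m - k) f) ∧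
          GJF.normU s k (fun x => u x - uN x) ≤
              C * √((N : ℝ) ^ (-(m : ℤ)) *
                  ((Nat.factorial (N - m + 1) : ℝ) / (Nat.factorial (N + 1) : ℝ))) *
                GJF.normL2w m (s - k + m) (GJF.weakDeriv (m - k) f)) := by
  have hc := inv_pos.2 (GJF.fracEigen_pos hs₁ 0)
  -- In `C`, the reciprocal of the lowest eigenvalue bounds the `L²` part of the `U` norm and the
  -- `1` accounts for the derivative part. The extra factor of `c m` is the price of replacing the
  -- factorial quotient by a power of `N`.
  refine ⟨√((GJF.fracEigen s k 0)⁻¹ + 1),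
    fun m => √((GJF.fracEigen s k 0)⁻¹ + 1) * √((m : ℝ) ^ m), Real.sqrt_pos.2 (by linarith),
    fun m => mul_pos (Real.sqrt_pos.2 (by linarith)) (Real.sqrt_pos.2 ?_),
    fun m N f u uN hmN hu hN => ⟨fun hB => ?_, fun hkm hf hfm => ?_⟩⟩
  · rcases Nat.eq_zero_or_pos m with rfl | h
    · simp
    · exact pow_pos (by exact_mod_cast h) m
  · obtain ⟨hRL, hL2⟩ := hB.2 m le_rfl
    exact GJF.normU_sub_le_rates hk hs₁ hs₂ hmN hu hN hL2 (σ := 1) abs_one fun φ hφ => by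
      rw [one_mul]
      exact GJF.integral_rlDeriv_mul_iteratedDeriv hk hs₁ hs₂ hu.1.2.1 hRL hφ
  · exact GJF.normU_sub_le_rates hk hs₁ hs₂ hmN hu hN hfm (σ := (-1) ^ (m - k)) (by simp)
      fun φ hφ => hu.integral_rlDeriv_mul_iteratedDeriv hkm hf hφ
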